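/- Let $V=V_{0}\oplus V_{1}$ be a finite-dimensional real supervector space with a symplectic form $B$, i.e. a nondegenerate even skew-symmetric bilinear form: $V_0\perp V_1$, $B|_{V_0}$ is a symplectic form and $B|_{V_1}$ is a nondegenerate symmetric form of arbitrary signature. Let $(e_1,\dots,e_m,f_1,\dots,f_n)$ be an oriented symplectic basis of $V\otimes\mathbb C$: $(e_i)$ is a basis of $V_0$ with $B(e_1,e_2)=B(e_3,e_4)=\dots=1$ and the other pairs orthogonal, $(f_j)$ is an orthonormal basis of $V_1\otimes\mathbb C$ with each $f_j\in V_1\cup iV_1$, and $V_1$ is oriented by $\xi^1\cdots\xi^n$, where $(x,\xi)$ are the dual coordinates. The Liouville integral is $$\int_V d_V(v)\,\phi(v)=(2\pi)^{-m/2}\int_{\mathbb R^m}|dx^1\cdots dx^m|\;\Big(\frac{\partial}{\partial\xi^1}\cdots\frac{\partial}{\partial\xi^n}\phi\Big)(x).$$ Let $\mathfrak{spo}(V)$ be the Lie superalgebra of endomorphisms of $V$ leaving $B$ invariant, so that $\mathfrak{spo}(V)_0=\mathfrak{sp}(V_0)\oplus\mathfrak{so}(V_1)$, and let $\mathcal V^+\subset\mathfrak{spo}(V)_0$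 be the set of $(a,d)$ such that $x\mapsto B(x,ax)$ is positive definite on $V_0$. Let $\mathcal V^+\times i\,\mathfrak{spo}(V)_0\subset \mathfrak{spo}(V)_0\otimes\mathbb C$ be the set of elements with real part in $\mathcal V^+$. For a point $X=\begin{pmatrix}A&B'\\ C&D\end{pmatrix}$ of $\mathfrak{spo}(V)$ with values in a complex commutative superalgebra, whose body lies in $\mathcal V^+\times i\,\mathfrak{spo}(V)_0$, put $$\operatorname{Spf}(X)=\int_V d_V(v)\exp\!\big(-\tfrac12 B(v,Xv)\big),\qquad \operatorname{Ber}^-(X)=\det(A)^{-1}\det(D-CA^{-1}B').$$ 1. (Superfunctions.) As superfunctions on $\mathcal V^+\times i\,\mathfrak{spo}(V)_0$ (in particular on $\mathcal V^+$), i.e. as functions with values in $\Lambda(\mathfrak{spo}(V)_1^*)\otimes\mathbb C$ obtained by evaluation at $X=Y+\Xi$, with $Y\in\mathcal V^+\times i\,\mathfrak{spo}(V)_0$ and $\Xi$ the generic point of $\mathfrak{spo}(V)_1$, $$\operatorname{Spf}^2=\operatorname{Ber}^-.$$ 2. (Points.) For every near superalgebra $\mathcal P$ (a finite-dimensional local real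 commutative superalgebra with residue field $\mathbb R$), with complexification $\mathcal P_{\mathbb C}=\mathcal P\otimes\mathbb C$, and every $X\in(\mathfrak{spo}(V)\otimes\mathcal P_{\mathbb C})_0$ whose body lies in $\mathcal V^+\times i\,\mathfrak{spo}(V)_0$, $$\operatorname{Spf}(X)^2=\operatorname{Ber}^-(X).$$ In both cases the integral converges and $A$ is invertible. -/

import Mathlib

open scoped TensorProduct
open MeasureTheory

noncomputable section

namespace SuperPf

/-! ### Commutative superalgebras -/

section Superalgebra

/-- A `ℤ/2`-graded algebra is a commutative superalgebra: even elements are central and odd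
elements anticommute with each other. -/
class IsSupercommutative {K R : Type*} [CommRing K] [Ring R] [Algebra K R]
    (ℛ : ZMod 2 → Submodule K R) : Prop where
  even_comm : ∀ a ∈ ℛ 0, ∀ b : R, a * b = b * a
  odd_anticomm : ∀ a ∈ ℛ 1, ∀ b ∈ ℛ 1, a * b = -(b * a)

variable {K R : Type*} [CommRing K] [Ring R] [Algebra K R] (ℛ : ZMod 2 → Submodule K R)
  [GradedAlgebra ℛ]

/-- The even part `R₀` of a superalgebra, as a subalgebra. -/
abbrev evenPart : Subalgebra K R := SetLike.GradeZero.subalgebra ℛ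

instance evenPart.instCommRing [IsSupercommutative ℛ] : CommRing (evenPart ℛ) :=
  { (inferInstance : Ring (evenPart ℛ)) with
    mul_comm := fun a b => Subtype.ext (IsSupercommutative.even_comm (ℛ := ℛ) a.1 a.2 b.1) }

/-- A near superalgebra: a real commutative superalgebra which is finite dimensional and local,
with residue field `ℝ`. -/
class IsNear {P : Type*} [Ring P] [Algebra ℝ P] (𝒢 : ZMod 2 → Submodule ℝ P)
    [GradedAlgebra 𝒢] : Prop extends IsSupercommutative 𝒢 where
  finiteDimensional : FiniteDimensional ℝ P
  isLocalRing : IsLocalRing P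
  residue : Nonempty (P →ₐ[ℝ] ℝ)

/-- The body map of a near superalgebra: the (unique) algebra homomorphism onto the residue field
`ℝ`. -/
def body {P : Type*} [Ring P] [Algebra ℝ P] (𝒢 : ZMod 2 → Submodule ℝ P) [GradedAlgebra 𝒢]
    [IsNear 𝒢] : P →ₐ[ℝ] ℝ :=
  Classical.choice (IsNear.residue (𝒢 := 𝒢))

/-- The grading of the complexification `P_ℂ = ℂ ⊗ P`. -/
abbrev complexify {P : Type*} [Ring P] [Algebra ℝ P] (𝒢 : ZMod 2 → Submodule ℝ P) :
    ZMod 2 → Submodule ℂ (ℂ ⊗[ℝ] P) :=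
  fun i => (𝒢 i).baseChange ℂ

/-- The complexified body map `P_ℂ → ℂ`. -/
def bodyC {P : Type*} [Ring P] [Algebra ℝ P] (𝒢 : ZMod 2 → Submodule ℝ P) [GradedAlgebra 𝒢]
    [IsNear 𝒢] : ℂ ⊗[ℝ] P →ₐ[ℂ] ℂ :=
  Algebra.TensorProduct.lift (AlgHom.id ℂ ℂ) ((Algebra.ofId ℝ ℂ).comp (body 𝒢))
    (fun _ _ => Commute.all _ _)

instance complexify.isSupercommutative {P : Type*} [Ring P] [Algebra ℝ P]
    (𝒢 : ZMod 2 → Submodule ℝ P) [IsSupercommutative 𝒢] :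
    IsSupercommutative (complexify 𝒢) where
  even_comm a ha b := by
    have ha' : a ∈ (𝒢 0).baseChange ℂ := ha
    rw [Submodule.baseChange_eq_span] at ha'
    induction ha' using Submodule.span_induction with
    | mem x hx =>
      obtain ⟨p, hp, rfl⟩ := hx
      induction b using TensorProduct.induction_on with
      | zero => simp
      | tmul z q =>
        simp [Algebra.TensorProduct.tmul_mul_tmul,
          IsSupercommutative.even_comm (ℛ := 𝒢) p hp q]
      | add x y hx hy => rw [mul_add, add_mul, hx, hy]
    | zero => simp
    | add x y hx hy ihx ihy =>
      rw [← Submodule.baseChange_eq_span] at hx hy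
      rw [add_mul, mul_add, ihx hx, ihy hy]
    | smul c x hx ih =>
      rw [← Submodule.baseChange_eq_span] at hx
      rw [smul_mul_assoc, mul_smul_comm, ih hx]
  odd_anticomm a ha b hb := by
    have ha' : a ∈ (𝒢 1).baseChange ℂ := ha
    have hb' : b ∈ (𝒢 1).baseChange ℂ := hb
    clear ha hb
    rw [Submodule.baseChange_eq_span] at ha' hb'
    induction ha' using Submodule.span_induction with
    | mem x hx =>
      obtain ⟨p, hp, rfl⟩ := hx
      induction hb' using Submodule.span_induction with
      | mem y hy =>
        obtain ⟨q, hq, rfl⟩ := hy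
        simp [Algebra.TensorProduct.tmul_mul_tmul,
          IsSupercommutative.odd_anticomm (ℛ := 𝒢) p hp q hq, TensorProduct.tmul_neg]
      | zero => simp
      | add x y hx hy ihx ihy => rw [mul_add, add_mul, ihx, ihy, neg_add]
      | smul c x hx ih => rw [smul_mul_assoc, mul_smul_comm, ih, smul_neg]
    | zero => simp
    | add x y hx hy ihx ihy => rw [add_mul, mul_add, ihx, ihy, neg_add]
    | smul c x hx ih => rw [smul_mul_assoc, mul_smul_comm, ih, smul_neg]

/-- The `ℤ/2`-grading of an exterior algebra. -/
abbrev extGrading (M : Type*) [AddCommGroup M] [Module ℂ M] :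
    ZMod 2 → Submodule ℂ (ExteriorAlgebra ℂ M) :=
  CliffordAlgebra.evenOdd (0 : QuadraticForm ℂ M)

instance extGrading.isSupercommutative (M : Type*) [AddCommGroup M] [Module ℂ M] :
    IsSupercommutative (extGrading M) where
  even_comm a ha b := by
    have key : ∀ (i : ZMod 2) (c : ExteriorAlgebra ℂ M), c ∈ extGrading M i →
        a * c = c * a := by
      intro i c hc
      have h := CliffordAlgebra.commute_map_mul_map_of_isOrtho_of_mem_evenOdd_zero_left
        (QuadraticMap.Isometry.id (0 : QuadraticForm ℂ M))
        (QuadraticMap.Isometry.id (0 : QuadraticForm ℂ M))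
        (fun x y => by simp [QuadraticMap.IsOrtho]) a c ha hc
      simpa [Commute, SemiconjBy] using h
    refine DirectSum.Decomposition.inductionOn (extGrading M) ?_ ?_ ?_ b
    · simp
    · intro i m
      exact key i m.1 m.2
    · intro m m' h h'
      rw [mul_add, add_mul, h, h']
  odd_anticomm a ha b hb := by
    have h := CliffordAlgebra.map_mul_map_eq_neg_of_isOrtho_of_mem_evenOdd_one
      (QuadraticMap.Isometry.id (0 : QuadraticForm ℂ M))
      (QuadraticMap.Isometry.id (0 : QuadraticForm ℂ M))
      (fun x y => by simp [QuadraticMap.IsOrtho]) a b ha hb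
    simpa using h

end Superalgebra

/-! ### Symplectic supervector spaces -/

section Symplectic

/-- A symplectic form on the supervector space `V = V₀ ⊕ V₁`: a nondegenerate even skew symmetric
bilinear form, that is, a symplectic form on `V₀` and a nondegenerate symmetric form on `V₁`, the
two parts being orthogonal to each other. -/
structure SymplecticForm (V₀ V₁ : Type*) [AddCommGroup V₀] [Module ℝ V₀] [AddCommGroup V₁]
    [Module ℝ V₁] where
  even : LinearMap.BilinForm ℝ V₀
  odd : LinearMap.BilinForm ℝ V₁
  even_alt : even.IsAlt
  even_nondegenerate : even.Nondegenerate
  odd_symm : odd.IsSymm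
  odd_nondegenerate : odd.Nondegenerate

variable {V₀ V₁ : Type*} [AddCommGroup V₀] [Module ℝ V₀] [AddCommGroup V₁] [Module ℝ V₁]
  (B : SymplecticForm V₀ V₁)

/-- The standard symplectic `2 × 2` matrix. -/
def J₂ : Matrix (Fin 2) (Fin 2) ℝ := !![0, 1; -1, 0]

/-- A symplectic basis of `V`. The basis `e` of `V₀` consists of `k` pairs spanning orthogonal
symplectic planes. The vectors `f i = phase i ⊗ g i`, with `phase i ∈ {1, 𝐢}`, form an orthonormal
basis of `V₁ ⊗ ℂ` contained in `V₁ ∪ 𝐢 V₁`. The space `V₁` is oriented by `ξ¹ ⋯ ξⁿ`, where `ξ` is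
the basis dual to `f`. -/
structure SymplecticBasis (k n : ℕ) where
  e : Module.Basis (Fin k × Fin 2) ℝ V₀
  g : Module.Basis (Fin n) ℝ V₁
  phase : Fin n → ℂ
  even_eq : ∀ i j a b, B.even (e (i, a)) (e (j, b)) = if i = j then J₂ a b else 0
  phase_eq : ∀ i, phase i = 1 ∨ phase i = Complex.I
  odd_eq : ∀ i j, phase i * phase j * (B.odd (g i) (g j) : ℂ) = if i = j then 1 else 0

/-- The even part of `𝔤𝔩(V)`. -/
abbrev GlEven (V₀ V₁ : Type*) [AddCommGroup V₀] [Module ℝ V₀] [AddCommGroup V₁] [Module ℝ V₁] :=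
  (V₀ →ₗ[ℝ] V₀) × (V₁ →ₗ[ℝ] V₁)

/-- The odd part of `𝔤𝔩(V)`: pairs `(b, c)` with `b : V₁ → V₀` and `c : V₀ → V₁`. -/
abbrev GlOdd (V₀ V₁ : Type*) [AddCommGroup V₀] [Module ℝ V₀] [AddCommGroup V₁] [Module ℝ V₁] :=
  (V₁ →ₗ[ℝ] V₀) × (V₀ →ₗ[ℝ] V₁)

/-- `𝔰𝔭𝔬(V)₀ = 𝔰𝔭(V₀) ⊕ 𝔰𝔬(V₁)`: the even `G` such that `B(Gv, w) + B(v, Gw) = 0`. -/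
def spoEven : Submodule ℝ (GlEven V₀ V₁) where
  carrier := {G | (∀ x x', B.even (G.1 x) x' + B.even x (G.1 x') = 0) ∧
    ∀ y y', B.odd (G.2 y) y' + B.odd y (G.2 y') = 0}
  zero_mem' := by simp
  add_mem' := by
    rintro G H ⟨h₁, h₂⟩ ⟨h₃, h₄⟩
    refine ⟨fun x x' => ?_, fun y y' => ?_⟩
    · have := h₁ x x'; have := h₃ x x'
      simp only [Prod.fst_add, LinearMap.add_apply, map_add]; linarith
    · have := h₂ y y'; have := h₄ y y'
      simp only [Prod.snd_add, LinearMap.add_apply, map_add]; linarith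
  smul_mem' := by
    rintro c G ⟨h₁, h₂⟩
    refine ⟨fun x x' => ?_, fun y y' => ?_⟩
    · simp [← mul_add, h₁ x x']
    · simp [← mul_add, h₂ y y']

/-- `𝔰𝔭𝔬(V)₁`: the odd `G` such that `B(Gv, w) + (-1)^{p(v)} B(v, Gw) = 0` for homogeneous
`v`, `w`. -/
def spoOdd : Submodule ℝ (GlOdd V₀ V₁) where
  carrier := {G | (∀ x y, B.odd (G.2 x) y + B.even x (G.1 y) = 0) ∧
    ∀ y x, B.even (G.1 y) x - B.odd y (G.2 x) = 0}
  zero_mem' := by simp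
  add_mem' := by
    rintro G H ⟨h₁, h₂⟩ ⟨h₃, h₄⟩
    refine ⟨fun x y => ?_, fun y x => ?_⟩
    · have := h₁ x y; have := h₃ x y
      simp only [Prod.fst_add, Prod.snd_add, LinearMap.add_apply, map_add]; linarith
    · have := h₂ y x; have := h₄ y x
      simp only [Prod.fst_add, Prod.snd_add, LinearMap.add_apply, map_add]; linarith
  smul_mem' := by
    rintro c G ⟨h₁, h₂⟩
    refine ⟨fun x y => ?_, fun y x => ?_⟩
    · simp [← mul_add, h₁ x y]
    · simp [← mul_sub, h₂ y x]

/-- Contraction `W ⊗ S → S`, `w ⊗ s ↦ φ(w) s`, with a linear form `φ` on `W`. -/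
def contract {W S : Type*} [AddCommGroup W] [Module ℝ W] [AddCommGroup S] [Module ℝ S]
    (φ : W →ₗ[ℝ] ℝ) : W ⊗[ℝ] S →ₗ[ℝ] S :=
  (TensorProduct.lid ℝ S).toLinearMap ∘ₗ LinearMap.rTensor S φ

/-- The real part of an element of `𝔰𝔭𝔬(V)₀ ⊗ ℂ`. -/
def realPart {W : Type*} [AddCommGroup W] [Module ℝ W] : W ⊗[ℝ] ℂ →ₗ[ℝ] W :=
  (TensorProduct.rid ℝ W).toLinearMap ∘ₗ LinearMap.lTensor W Complex.reLm

/-- `𝒱⁺`: the elements `(a, d)` of `𝔰𝔭(V₀) ⊕ 𝔰𝔬(V₁)` such that the quadratic form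
`x ↦ B(x, a x)` on `V₀` is positive definite. -/
def posCone : Set (spoEven B) :=
  {G | ∀ x : V₀, x ≠ 0 → 0 < B.even x (G.1.1 x)}

/-- The tube `𝒱⁺ × 𝐢 𝔰𝔭𝔬(V)₀` in `𝔰𝔭𝔬(V)₀ ⊗ ℂ`. -/
def tube : Set (spoEven B ⊗[ℝ] ℂ) :=
  {Y | realPart Y ∈ posCone B}

section Points

variable {R : Type*} [Ring R] [Algebra ℂ R] (ℛ : ZMod 2 → Submodule ℂ R) [GradedAlgebra ℛ]

/-- The set `(𝔰𝔭𝔬(V) ⊗ R)₀` of points of `𝔰𝔭𝔬(V)` with values in the complex superalgebra `R`. -/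
structure SpoPoint where
  even : spoEven B ⊗[ℝ] evenPart ℛ
  odd : spoOdd B ⊗[ℝ] ℛ 1

variable {B ℛ}

/-- The body of an `R`-valued point of `𝔰𝔭𝔬(V)`, in `𝔰𝔭𝔬(V)₀ ⊗ ℂ`. -/
def SpoPoint.body (b : R →ₐ[ℂ] ℂ) (X : SpoPoint B ℛ) : spoEven B ⊗[ℝ] ℂ :=
  LinearMap.lTensor (spoEven B) ((b.toLinearMap ∘ₗ (evenPart ℛ).val.toLinearMap).restrictScalars ℝ)
    X.even

variable {k n : ℕ} (β : SymplecticBasis B k n)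

/-- The block of `X` in `𝔤𝔩(V₀) ⊗ R₀`, as a matrix. Matrices are taken in the real basis `(e, g)`
of `V`, with the convention `X g_j = ∑ i, g_i X_ij`. -/
def SpoPoint.blockA (X : SpoPoint B ℛ) : Matrix (Fin k × Fin 2) (Fin k × Fin 2) (evenPart ℛ) :=
  fun i j => contract (β.e.coord i ∘ₗ LinearMap.applyₗ (β.e j) ∘ₗ
    LinearMap.fst ℝ _ _ ∘ₗ (spoEven B).subtype) X.even

/-- The block of `X` in `𝔤𝔩(V₁) ⊗ R₀`. -/
def SpoPoint.blockD (X : SpoPoint B ℛ) : Matrix (Fin n) (Fin n) (evenPart ℛ) :=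
  fun i j => contract (β.g.coord i ∘ₗ LinearMap.applyₗ (β.g j) ∘ₗ
    LinearMap.snd ℝ _ _ ∘ₗ (spoEven B).subtype) X.even

/-- The block of `X` in `Hom(V₁, V₀) ⊗ R₁`. The sign comes from the rule of signs,
`(G ⊗ p) g_j = - G g_j ⊗ p` for odd `p` and odd `g_j`. -/
def SpoPoint.blockB (X : SpoPoint B ℛ) : Matrix (Fin k × Fin 2) (Fin n) (ℛ 1) :=
  fun i j => -contract (β.e.coord i ∘ₗ LinearMap.applyₗ (β.g j) ∘ₗ
    LinearMap.fst ℝ _ _ ∘ₗ (spoOdd B).subtype) X.odd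

/-- The block of `X` in `Hom(V₀, V₁) ⊗ R₁`. -/
def SpoPoint.blockC (X : SpoPoint B ℛ) : Matrix (Fin n) (Fin k × Fin 2) (ℛ 1) :=
  fun i j => contract (β.g.coord i ∘ₗ LinearMap.applyₗ (β.e j) ∘ₗ
    LinearMap.snd ℝ _ _ ∘ₗ (spoOdd B).subtype) X.odd

/-- The product of an odd, an even and an odd element is even. -/
def oddEvenOdd (c : ℛ 1) (a : evenPart ℛ) (b : ℛ 1) : evenPart ℛ :=
  ⟨c.1 * a.1 * b.1, SetLike.mul_mem_graded (SetLike.mul_mem_graded c.2 a.2) b.2⟩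

variable [IsSupercommutative ℛ]

/-- The matrix `D - C A⁻¹ B` with entries in the commutative ring `R₀`. -/
def SpoPoint.schur (X : SpoPoint B ℛ) : Matrix (Fin n) (Fin n) (evenPart ℛ) :=
  fun i j => X.blockD β i j -
    ∑ l, ∑ l', oddEvenOdd (X.blockC β i l) ((X.blockA β)⁻¹ l l') (X.blockB β l' j)

/-- The inverse Berezinian `Ber⁻(X) = det(A)⁻¹ det(D - C A⁻¹ B)`, defined when `A` is
invertible. -/
def SpoPoint.invBer (X : SpoPoint B ℛ) : R :=
  ((Ring.inverse (X.blockA β).det * (X.schur β).det : evenPart ℛ) : R)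


end Points

/-! ### The superPfaffian -/

section Integral

variable {R : Type*} [Ring R] [Algebra ℂ R] (ℛ : ZMod 2 → Submodule ℂ R) [GradedAlgebra ℛ]

/-- `Λ(V₁*) ⊗ R`, where `Λ(V₁*) ⊗ ℂ` is the exterior algebra on the odd coordinates
`ξ¹, …, ξⁿ`. The tensor product is the graded one, so that `ξⁱ` anticommutes with the odd
elements of `R`. An `R`-valued function on `V` is a function of `x ∈ V₀` with values in this
algebra. -/
abbrev OddFun (n : ℕ) : Type _ :=
  GradedTensorProduct ℂ (extGrading (Fin n → ℂ)) ℛ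

/-- The odd coordinate `ξⁱ`. -/
def oddCoord {n : ℕ} (i : Fin n) : OddFun ℛ n :=
  GradedTensorProduct.includeLeft (extGrading (Fin n → ℂ)) ℛ
    (ExteriorAlgebra.ι ℂ (Pi.single i 1))

/-- The elements of `R` as constant functions. -/
def const (n : ℕ) : R →ₐ[ℂ] OddFun ℛ n :=
  GradedTensorProduct.includeRight (extGrading (Fin n → ℂ)) ℛ

/-- The Berezin integral `∂/∂ξ¹ ⋯ ∂/∂ξⁿ` on `Λ(ξ¹, …, ξⁿ)`: it vanishes in degrees other than `n`
and takes the value `(-1)^{n(n-1)/2}` on `ξ¹ ⋯ ξⁿ`. -/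
def berezin (n : ℕ) : ExteriorAlgebra ℂ (Fin n → ℂ) →ₗ[ℂ] ℂ :=
  ExteriorAlgebra.liftAlternating
    (Pi.single n ((-1 : ℂ) ^ (n * (n - 1) / 2) • (Pi.basisFun ℂ (Fin n)).det))

/-- The Berezin integral with values in `R`: `∑ ξ^I φ_I ↦ (-1)^{n(n-1)/2} φ_{(1, …, 1)}`. -/
def berezinR (n : ℕ) : OddFun ℛ n →ₗ[ℂ] R :=
  (TensorProduct.lid ℂ R).toLinearMap ∘ₗ LinearMap.rTensor R (berezin n) ∘ₗ
    (GradedTensorProduct.of ℂ (extGrading (Fin n → ℂ)) ℛ).symm.toLinearMap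

/-- The body map of `Λ(V₁*) ⊗ R`. -/
def oddBody (b : R →ₐ[ℂ] ℂ) (n : ℕ) : OddFun ℛ n →ₗ[ℂ] ℂ :=
  (TensorProduct.lid ℂ ℂ).toLinearMap ∘ₗ
    TensorProduct.map (ExteriorAlgebra.algebraMapInv (R := ℂ) (M := Fin n → ℂ)).toLinearMap
      b.toLinearMap ∘ₗ
    (GradedTensorProduct.of ℂ (extGrading (Fin n → ℂ)) ℛ).symm.toLinearMap

/-- The exponential of an element with body `z` and nilpotent soul `s`:
`exp(z + s) = e^z ∑ sʲ / j!`. -/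
def superExp (b : R →ₐ[ℂ] ℂ) {n : ℕ} (α : OddFun ℛ n) : OddFun ℛ n :=
  let z := oddBody ℛ b n α
  let s := α - algebraMap ℂ _ z
  Complex.exp z • ∑ j ∈ Finset.range (nilpotencyClass s), ((j.factorial : ℂ)⁻¹) • s ^ j

variable {B ℛ} {k n : ℕ} (β : SymplecticBasis B k n)

/-- The coordinates `zⁱ`, dual to the basis `(e, g)` of `V`, at the point of `V₀` with coordinates
`x`. As `f j = phase j ⊗ g j`, the coordinate dual to `g j` is `phase j • ξʲ`. -/
def coordFun (ℛ : ZMod 2 → Submodule ℂ R) [GradedAlgebra ℛ] (x : Fin k × Fin 2 → ℝ) :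
    (Fin k × Fin 2) ⊕ Fin n → OddFun ℛ n
  | .inl i => algebraMap ℂ _ (x i : ℂ)
  | .inr j => β.phase j • oddCoord ℛ j

/-- The coefficients `B(g_i, G g_j) ⊗ p ∈ R` of a point `X = ∑ G ⊗ p`, in the basis
`(e, g)` of `V`. -/
def SpoPoint.pairing (X : SpoPoint B ℛ) :
    (Fin k × Fin 2) ⊕ Fin n → (Fin k × Fin 2) ⊕ Fin n → R
  | .inl i, .inl j => (contract (B.even (β.e i) ∘ₗ LinearMap.applyₗ (β.e j) ∘ₗ
      LinearMap.fst ℝ _ _ ∘ₗ (spoEven B).subtype) X.even : evenPart ℛ)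
  | .inr i, .inr j => (contract (B.odd (β.g i) ∘ₗ LinearMap.applyₗ (β.g j) ∘ₗ
      LinearMap.snd ℝ _ _ ∘ₗ (spoEven B).subtype) X.even : evenPart ℛ)
  | .inl i, .inr j => (contract (B.even (β.e i) ∘ₗ LinearMap.applyₗ (β.g j) ∘ₗ
      LinearMap.fst ℝ _ _ ∘ₗ (spoOdd B).subtype) X.odd : ℛ 1)
  | .inr i, .inl j => (contract (B.odd (β.g i) ∘ₗ LinearMap.applyₗ (β.e j) ∘ₗ
      LinearMap.snd ℝ _ _ ∘ₗ (spoOdd B).subtype) X.odd : ℛ 1)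

/-- The moment map `μ(X, v) = -½ B(v, X v)`, `v` being the generic point of `V`. For
`X = ∑ G_k Z^k` it is `-½ ∑ B(g_i, G_k g_j) zʲ Z^k zⁱ`. -/
def SpoPoint.moment (X : SpoPoint B ℛ) (x : Fin k × Fin 2 → ℝ) : OddFun ℛ n :=
  (-(1 / 2) : ℂ) • ∑ i, ∑ j,
    coordFun β ℛ x j * const ℛ n (X.pairing β i j) * coordFun β ℛ x i

/-- The integral over `V₁` of `exp(μ(X, v))`, as a function of `x ∈ V₀`. -/
def SpoPoint.integrand (b : R →ₐ[ℂ] ℂ) (X : SpoPoint B ℛ) (x : Fin k × Fin 2 → ℝ) : R :=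
  berezinR ℛ n (superExp ℛ b (X.moment β x))

/-- The integral of a function with values in a finite dimensional complex vector space `E`,
coordinate by coordinate. -/
def vectorIntegral {Ω E : Type*} [MeasureSpace Ω] [AddCommGroup E] [Module ℂ E] (f : Ω → E) : E :=
  ∑ᶠ i, (∫ x, (Module.Basis.ofVectorSpace ℂ E).repr (f x) i) • Module.Basis.ofVectorSpace ℂ E i

/-- Convergence of the integral of a function with values in a complex vector space. -/
def Converges {Ω E : Type*} [MeasureSpace Ω] [AddCommGroup E] [Module ℂ E] (f : Ω → E) : Prop :=
  ∀ l : E →ₗ[ℂ] ℂ, Integrable (fun x => l (f x))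

/-- The superPfaffian `Spf(X) = ∫_V d_V(v) exp(-½ B(v, X v))`, where `d_V` is the Liouville
integral of `V`: the product of `(2π)^{-k} |dx|` on `V₀` and of the Berezin integral on `V₁`. -/
def SpoPoint.superPf (b : R →ₐ[ℂ] ℂ) (X : SpoPoint B ℛ) : R :=
  (((2 * Real.pi) ^ k : ℝ) : ℂ)⁻¹ • vectorIntegral (X.integrand β b)

end Integral

/-! ### The superPfaffian as a superfunction -/

section Generic

/-- `Λ(𝔰𝔭𝔬(V)₁*) ⊗ ℂ`. A superfunction on an open subset of `𝔰𝔭𝔬(V)₀ ⊗ ℂ` is a function with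
values in this algebra. -/
abbrev LambdaSpo : Type _ := ExteriorAlgebra ℂ (spoOdd B →ₗ[ℝ] ℂ)

variable [FiniteDimensional ℝ V₀] [FiniteDimensional ℝ V₁]

/-- The generic point of `𝔰𝔭𝔬(V)` over `Y ∈ 𝔰𝔭𝔬(V)₀ ⊗ ℂ`: the sum of `Y` and of
`∑ G_k ⊗ Z^k`, where `G` is a basis of `𝔰𝔭𝔬(V)₁` and `Z` is the dual basis. -/
def genericPoint (Y : spoEven B ⊗[ℝ] ℂ) : SpoPoint B (extGrading (spoOdd B →ₗ[ℝ] ℂ)) where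
  even := LinearMap.lTensor (spoEven B)
    ((Algebra.linearMap ℂ (evenPart (extGrading (spoOdd B →ₗ[ℝ] ℂ)))).restrictScalars ℝ) Y
  odd := ∑ i, Module.finBasis ℝ (spoOdd B) i ⊗ₜ[ℝ]
    ⟨ExteriorAlgebra.ι ℂ (Complex.ofRealCLM.toLinearMap ∘ₗ (Module.finBasis ℝ (spoOdd B)).coord i),
      CliffordAlgebra.ι_mem_evenOdd_one _ _⟩

variable {B} {k n : ℕ} (β : SymplecticBasis B k n)

/-- The superPfaffian, as a superfunction on the tube `𝒱⁺ × 𝐢 𝔰𝔭𝔬(V)₀`. -/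
def superPfFun : tube B → LambdaSpo B :=
  fun Y => (genericPoint B Y).superPf β ExteriorAlgebra.algebraMapInv

/-- The inverse Berezinian, as a superfunction on the tube. -/
def invBerFun : tube B → LambdaSpo B :=
  fun Y => (genericPoint B Y).invBer β

end Generic

end Symplectic

end SuperPf

end

/-! The moment `-½ B(v, X v)` is a quadratic polynomial in the real coordinates `x` of `V₀`. Its
coefficients are a symmetric matrix `S = formEven` over `R₀`, linear coefficients `ℓᵢ = ∑ bᵢⱼ ξʲ`,
and a quadratic term in `ξ`. A product of two odd elements is even, so `S` and `ℓ` lie in the center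
of `Λ(ξ) ⊗ R`, a commutative ring in which the square can be completed (`moment_eq_gaussExponent`):
the exponent becomes `-½ (x - w)ᵀ S (x - w) + ½ ∑ Nᵢⱼ ξⁱ ξʲ`, with `w = S⁻¹ ℓ` nilpotent and `N =
pfaffMatrix` antisymmetric. The integrand is then an even Gaussian times an odd one.

Even factor (`gaussian_integral`). Over a finite dimensional commutative algebra, write `J(w)` for
the Gaussian integral with shift `w`. Deform `(S, w)` linearly to `(1, 0)`. Integration by parts
gives `J` the logarithmic derivative `-½ tr(S⁻¹ S')`, with no contribution from the shift, so `J(w)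
J(w') det S` is constant, equal to `(2π)^m`. No square root has to be chosen. Comparing with `w' =
0` shows that `J(w)` does not depend on `w`; it is therefore an element of `R₀`, and passes through
the Berezin integral.

Odd factor (`exists_berezinR_nilExp_eq`). The Berezin integral of the odd Gaussian is a Pfaffian of
`N` up to sign. Its square is `det N` by a doubling of the variables (`exists_quadElt_pow_eq`).

Linear algebra. `S` is the Gram matrix of `V₀`, of determinant `1`, times `A`; hence `det S = det
A`. Similarly `N` is the Gram matrix of `V₁` times `D - C A⁻¹ B`, multiplied on both sides by the
phases, which normalize the Gram matrix; hence `det N = det (D - C A⁻¹ B)` (`det_formEven`,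
`det_pfaffMatrix`). Everything is assembled in `converges_and_superPf_sq`. Its remaining hypothesis,
that `S` minus its body is nilpotent, is immediate at a generic point and follows from locality over
a near superalgebra. -/

namespace SuperPf

noncomputable section

/-! ### Exponentials of nilpotent elements -/

section NilExp

variable {A A' : Type*} [Ring A] [Algebra ℂ A] [Ring A'] [Algebra ℂ A']

/-- The exponential of a nilpotent element of a complex algebra. -/
def nilExp (s : A) : A :=
  ∑ j ∈ Finset.range (nilpotencyClass s), ((j.factorial : ℂ)⁻¹) • s ^ j

theorem nilExp_eq_isNilpotent_exp [Module ℚ A] (s : A) : nilExp s = IsNilpotent.exp s :=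
  Finset.sum_congr rfl fun _ _ => inv_natCast_smul_eq ℂ ℚ _ _

/-- The cutoff built into `nilExp` depends on the element, and is `0` for an element that is not
nilpotent. Freedom to enlarge it lets sums for different elements be compared, in particular under a
homomorphism which lowers the nilpotency class. -/
theorem nilExp_eq_sum {s : A} {K : ℕ} (h : s ^ K = 0) :
    nilExp s = ∑ j ∈ Finset.range K, ((j.factorial : ℂ)⁻¹) • s ^ j := by
  let : Module ℚ A := Module.compHom A (algebraMap ℚ ℂ)
  rw [nilExp_eq_isNilpotent_exp, IsNilpotent.exp_eq_sum h]
  exact Finset.sum_congr rfl fun _ _ => (inv_natCast_smul_eq ℂ ℚ _ _).symm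

theorem nilExp_add {s t : A} (h : Commute s t) (hs : IsNilpotent s) (ht : IsNilpotent t) :
    nilExp (s + t) = nilExp s * nilExp t := by
  let : Module ℚ A := Module.compHom A (algebraMap ℚ ℂ)
  simp only [nilExp_eq_isNilpotent_exp]
  exact IsNilpotent.exp_add_of_commute h hs ht

theorem map_nilExp (f : A →ₐ[ℂ] A') {s : A} (hs : IsNilpotent s) :
    f (nilExp s) = nilExp (f s) := by
  obtain ⟨K, hK⟩ := hs
  rw [nilExp_eq_sum hK, nilExp_eq_sum (K := K) (by rw [← map_pow, hK, map_zero])]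
  simp [map_sum]

theorem nilExp_eq_exp {A : Type*} [NormedRing A] [NormedAlgebra ℂ A]
    {s : A} (hs : IsNilpotent s) : nilExp s = NormedSpace.exp s := by
  obtain ⟨K, hK⟩ := hs
  rw [nilExp_eq_sum hK, NormedSpace.exp_eq_tsum ℂ]
  refine (tsum_eq_sum fun j hj => ?_).symm
  rw [pow_eq_zero_of_le (by simpa using hj) hK, smul_zero]

end NilExp

/-! ### Integrals with values in finite dimensional spaces -/

section VectorIntegral

variable {Ω E F : Type*} [MeasureSpace Ω] [AddCommGroup E] [Module ℂ E] [FiniteDimensional ℂ E]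
  [AddCommGroup F] [Module ℂ F] [FiniteDimensional ℂ F]

/-- Linear functionals separate points, so this property characterizes the integral independently of
the basis used to define it. -/
theorem apply_vectorIntegral (l : E →ₗ[ℂ] ℂ) {f : Ω → E} (hf : Converges f) :
    l (vectorIntegral f) = ∫ x, l (f x) := by
  have : Finite (Module.Basis.ofVectorSpaceIndex ℂ E) :=
    Module.Finite.finite_basis (Module.Basis.ofVectorSpace ℂ E)
  let : Fintype (Module.Basis.ofVectorSpaceIndex ℂ E) := Fintype.ofFinite _
  set b := Module.Basis.ofVectorSpace ℂ E
  have key : ∀ x, l (f x) = ∑ i, b.coord i (f x) * l (b i) := fun x => by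
    have h := congrArg l (b.sum_repr (f x))
    rw [map_sum] at h
    rw [← h]
    simp
  simp_rw [key]
  rw [integral_finsetSum _ fun i _ => (hf (b.coord i)).mul_const _]
  unfold vectorIntegral
  rw [finsum_eq_sum_of_fintype, map_sum]
  refine Finset.sum_congr rfl fun i _ => ?_
  rw [integral_mul_const, map_smul, smul_eq_mul]
  rfl

theorem eq_of_forall_dual {E : Type*} [AddCommGroup E] [Module ℂ E] {u v : E}
    (h : ∀ l : E →ₗ[ℂ] ℂ, l u = l v) : u = v :=
  (Module.forall_dual_apply_eq_zero_iff ℂ (u - v)).1 (fun l => by simp [h l]) |> sub_eq_zero.1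

theorem Converges.map {E F : Type*} [AddCommGroup E] [Module ℂ E] [AddCommGroup F] [Module ℂ F]
    {f : Ω → E} (hf : Converges f) (T : E →ₗ[ℂ] F) :
    Converges fun x => T (f x) := fun l => hf (l ∘ₗ T)

theorem map_vectorIntegral {f : Ω → E} (hf : Converges f) (T : E →ₗ[ℂ] F) :
    T (vectorIntegral f) = vectorIntegral fun x => T (f x) :=
  eq_of_forall_dual fun l => by
    rw [apply_vectorIntegral l (hf.map T)]
    exact apply_vectorIntegral (l ∘ₗ T) hf

theorem converges_of_integrable {E : Type*} [NormedAddCommGroup E] [NormedSpace ℂ E]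
    [FiniteDimensional ℂ E] {f : Ω → E} (hf : Integrable f) : Converges f := fun l =>
  (LinearMap.toContinuousLinearMap l).integrable_comp hf

theorem vectorIntegral_eq_integral {E : Type*} [NormedAddCommGroup E] [NormedSpace ℂ E]
    [FiniteDimensional ℂ E] {f : Ω → E} (hf : Integrable f) : vectorIntegral f = ∫ x, f x := by
  have : CompleteSpace E := FiniteDimensional.complete ℂ E
  refine eq_of_forall_dual fun l => ?_
  rw [apply_vectorIntegral l (converges_of_integrable hf)]
  exact (LinearMap.toContinuousLinearMap l).integral_comp_comm hf

end VectorIntegral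

/-! ### Norms on finite dimensional algebras -/

/-- A finite dimensional complex commutative algebra has a compatible norm, induced from its
regular representation. -/
theorem exists_normedCommRing (Q : Type*) [hQ : CommRing Q] [hA : Algebra ℂ Q]
    [FiniteDimensional ℂ Q] :
    ∃ (i : NormedCommRing Q) (j : NormedAlgebra ℂ Q),
      i.toCommRing = hQ ∧ HEq j.toAlgebra hA := by
  classical
  let b := Module.finBasis ℂ Q
  let : NormedRing (Matrix (Fin (Module.finrank ℂ Q)) (Fin (Module.finrank ℂ Q)) ℂ) :=
    Matrix.linftyOpNormedRing
  let : NormedAlgebra ℂ (Matrix (Fin (Module.finrank ℂ Q)) (Fin (Module.finrank ℂ Q)) ℂ) :=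
    Matrix.linftyOpNormedAlgebra
  let f := Algebra.leftMulMatrix b
  let i : NormedCommRing Q := NormedCommRing.induced Q _ f (Algebra.leftMulMatrix_injective b)
  -- The norm extends the given structures definitionally, so a norm-free statement can be proved
  -- with this norm and transported back by substitution.
  exact ⟨i, NormedAlgebra.induced ℂ Q _ f, rfl, HEq.rfl⟩

end

end SuperPf

namespace SuperPf

noncomputable section

/-! ### Gaussian integrals over a commutative algebra -/

section Gaussian

variable {ι : Type*} [Fintype ι]

/-- The quadratic form `∑ i j, S i j y i y j`. -/
def quad {Q : Type*} [CommRing Q] (S : Matrix ι ι Q) (y : ι → Q) : Q :=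
  ∑ i, ∑ j, S i j * y i * y j

/-- The argument `x - w` of a shifted Gaussian. -/
def shifted {Q : Type*} [CommRing Q] [Algebra ℂ Q] (w : ι → Q) (x : ι → ℝ) (i : ι) : Q :=
  algebraMap ℂ Q (x i) - w i

/-- The exponent `-½ ∑ i j, S i j (x i - w i) (x j - w j)`. -/
def gaussExponent {Q : Type*} [CommRing Q] [Algebra ℂ Q] (S : Matrix ι ι Q) (w : ι → Q)
    (x : ι → ℝ) : Q :=
  (-(1 / 2) : ℂ) • quad S (shifted w x)

theorem map_quad {Q Q' : Type*} [CommRing Q] [CommRing Q'] (f : Q →+* Q') (S : Matrix ι ι Q)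
    (y : ι → Q) : f (quad S y) = quad (S.map f) (f ∘ y) := by
  simp [quad, map_sum]

/-- Jacobi's formula: the product rule replaces one column at a time by its derivative, and Cramer's
rule expresses these determinants through the adjugate. -/
theorem det_hasDerivAt [DecidableEq ι] {Q : Type*} [NormedCommRing Q] [NormedAlgebra ℝ Q]
    {S : ℝ → Matrix ι ι Q}
    {S' : Matrix ι ι Q} {u : ℝ} (h : ∀ i j, HasDerivAt (fun v => S v i j) (S' i j) u) :
    HasDerivAt (fun v => (S v).det) ((S u).adjugate * S').trace u := by
  have h1 : HasDerivAt (fun v => ∑ σ : Equiv.Perm ι, Equiv.Perm.sign σ • ∏ i, S v (σ i) i)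
      (∑ σ : Equiv.Perm ι, Equiv.Perm.sign σ •
        ∑ i, (∏ j ∈ Finset.univ.erase i, S u (σ j) j) • S' (σ i) i) u := by
    refine HasDerivAt.fun_sum fun σ _ => ?_
    simp only [Units.smul_def, zsmul_eq_mul]
    exact (HasDerivAt.fun_finsetProd (fun i _ => h (σ i) i)).const_mul _
  simp_rw [Matrix.det_apply]
  convert h1 using 1
  have h2 : ((S u).adjugate * S').trace =
      ∑ i, ((S u).updateCol i (fun k => S' k i)).det := by
    refine Finset.sum_congr rfl fun i _ => ?_
    rw [← Matrix.cramer_apply, Matrix.cramer_eq_adjugate_mulVec]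
    simp [Matrix.mul_apply, Matrix.mulVec, dotProduct]
  rw [h2]
  simp_rw [Matrix.det_apply, Finset.smul_sum]
  rw [Finset.sum_comm]
  refine Finset.sum_congr rfl fun σ _ => Finset.sum_congr rfl fun i _ => ?_
  congr 1
  rw [← Finset.prod_erase_mul _ _ (Finset.mem_univ i), smul_eq_mul]
  congr 1
  · refine Finset.prod_congr rfl fun j hj => ?_
    rw [Matrix.updateCol_ne (Finset.ne_of_mem_erase hj)]
  · simp

/-- `ε` is the minimum of the form on the compact Euclidean unit sphere; homogeneity extends the
bound to all vectors. -/
theorem exists_le_quadratic (q : Matrix ι ι ℝ)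
    (hq : ∀ x : ι → ℝ, x ≠ 0 → 0 < ∑ i, ∑ j, q i j * x i * x j) :
    ∃ ε : ℝ, 0 < ε ∧ ∀ x : ι → ℝ, ε * ∑ i, x i ^ 2 ≤ ∑ i, ∑ j, q i j * x i * x j := by
  classical
  set Qf : (ι → ℝ) → ℝ := fun x => ∑ i, ∑ j, q i j * x i * x j
  have hQc : Continuous Qf := by fun_prop
  have hQs : ∀ (c : ℝ) x, Qf (c • x) = c ^ 2 * Qf x := fun c x => by
    simp only [Qf, Finset.mul_sum, Pi.smul_apply, smul_eq_mul]
    exact Finset.sum_congr rfl fun i _ => Finset.sum_congr rfl fun j _ => by ring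
  have hcomp : IsCompact {x : ι → ℝ | ∑ i, x i ^ 2 = 1} := by
    refine (isCompact_closedBall (0 : ι → ℝ) 1).of_isClosed_subset
      (isClosed_eq (by fun_prop) continuous_const) fun x hx => ?_
    rw [mem_closedBall_zero_iff, pi_norm_le_iff_of_nonneg zero_le_one]
    intro i
    have : x i ^ 2 ≤ 1 := by
      rw [← show ∑ i, x i ^ 2 = 1 from hx]
      exact Finset.single_le_sum (f := fun i => x i ^ 2) (fun _ _ => sq_nonneg _)
        (Finset.mem_univ i)
    exact abs_le_one_iff_mul_self_le_one.2 (by nlinarith)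
  rcases Set.eq_empty_or_nonempty {x : ι → ℝ | ∑ i, x i ^ 2 = 1} with he | hne
  -- If the sphere is empty, every vector is zero and any `ε` works.
  · refine ⟨1, one_pos, fun x => ?_⟩
    have hx0 : x = 0 := by
      by_contra hx
      have hs : 0 < ∑ i, x i ^ 2 := by
        obtain ⟨i, hi⟩ := Function.ne_iff.1 hx
        exact Finset.sum_pos' (fun _ _ => sq_nonneg _)
          ⟨i, Finset.mem_univ _, by have : x i ≠ 0 := hi; positivity⟩
      have : (Real.sqrt (∑ i, x i ^ 2))⁻¹ • x ∈ {x : ι → ℝ | ∑ i, x i ^ 2 = 1} := by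
        simp only [Set.mem_ofPred_eq, Pi.smul_apply, smul_eq_mul, mul_pow, ← Finset.mul_sum,
          inv_pow, Real.sq_sqrt hs.le]
        exact inv_mul_cancel₀ hs.ne'
      rw [he] at this
      exact this
    simp [hx0]
  · obtain ⟨x₀, hx₀, hmin⟩ := hcomp.exists_isMinOn hne hQc.continuousOn
    have hx₀0 : x₀ ≠ 0 := by
      rintro rfl
      simp at hx₀
    refine ⟨Qf x₀, hq x₀ hx₀0, fun x => ?_⟩
    by_cases hx : x = 0
    · simp [hx]
    have hs : 0 < ∑ i, x i ^ 2 := by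
      obtain ⟨i, hi⟩ := Function.ne_iff.1 hx
      exact Finset.sum_pos' (fun _ _ => sq_nonneg _)
        ⟨i, Finset.mem_univ _, by have : x i ≠ 0 := hi; positivity⟩
    have hmem : (Real.sqrt (∑ i, x i ^ 2))⁻¹ • x ∈ {x : ι → ℝ | ∑ i, x i ^ 2 = 1} := by
      simp only [Set.mem_ofPred_eq, Pi.smul_apply, smul_eq_mul, mul_pow, ← Finset.mul_sum,
        inv_pow, Real.sq_sqrt hs.le]
      exact inv_mul_cancel₀ hs.ne'
    have h := hmin hmem
    simp only [Set.mem_ofPred_eq, hQs, inv_pow, Real.sq_sqrt hs.le] at h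
    rwa [inv_mul_eq_div, le_div_iff₀ hs] at h

theorem one_add_norm_pow_le (N : ℕ) {a : ℝ} (ha : 0 < a) :
    ∃ C : ℝ, 0 ≤ C ∧ ∀ x : ι → ℝ, (1 + ‖x‖) ^ N ≤ C * Real.exp (a * ∑ i, x i ^ 2) := by
  -- The constant comes from `t ^ N ≤ N! exp t` at `t = 1 + ‖x‖`, together with `‖x‖ ≤ 1 / (4a) + a
  -- ‖x‖²`.
  refine ⟨N.factorial * Real.exp (1 + 1 / (4 * a)), by positivity, fun x => ?_⟩
  have hsq : ‖x‖ ^ 2 ≤ ∑ i, x i ^ 2 := by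
    have hs : 0 ≤ ∑ i, x i ^ 2 := Finset.sum_nonneg fun _ _ => sq_nonneg _
    have : ‖x‖ ≤ Real.sqrt (∑ i, x i ^ 2) := by
      rw [pi_norm_le_iff_of_nonneg (Real.sqrt_nonneg _)]
      intro i
      refine Real.abs_le_sqrt ?_
      exact Finset.single_le_sum (f := fun i => x i ^ 2) (fun _ _ => sq_nonneg _)
        (Finset.mem_univ i)
    calc ‖x‖ ^ 2 ≤ Real.sqrt (∑ i, x i ^ 2) ^ 2 := by gcongr
      _ = _ := Real.sq_sqrt hs
  have h1 : (1 + ‖x‖) ^ N ≤ N.factorial * Real.exp (1 + ‖x‖) := by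
    have := Real.pow_div_factorial_le_exp (1 + ‖x‖) (by positivity) N
    rwa [div_le_iff₀' (by positivity)] at this
  have h2 : ‖x‖ ≤ 1 / (4 * a) + a * ∑ i, x i ^ 2 := by
    have h3 : ‖x‖ ≤ 1 / (4 * a) + a * ‖x‖ ^ 2 := by
      have h4 : 1 / (4 * a) + a * ‖x‖ ^ 2 - ‖x‖ = (2 * a * ‖x‖ - 1) ^ 2 / (4 * a) := by
        field_simp
        ring
      have : 0 ≤ (2 * a * ‖x‖ - 1) ^ 2 / (4 * a) := by positivity
      linarith
    have := mul_le_mul_of_nonneg_left hsq ha.le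
    linarith
  calc (1 + ‖x‖) ^ N ≤ N.factorial * Real.exp (1 + ‖x‖) := h1
    _ ≤ N.factorial * Real.exp ((1 + 1 / (4 * a)) + a * ∑ i, x i ^ 2) := by
        refine mul_le_mul_of_nonneg_left (Real.exp_le_exp.2 ?_) (by positivity)
        linarith
    _ = _ := by rw [Real.exp_add, mul_assoc]

theorem integrable_exp_neg_mul_sum_sq {a : ℝ} (ha : 0 < a) :
    Integrable fun x : ι → ℝ => Real.exp (-a * ∑ i, x i ^ 2) := by
  have := Integrable.fintype_prod (f := fun (_ : ι) (y : ℝ) => Real.exp (-a * y ^ 2))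
    fun _ => integrable_exp_neg_mul_sq ha
  simp only [Finset.mul_sum, Real.exp_sum]
  exact this

theorem integral_exp_neg_half_sum_sq :
    (∫ x : ι → ℝ, Real.exp (-(1 / 2) * ∑ i, x i ^ 2)) ^ 2 = (2 * Real.pi) ^ Fintype.card ι := by
  have h : ∀ x : ι → ℝ, Real.exp (-(1 / 2) * ∑ i, x i ^ 2) =
      ∏ i, Real.exp (-(1 / 2) * x i ^ 2) := fun x => by
    rw [Finset.mul_sum, Real.exp_sum]
  simp_rw [h]
  rw [integral_fintype_prod_volume_eq_pow (fun y : ℝ => Real.exp (-(1 / 2) * y ^ 2)),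
    integral_gaussian, ← pow_mul, mul_comm (Fintype.card ι), pow_mul,
    Real.sq_sqrt (by positivity)]
  congr 1
  ring

end Gaussian

end

end SuperPf

namespace SuperPf

noncomputable section

/-! ### Norm bounds and derivatives of Gaussian integrands -/

section Gaussian

variable {ι : Type*} [Fintype ι] {Q : Type*} [NormedCommRing Q] [NormedAlgebra ℂ Q]

/-- The two terms in which a factor `y` is differentiated coincide because `S` is symmetric, and
their sum cancels the `½`. -/
theorem quad_hasDerivAt {S : ℝ → Matrix ι ι Q} {S' : Matrix ι ι Q} {y : ℝ → ι → Q} {y' : ι → Q}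
    {u : ℝ} (hsymm : (S u).IsSymm) (hS : ∀ i j, HasDerivAt (fun v => S v i j) (S' i j) u)
    (hy : ∀ i, HasDerivAt (fun v => y v i) (y' i) u) :
    HasDerivAt (fun v => (-(1 / 2) : ℂ) • quad (S v) (y v))
      ((-(1 / 2) : ℂ) • quad S' (y u) - ∑ i, y' i * ∑ j, S u i j * y u j) u := by
  have h := (HasDerivAt.fun_sum (u := Finset.univ) fun i _ => HasDerivAt.fun_sum
    (u := Finset.univ) fun j _ => ((hS i j).mul (hy i)).mul (hy j)).const_smul (-(1 / 2) : ℂ)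
  refine h.congr_deriv ?_
  have hsum : ∑ i, ∑ j, S u i j * y u i * y' j = ∑ i, ∑ j, S u i j * y' i * y u j := by
    rw [Finset.sum_comm]
    refine Finset.sum_congr rfl fun i _ => Finset.sum_congr rfl fun j _ => ?_
    rw [hsymm.apply]
    ring
  have hexp : ∑ i, ∑ j, ((S' i j * y u i + S u i j * y' i) * y u j + S u i j * y u i * y' j) =
      quad S' (y u) + (2 : ℂ) • ∑ i, y' i * ∑ j, S u i j * y u j := by
    simp only [add_mul, Finset.sum_add_distrib, hsum, quad, Finset.mul_sum, two_smul, add_assoc]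
    congr 2 <;> exact Finset.sum_congr rfl fun i _ => Finset.sum_congr rfl fun j _ => by ring
  change (-(1 / 2) : ℂ) • ∑ i, ∑ j, ((S' i j * y u i + S u i j * y' i) * y u j +
    S u i j * y u i * y' j) = _
  rw [hexp, smul_add, smul_smul, sub_eq_add_neg, ← neg_one_smul ℂ (∑ i, y' i * _)]
  norm_num

theorem continuous_shifted {ι : Type*} (w : ι → Q) (i : ι) : Continuous fun x => shifted w x i := by
  unfold shifted
  have h : Continuous (algebraMap ℂ Q) := continuous_algebraMap ℂ Q
  fun_prop

theorem continuous_gaussExponent (S : Matrix ι ι Q) (w : ι → Q) :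
    Continuous (gaussExponent S w) := by
  unfold gaussExponent quad
  have h := continuous_shifted w
  fun_prop

theorem norm_shifted_le {w : ι → Q} {d : ℝ} (hw : ∀ i, ‖w i‖ ≤ d) (x : ι → ℝ) (i : ι) :
    ‖shifted w x i‖ ≤ (‖(1 : Q)‖ + d) * (1 + ‖x‖) := by
  have hd : 0 ≤ d := (norm_nonneg _).trans (hw i)
  have h1 : ‖algebraMap ℂ Q (x i)‖ ≤ ‖x‖ * ‖(1 : Q)‖ := by
    rw [norm_algebraMap]
    gcongr
    simpa using norm_le_pi_norm x i
  calc ‖shifted w x i‖ ≤ ‖algebraMap ℂ Q (x i)‖ + ‖w i‖ := norm_sub_le _ _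
    _ ≤ ‖x‖ * ‖(1 : Q)‖ + d := add_le_add h1 (hw i)
    _ ≤ _ := by nlinarith [norm_nonneg x, norm_nonneg (1 : Q), mul_nonneg hd (norm_nonneg x)]

theorem norm_gaussExponent_le {S : Matrix ι ι Q} {w : ι → Q} {c d : ℝ} (hc : 0 ≤ c) (hd : 0 ≤ d)
    (hS : ∀ i j, ‖S i j‖ ≤ c) (hw : ∀ i, ‖w i‖ ≤ d) (x : ι → ℝ) :
    ‖gaussExponent S w x‖ ≤
      ((Fintype.card ι) ^ 2 * (c * (‖(1 : Q)‖ + d) ^ 2)) * (1 + ‖x‖) ^ 2 := by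
  have h1 : ‖quad S (shifted w x)‖ ≤
      ∑ _i : ι, ∑ _j : ι, c * ((‖(1 : Q)‖ + d) * (1 + ‖x‖)) * ((‖(1 : Q)‖ + d) * (1 + ‖x‖)) := by
    refine (norm_sum_le _ _).trans (Finset.sum_le_sum fun i _ =>
      (norm_sum_le _ _).trans (Finset.sum_le_sum fun j _ => ?_))
    have hi := norm_shifted_le hw x i
    have hj := norm_shifted_le hw x j
    refine (norm_mul_le _ _).trans (mul_le_mul ((norm_mul_le _ _).trans
      (mul_le_mul (hS i j) hi (norm_nonneg _) hc)) hj (norm_nonneg _) ?_)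
    positivity
  calc ‖gaussExponent S w x‖ ≤ ‖(-(1 / 2) : ℂ)‖ * ‖quad S (shifted w x)‖ := norm_smul_le _ _
    _ ≤ 1 * ‖quad S (shifted w x)‖ := by gcongr; norm_num
    _ ≤ _ := by
      rw [one_mul]
      refine h1.trans (le_of_eq ?_)
      simp only [Finset.sum_const, Finset.card_univ, nsmul_eq_mul]
      ring

/-- The exponential of a nilpotent grows only polynomially, so the soul of the exponent cannot spoil
the Gaussian decay due to the body. The factor `‖1‖` stays because the norm is not assumed to
satisfy `‖1‖ = 1`. -/
theorem norm_nilExp_le {s : Q} {K : ℕ} (hK : s ^ K = 0) :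
    ‖nilExp s‖ ≤ K * ‖(1 : Q)‖ * (1 + ‖s‖) ^ K := by
  have hpow : ∀ j : ℕ, ‖s ^ j‖ ≤ ‖(1 : Q)‖ * ‖s‖ ^ j := fun j => by
    induction j with
    | zero => simp
    | succ j ih =>
      rw [pow_succ, pow_succ, ← mul_assoc]
      exact (norm_mul_le _ _).trans (mul_le_mul_of_nonneg_right ih (norm_nonneg _))
  rw [nilExp_eq_sum hK]
  have : ∀ j ∈ Finset.range K, ‖((j.factorial : ℂ)⁻¹) • s ^ j‖ ≤ ‖(1 : Q)‖ * (1 + ‖s‖) ^ K := by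
    intro j hj
    have h1 : ‖((j.factorial : ℂ)⁻¹)‖ ≤ 1 := by
      rw [norm_inv, Complex.norm_natCast]
      exact inv_le_one_of_one_le₀ (by exact_mod_cast Nat.one_le_iff_ne_zero.2 j.factorial_ne_zero)
    calc ‖((j.factorial : ℂ)⁻¹) • s ^ j‖ ≤ ‖((j.factorial : ℂ)⁻¹)‖ * ‖s ^ j‖ := norm_smul_le _ _
      _ ≤ 1 * (‖(1 : Q)‖ * ‖s‖ ^ j) := mul_le_mul h1 (hpow j) (norm_nonneg _) zero_le_one
      _ ≤ ‖(1 : Q)‖ * (1 + ‖s‖) ^ K := by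
        rw [one_mul]
        refine mul_le_mul_of_nonneg_left ?_ (norm_nonneg _)
        calc ‖s‖ ^ j ≤ (1 + ‖s‖) ^ j := by gcongr; linarith
          _ ≤ (1 + ‖s‖) ^ K := pow_le_pow_right₀ (by linarith [norm_nonneg s])
            (Finset.mem_range.1 hj).le
  refine (norm_sum_le_of_le _ this).trans (le_of_eq ?_)
  simp [mul_assoc]

variable [FiniteDimensional ℂ Q]

theorem gaussExp_hasDerivAt {S : ℝ → Matrix ι ι Q} {S' : Matrix ι ι Q} {y : ℝ → ι → Q}
    {y' : ι → Q} {u : ℝ} (hsymm : (S u).IsSymm)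
    (hS : ∀ i j, HasDerivAt (fun v => S v i j) (S' i j) u)
    (hy : ∀ i, HasDerivAt (fun v => y v i) (y' i) u) :
    HasDerivAt (fun v => NormedSpace.exp ((-(1 / 2) : ℂ) • quad (S v) (y v)))
      (((-(1 / 2) : ℂ) • quad S' (y u) - ∑ i, y' i * ∑ j, S u i j * y u j) *
        NormedSpace.exp ((-(1 / 2) : ℂ) • quad (S u) (y u))) u := by
  have : CompleteSpace Q := FiniteDimensional.complete ℂ Q
  have h := (hasFDerivAt_exp (𝕂 := ℝ) (𝔸 := Q)).comp_hasDerivAt u (quad_hasDerivAt hsymm hS hy)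
  refine h.congr_deriv ?_
  simp [mul_comm]

variable (S : Matrix ι ι Q) (w : ι → Q)

/-- The shifted Gaussian `exp(-½ ∑ i j, S i j (x i - w i) (x j - w j))`. -/
def gaussExp (x : ι → ℝ) : Q := NormedSpace.exp (gaussExponent S w x)

variable {S w} {a : ℝ}

theorem gaussExp_continuous : Continuous (gaussExp S w) := by
  have : CompleteSpace Q := FiniteDimensional.complete ℂ Q
  let : NormedAlgebra ℚ Q := NormedAlgebra.restrictScalars ℚ ℝ Q
  exact (NormedSpace.exp_continuous).comp (continuous_gaussExponent S w)

theorem integrable_of_le_gaussian {E : Type*} [NormedAddCommGroup E] {f : (ι → ℝ) → E}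
    (ha : 0 < a) (hf : Continuous f) {C : ℝ}
    (h : ∀ x, ‖f x‖ ≤ C * Real.exp (-a * ∑ i, x i ^ 2)) : Integrable f :=
  ((integrable_exp_neg_mul_sum_sq ha).const_mul C).mono' hf.aestronglyMeasurable
    (Filter.Eventually.of_forall h)

end Gaussian

end

end SuperPf

namespace SuperPf

noncomputable section

/-! ### Integration by parts and Gaussian moments -/

section Gaussian

variable {ι : Type*} [Fintype ι] {Q : Type*} [NormedCommRing Q] [NormedAlgebra ℂ Q]

/-- Integration by parts against the constant function `1`. -/
theorem integral_lineDeriv_eq_zero {f f' : (ι → ℝ) → Q} {v : ι → ℝ} (hf : Integrable f)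
    (hf' : Integrable f') (h : ∀ x, HasLineDerivAt ℝ f (f' x) x v) : ∫ x, f' x = 0 := by
  have := integral_bilinear_hasLineDerivAt_right_eq_neg_left_of_integrable
    (μ := (volume : Measure (ι → ℝ))) (f := fun _ => (1 : ℝ)) (f' := fun _ => 0) (g := f)
    (g' := f') (v := v) (B := ContinuousLinearMap.lsmul ℝ ℝ) (by simp) (by simpa using hf')
    (by simpa using hf) (fun x _ => by
      simpa [HasLineDerivAt] using hasDerivAt_const (0 : ℝ) (1 : ℝ)) (fun x _ => h x)
  simpa using this

variable [FiniteDimensional ℂ Q] {S : Matrix ι ι Q} {w : ι → Q} {C a : ℝ}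

/-- The weight `(1 + ‖x‖) ^ 2` in the domination hypothesis covers moments of degree at most two,
the only ones needed below. -/
theorem integrable_mul_gaussExp (ha : 0 < a)
    (hdom : ∀ x, (1 + ‖x‖) ^ 2 * ‖gaussExp S w x‖ ≤ C * Real.exp (-a * ∑ i, x i ^ 2))
    {g : (ι → ℝ) → Q} {M : ℝ} (hM : 0 ≤ M) (hg : Continuous g)
    (hgM : ∀ x, ‖g x‖ ≤ M * (1 + ‖x‖) ^ 2) : Integrable fun x => g x * gaussExp S w x := by
  refine integrable_of_le_gaussian ha (hg.mul gaussExp_continuous) (C := M * C) fun x => ?_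
  calc ‖g x * gaussExp S w x‖ ≤ (M * (1 + ‖x‖) ^ 2) * ‖gaussExp S w x‖ :=
        (norm_mul_le _ _).trans (mul_le_mul_of_nonneg_right (hgM x) (norm_nonneg _))
    _ = M * ((1 + ‖x‖) ^ 2 * ‖gaussExp S w x‖) := by ring
    _ ≤ M * (C * Real.exp (-a * ∑ i, x i ^ 2)) := mul_le_mul_of_nonneg_left (hdom x) hM
    _ = _ := by ring

theorem one_le_one_add_norm_sq (x : ι → ℝ) : 1 ≤ (1 + ‖x‖) ^ 2 :=
  one_le_pow₀ (by linarith [norm_nonneg x])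

theorem integrable_gaussExp (ha : 0 < a)
    (hdom : ∀ x, (1 + ‖x‖) ^ 2 * ‖gaussExp S w x‖ ≤ C * Real.exp (-a * ∑ i, x i ^ 2)) :
    Integrable (gaussExp S w) := by
  have := integrable_mul_gaussExp ha hdom (g := fun _ => 1) (norm_nonneg (1 : Q))
    continuous_const fun x => le_mul_of_one_le_right (norm_nonneg _) (one_le_one_add_norm_sq x)
  simpa using this

/-- A common bound for the entries of a vector. -/
theorem norm_le_sum_norm {E : Type*} [SeminormedAddCommGroup E] (w : ι → E) (i : ι) :
    ‖w i‖ ≤ ∑ j, ‖w j‖ :=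
  Finset.single_le_sum (f := fun j => ‖w j‖) (fun _ _ => norm_nonneg _) (Finset.mem_univ i)

theorem integrable_shifted_mul_gaussExp (ha : 0 < a)
    (hdom : ∀ x, (1 + ‖x‖) ^ 2 * ‖gaussExp S w x‖ ≤ C * Real.exp (-a * ∑ i, x i ^ 2)) (i : ι) :
    Integrable fun x => shifted w x i * gaussExp S w x := by
  have h0 : 0 ≤ ‖(1 : Q)‖ + ∑ j, ‖w j‖ := by positivity
  refine integrable_mul_gaussExp ha hdom h0 (continuous_shifted w i) fun x => ?_
  refine (norm_shifted_le (norm_le_sum_norm w) x i).trans (mul_le_mul_of_nonneg_left ?_ h0)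
  nlinarith [norm_nonneg x]

theorem integrable_shifted_mul_shifted_mul_gaussExp (ha : 0 < a)
    (hdom : ∀ x, (1 + ‖x‖) ^ 2 * ‖gaussExp S w x‖ ≤ C * Real.exp (-a * ∑ i, x i ^ 2)) (i j : ι) :
    Integrable fun x => shifted w x i * shifted w x j * gaussExp S w x := by
  refine integrable_mul_gaussExp ha hdom (M := (‖(1 : Q)‖ + ∑ j, ‖w j‖) ^ 2) (by positivity)
    ((continuous_shifted w i).mul (continuous_shifted w j)) fun x => ?_
  refine (norm_mul_le _ _).trans ((mul_le_mul (norm_shifted_le (norm_le_sum_norm w) x i)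
    (norm_shifted_le (norm_le_sum_norm w) x j) (norm_nonneg _) (by positivity)).trans
      (le_of_eq (by ring)))

variable [DecidableEq ι]

theorem shifted_hasDerivAt (x : ι → ℝ) (l i : ι) :
    HasDerivAt (fun t : ℝ => shifted w (x + t • (Pi.single l 1 : ι → ℝ)) i)
      ((Pi.single l 1 : ι → Q) i) 0 := by
  have h1 : HasDerivAt (fun t : ℝ => (((x + t • (Pi.single l 1 : ι → ℝ)) i : ℝ) : ℂ))
      ((Pi.single l 1 : ι → ℂ) i) 0 := by
    have : HasDerivAt (fun t : ℝ => (x + t • (Pi.single l 1 : ι → ℝ)) i)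
        ((Pi.single l 1 : ι → ℝ) i) 0 := by
      simpa using ((hasDerivAt_id (0 : ℝ)).mul_const ((Pi.single l 1 : ι → ℝ) i)).const_add (x i)
    refine this.ofReal_comp.congr_deriv ?_
    by_cases h : i = l
    · subst h; simp
    · simp [h]
  have h2 := ((Algebra.linearMap ℂ Q).toContinuousLinearMap.restrictScalars ℝ).hasFDerivAt
    |>.comp_hasDerivAt (0 : ℝ) h1
  refine (h2.sub_const (w i)).congr_deriv ?_
  by_cases h : i = l
  · subst h; simp
  · simp [h]

theorem gaussExp_hasLineDerivAt (hS : S.IsSymm) (x : ι → ℝ) (l : ι) :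
    HasLineDerivAt ℝ (gaussExp S w) (-(∑ j, S l j * shifted w x j) * gaussExp S w x) x
      (Pi.single l 1) := by
  have h := gaussExp_hasDerivAt (S := fun _ => S) (S' := 0) (u := 0) hS
    (fun i j => hasDerivAt_const _ _) (shifted_hasDerivAt (w := w) x l)
  refine h.congr_deriv ?_
  simp [quad, gaussExp, gaussExponent, Pi.single_apply]

/-- This is the vanishing of the integral of the `l`-th partial derivative of the Gaussian. The
matrix `S` is left in place since it is not known here to be invertible. -/
theorem integral_shifted_mul_gaussExp (ha : 0 < a)
    (hdom : ∀ x, (1 + ‖x‖) ^ 2 * ‖gaussExp S w x‖ ≤ C * Real.exp (-a * ∑ i, x i ^ 2))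
    (hS : S.IsSymm) (l : ι) : ∑ j, S l j * ∫ x, shifted w x j * gaussExp S w x = 0 := by
  have hi := integrable_shifted_mul_gaussExp ha hdom
  have hexp : ∀ x, -(∑ j, S l j * shifted w x j) * gaussExp S w x =
      -∑ j, S l j * (shifted w x j * gaussExp S w x) := fun x => by
    simp only [Finset.sum_mul, neg_mul, mul_assoc]
  have hint : Integrable fun x => -(∑ j, S l j * shifted w x j) * gaussExp S w x := by
    simp_rw [hexp]
    exact (integrable_finsetSum _ fun j _ => (hi j).const_mul _).neg
  have h := integral_lineDeriv_eq_zero (integrable_gaussExp ha hdom) hint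
    fun x => gaussExp_hasLineDerivAt hS x l
  simp_rw [hexp] at h
  rw [integral_neg, integral_finsetSum _ fun j _ => (hi j).const_mul _, neg_eq_zero] at h
  rw [← h]
  exact Finset.sum_congr rfl fun j _ => (integral_const_mul_of_integrable (hi j)).symm

/-- The same argument applied to the `l`-th partial derivative of `(x m - w m)` times the Gaussian.
-/
theorem integral_shifted_mul_shifted_mul_gaussExp (ha : 0 < a)
    (hdom : ∀ x, (1 + ‖x‖) ^ 2 * ‖gaussExp S w x‖ ≤ C * Real.exp (-a * ∑ i, x i ^ 2))
    (hS : S.IsSymm) (l m : ι) :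
    ∑ j, S l j * ∫ x, shifted w x j * shifted w x m * gaussExp S w x =
      (1 : Matrix ι ι Q) l m * ∫ x, gaussExp S w x := by
  have hi := fun j => integrable_shifted_mul_shifted_mul_gaussExp ha hdom j m
  have h0 := integrable_gaussExp ha hdom
  have hexp : ∀ x, (Pi.single l 1 : ι → Q) m * gaussExp S w x +
      shifted w x m * (-(∑ j, S l j * shifted w x j) * gaussExp S w x) =
      (1 : Matrix ι ι Q) l m * gaussExp S w x -
        ∑ j, S l j * (shifted w x j * shifted w x m * gaussExp S w x) := fun x => by
    rw [Matrix.one_apply, Pi.single_apply, neg_mul, mul_neg, ← sub_eq_add_neg, Finset.sum_mul,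
      Finset.mul_sum]
    congr 1
    · simp [eq_comm]
    · exact Finset.sum_congr rfl fun j _ => by ring
  have hder : ∀ x, HasLineDerivAt ℝ (fun x => shifted w x m * gaussExp S w x)
      ((1 : Matrix ι ι Q) l m * gaussExp S w x -
        ∑ j, S l j * (shifted w x j * shifted w x m * gaussExp S w x)) x (Pi.single l 1) :=
    fun x => by
      rw [← hexp]
      have := (shifted_hasDerivAt (w := w) x l m).mul (gaussExp_hasLineDerivAt (w := w) hS x l)
      simp only [zero_smul, add_zero] at this
      exact this
  have hs := integrable_finsetSum Finset.univ fun j _ => (hi j).const_mul (S l j)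
  have hint : Integrable fun x => (1 : Matrix ι ι Q) l m * gaussExp S w x -
      ∑ j, S l j * (shifted w x j * shifted w x m * gaussExp S w x) := (h0.const_mul _).sub hs
  have h := integral_lineDeriv_eq_zero (integrable_shifted_mul_gaussExp ha hdom m) hint hder
  rw [integral_sub (h0.const_mul _) hs, integral_finsetSum _ fun j _ => (hi j).const_mul _,
    sub_eq_zero, integral_const_mul_of_integrable h0] at h
  rw [h]
  exact Finset.sum_congr rfl fun j _ => (integral_const_mul_of_integrable (hi j)).symm

end Gaussian

end

end SuperPf

namespace SuperPf

noncomputable section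

/-! ### Uniform Gaussian domination along a deformation -/

section Gaussian

variable {ι : Type*} [Fintype ι]

section Algebraic

variable {Q Q' : Type*} [CommRing Q] [Algebra ℂ Q] [CommRing Q'] [Algebra ℂ Q']

theorem map_gaussExponent (f : Q →ₐ[ℂ] Q') (S : Matrix ι ι Q) (w : ι → Q) (x : ι → ℝ) :
    f (gaussExponent S w x) = gaussExponent (S.map f) (f ∘ w) x := by
  unfold gaussExponent
  rw [map_smul]
  congr 1
  refine (map_quad (f : Q →+* Q') S _).trans ?_
  congr 1
  funext i
  simp [shifted]

/-- The Gaussian `exp(-½ ∑ i j, S i j (x i - w i) (x j - w j))`, for a matrix `S` with body `S₀`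
and a nilpotent vector `w`. -/
def gaussFun (S₀ : Matrix ι ι ℂ) (S : Matrix ι ι Q) (w : ι → Q) (x : ι → ℝ) : Q :=
  Complex.exp (gaussExponent S₀ 0 x) •
    nilExp (gaussExponent S w x - algebraMap ℂ Q (gaussExponent S₀ 0 x))

/-- Modulo the nilradical, `S` becomes `S₀` and `w` becomes `0`, so both exponents have the same
image. -/
theorem gaussExponent_sub_mem_nilradical {S₀ : Matrix ι ι ℂ} {S : Matrix ι ι Q} {w : ι → Q}
    (hS : ∀ i j, IsNilpotent (S i j - algebraMap ℂ Q (S₀ i j))) (hw : ∀ i, IsNilpotent (w i))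
    (x : ι → ℝ) :
    gaussExponent S w x - algebraMap ℂ Q (gaussExponent S₀ 0 x) ∈ nilradical Q := by
  rw [← Ideal.Quotient.eq]
  have h1 : (Ideal.Quotient.mkₐ ℂ (nilradical Q)) (gaussExponent S w x) = _ :=
    map_gaussExponent _ S w x
  have h2 : (Ideal.Quotient.mkₐ ℂ (nilradical Q)) (algebraMap ℂ Q (gaussExponent S₀ 0 x)) = _ :=
    map_gaussExponent ((Ideal.Quotient.mkₐ ℂ (nilradical Q)).comp (Algebra.ofId ℂ Q)) S₀ 0 x
  refine h1.trans (Eq.trans ?_ h2.symm)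
  congr 1
  · ext i j
    exact Ideal.Quotient.eq.2 (mem_nilradical.2 (hS i j))
  · funext i
    simpa using Ideal.Quotient.eq_zero_iff_mem.2 (mem_nilradical.2 (hw i))

end Algebraic

variable {Q : Type*} [NormedCommRing Q] [NormedAlgebra ℂ Q] [FiniteDimensional ℂ Q]

theorem gaussExp_eq_gaussFun {S₀ : Matrix ι ι ℂ} {S : Matrix ι ι Q} {w : ι → Q}
    (hS : ∀ i j, IsNilpotent (S i j - algebraMap ℂ Q (S₀ i j))) (hw : ∀ i, IsNilpotent (w i))
    (x : ι → ℝ) : gaussExp S w x = gaussFun S₀ S w x := by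
  have : CompleteSpace Q := FiniteDimensional.complete ℂ Q
  let : NormedAlgebra ℚ Q := NormedAlgebra.restrictScalars ℚ ℝ Q
  have hn := mem_nilradical.1 (gaussExponent_sub_mem_nilradical hS hw x)
  unfold gaussFun gaussExp
  rw [nilExp_eq_exp hn, Algebra.smul_def, Complex.exp_eq_exp_ℂ,
    NormedSpace.algebraMap_exp_comm (𝔸 := Q), ← NormedSpace.exp_add_of_commute (Commute.all _ _)]
  congr 1
  ring

variable [DecidableEq ι]

/-- The segment from the identity matrix to `S`. -/
def matrixPath {ι Q : Type*} [DecidableEq ι] [CommRing Q] [Algebra ℂ Q]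
    (S : Matrix ι ι Q) (t : ℝ) : Matrix ι ι Q :=
  ((1 - t : ℝ) : ℂ) • 1 + (t : ℂ) • S

theorem re_gaussExponent_matrixPath_le {S₀ : Matrix ι ι ℂ}
    (hpos : ∀ x : ι → ℝ, x ≠ 0 → 0 < ∑ i, ∑ j, (S₀ i j).re * x i * x j) :
    ∃ a : ℝ, 0 < a ∧ ∀ t ∈ Set.Icc (0 : ℝ) 1, ∀ x : ι → ℝ,
      (gaussExponent (matrixPath S₀ t) 0 x).re ≤ -a * ∑ i, x i ^ 2 := by
  obtain ⟨ε, hε, h⟩ := exists_le_quadratic (Matrix.of fun i j => (S₀ i j).re) hpos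
  -- The form at time `t` is a convex combination of one bounded below by `∑ x i ^ 2` and one
  -- bounded below by `ε` times it; the `2` comes from the factor `-½` in the exponent.
  refine ⟨min 1 ε / 2, by positivity, fun t ht x => ?_⟩
  have hs : 0 ≤ ∑ i, x i ^ 2 := Finset.sum_nonneg fun _ _ => sq_nonneg _
  have h1 : gaussExponent (matrixPath S₀ t) 0 x =
      ((-(1 / 2) : ℝ) : ℂ) * (((1 - t : ℝ) : ℂ) * ((∑ i, x i ^ 2 : ℝ) : ℂ) +
        ((t : ℝ) : ℂ) * ∑ i, ∑ j, S₀ i j * ((x i * x j : ℝ) : ℂ)) := by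
    simp only [gaussExponent, quad, matrixPath, shifted, Matrix.add_apply, Matrix.smul_apply,
      smul_eq_mul, Matrix.one_apply, add_mul, Finset.sum_add_distrib, Pi.zero_apply, sub_zero]
    congr 1
    · norm_num
    congr 1
    · rw [Complex.ofReal_sum, Finset.mul_sum]
      refine Finset.sum_congr rfl fun i _ => ?_
      simp only [mul_ite, ite_mul, mul_one, mul_zero, zero_mul, Finset.sum_ite_eq,
        Finset.mem_univ, if_true]
      push_cast
      simp
      ring
    · simp only [Finset.mul_sum]
      refine Finset.sum_congr rfl fun i _ => Finset.sum_congr rfl fun j _ => ?_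
      push_cast
      simp
      ring
  have h2 : (∑ i, ∑ j, S₀ i j * ((x i * x j : ℝ) : ℂ)).re =
      ∑ i, ∑ j, (S₀ i j).re * x i * x j := by
    simp only [Complex.re_sum, Complex.re_mul_ofReal, mul_assoc]
  rw [h1, Complex.re_ofReal_mul, Complex.add_re, Complex.re_ofReal_mul, Complex.re_ofReal_mul, h2,
    Complex.ofReal_re]
  have h3 := mul_le_mul_of_nonneg_left (h x) ht.1
  have h4 : min 1 ε * ∑ i, x i ^ 2 ≤ 1 * ∑ i, x i ^ 2 :=
    mul_le_mul_of_nonneg_right (min_le_left _ _) hs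
  have h5 : min 1 ε * ∑ i, x i ^ 2 ≤ ε * ∑ i, x i ^ 2 :=
    mul_le_mul_of_nonneg_right (min_le_right _ _) hs
  have h6 := mul_le_mul_of_nonneg_left h4 (sub_nonneg.2 ht.2)
  have h7 := mul_le_mul_of_nonneg_left h5 ht.1
  simp only [Matrix.of_apply] at h3
  linarith

theorem norm_matrixPath_le {Q : Type*} [NormedCommRing Q] [NormedAlgebra ℂ Q] {S : Matrix ι ι Q}
    {t : ℝ} (ht : t ∈ Set.Icc (0 : ℝ) 1) (i j : ι) :
    ‖matrixPath S t i j‖ ≤ ‖(1 : Q)‖ + ∑ i, ∑ j, ‖S i j‖ := by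
  have h1 : ‖(1 : Matrix ι ι Q) i j‖ ≤ ‖(1 : Q)‖ := by
    rw [Matrix.one_apply]
    split_ifs <;> simp
  have h2 : ‖S i j‖ ≤ ∑ i, ∑ j, ‖S i j‖ :=
    (Finset.single_le_sum (f := fun j => ‖S i j‖) (fun _ _ => norm_nonneg _)
      (Finset.mem_univ j)).trans
      (Finset.single_le_sum (f := fun i => ∑ j, ‖S i j‖)
        (fun _ _ => Finset.sum_nonneg fun _ _ => norm_nonneg _) (Finset.mem_univ i))
  have h3 : ‖((1 - t : ℝ) : ℂ)‖ ≤ 1 := by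
    rw [Complex.norm_real, Real.norm_eq_abs, abs_le]
    constructor <;> linarith [ht.1, ht.2]
  have h4 : ‖(t : ℂ)‖ ≤ 1 := by
    rw [Complex.norm_real, Real.norm_eq_abs, abs_le]
    constructor <;> linarith [ht.1, ht.2]
  unfold matrixPath
  rw [Matrix.add_apply, Matrix.smul_apply, Matrix.smul_apply]
  refine (norm_add_le _ _).trans (add_le_add ?_ ?_)
  · exact (norm_smul_le _ _).trans ((mul_le_of_le_one_left (norm_nonneg _) h3).trans h1)
  · exact (norm_smul_le _ _).trans ((mul_le_of_le_one_left (norm_nonneg _) h4).trans h2)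

theorem norm_vectorPath_le {ι Q : Type*} [Fintype ι] [NormedCommRing Q] [NormedAlgebra ℂ Q]
    {w : ι → Q} {t : ℝ} (ht : t ∈ Set.Icc (0 : ℝ) 1) (i : ι) :
    ‖((t : ℂ) • w) i‖ ≤ ∑ i, ‖w i‖ := by
  have h4 : ‖(t : ℂ)‖ ≤ 1 := by
    rw [Complex.norm_real, Real.norm_eq_abs, abs_le]
    constructor <;> linarith [ht.1, ht.2]
  exact (norm_smul_le _ _).trans
    ((mul_le_of_le_one_left (norm_nonneg _) h4).trans (norm_le_sum_norm w i))

theorem isNilpotent_matrixPath_sub {ι Q : Type*} [DecidableEq ι] [CommRing Q]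
    [Algebra ℂ Q] {S₀ : Matrix ι ι ℂ} {S : Matrix ι ι Q}
    (hS : ∀ i j, IsNilpotent (S i j - algebraMap ℂ Q (S₀ i j))) (t : ℝ) (i j : ι) :
    IsNilpotent (matrixPath S t i j - algebraMap ℂ Q (matrixPath S₀ t i j)) := by
  have : matrixPath S t i j - algebraMap ℂ Q (matrixPath S₀ t i j) =
      (t : ℂ) • (S i j - algebraMap ℂ Q (S₀ i j)) := by
    have h1 : algebraMap ℂ Q ((1 : Matrix ι ι ℂ) i j) = (1 : Matrix ι ι Q) i j := by
      simp [Matrix.one_apply, apply_ite (algebraMap ℂ Q)]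
    change ((1 - t : ℝ) : ℂ) • (1 : Matrix ι ι Q) i j + (t : ℂ) • S i j -
      algebraMap ℂ Q (((1 - t : ℝ) : ℂ) • (1 : Matrix ι ι ℂ) i j + (t : ℂ) • S₀ i j) = _
    simp only [map_add, Algebra.smul_def, map_mul, Algebra.algebraMap_self, RingHom.id_apply, h1]
    ring
  rw [this]
  exact (hS i j).smul _

/-- The body gives Gaussian decay and the soul polynomial growth, both uniformly in `t`. A single
bound for the whole path is what differentiation under the integral requires. -/
theorem exists_gaussian_bound {S₀ : Matrix ι ι ℂ} {S : Matrix ι ι Q} {w : ι → Q}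
    (hpos : ∀ x : ι → ℝ, x ≠ 0 → 0 < ∑ i, ∑ j, (S₀ i j).re * x i * x j)
    (hS : ∀ i j, IsNilpotent (S i j - algebraMap ℂ Q (S₀ i j))) (hw : ∀ i, IsNilpotent (w i)) :
    ∃ C a : ℝ, 0 < a ∧ ∀ t ∈ Set.Icc (0 : ℝ) 1, ∀ x : ι → ℝ,
      (1 + ‖x‖) ^ 2 * ‖gaussExp (matrixPath S t) ((t : ℂ) • w) x‖ ≤
        C * Real.exp (-a * ∑ i, x i ^ 2) := by
  have : IsNoetherianRing Q := IsNoetherianRing.of_finite ℂ Q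
  -- One exponent `K` kills the soul for all `x` and `t` at once.
  obtain ⟨K, hK⟩ := IsNoetherianRing.isNilpotent_nilradical Q
  obtain ⟨b, hb, hre⟩ := re_gaussExponent_matrixPath_le hpos
  set S₁ : Matrix ι ι Q := S₀.map (algebraMap ℂ Q) with hS₁
  set c := ‖(1 : Q)‖ + ∑ i, ∑ j, ‖S i j‖ with hc
  set c₁ := ‖(1 : Q)‖ + ∑ i, ∑ j, ‖S₁ i j‖ with hc₁
  set d := ∑ i, ‖w i‖ with hd
  set M := (Fintype.card ι) ^ 2 * (c * (‖(1 : Q)‖ + d) ^ 2) with hM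
  set M₁ := (Fintype.card ι) ^ 2 * (c₁ * (‖(1 : Q)‖ + 0) ^ 2) with hM₁
  have hc0 : 0 ≤ c := by positivity
  have hc₁0 : 0 ≤ c₁ := by positivity
  have hd0 : 0 ≤ d := by positivity
  have hM0 : 0 ≤ M := by positivity
  have hM₁0 : 0 ≤ M₁ := by positivity
  -- Half of the decay rate `b` absorbs the polynomial factors: degree `2` from the weight and `2 *
  -- K` from the exponential of a soul that is quadratic in `x`.
  obtain ⟨C₂, hC₂, hpoly⟩ := one_add_norm_pow_le (ι := ι) (2 + 2 * K) (half_pos hb)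
  refine ⟨K * ‖(1 : Q)‖ * (1 + M + M₁) ^ K * C₂, b / 2, half_pos hb, fun t ht x => ?_⟩
  have hSt := isNilpotent_matrixPath_sub hS t
  have hwt : ∀ i, IsNilpotent (((t : ℂ) • w) i) := fun i => by
    rw [Pi.smul_apply]
    exact (hw i).smul _
  set z := gaussExponent (matrixPath S₀ t) 0 x with hz
  set s := gaussExponent (matrixPath S t) ((t : ℂ) • w) x - algebraMap ℂ Q z with hs
  have hsK : s ^ K = 0 := by
    have := Ideal.pow_mem_pow (gaussExponent_sub_mem_nilradical hSt hwt x) K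
    rwa [hK] at this
  have hp := one_le_one_add_norm_sq x
  have hsn : 1 + ‖s‖ ≤ (1 + M + M₁) * (1 + ‖x‖) ^ 2 := by
    have h1 := norm_gaussExponent_le hc0 hd0 (norm_matrixPath_le (S := S) ht)
      (norm_vectorPath_le (w := w) ht) x
    have h2 := norm_gaussExponent_le hc₁0 le_rfl (norm_matrixPath_le (S := S₁) ht)
      (w := (0 : ι → Q)) (fun i => by simp) x
    -- Seen in `Q`, the body is itself a Gaussian exponent, so the same norm estimate applies to it.
    have h3 : algebraMap ℂ Q z = gaussExponent (matrixPath S₁ t) 0 x := by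
      refine (map_gaussExponent (Algebra.ofId ℂ Q) _ _ x).trans ?_
      congr 1
      · ext i j
        simp only [matrixPath, hS₁, Matrix.map_apply, Matrix.add_apply, Matrix.smul_apply,
          map_add, map_smul, Matrix.one_apply]
        congr 2
        split_ifs <;> simp
      · funext i
        simp
    have h4 : ‖s‖ ≤ M * (1 + ‖x‖) ^ 2 + M₁ * (1 + ‖x‖) ^ 2 := by
      rw [hs, h3]
      exact (norm_sub_le _ _).trans (add_le_add h1 h2)
    nlinarith
  have hE : ‖gaussExp (matrixPath S t) ((t : ℂ) • w) x‖ ≤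
      Real.exp (-b * ∑ i, x i ^ 2) *
        (K * ‖(1 : Q)‖ * ((1 + M + M₁) * (1 + ‖x‖) ^ 2) ^ K) := by
    rw [gaussExp_eq_gaussFun hSt hwt]
    refine (norm_smul_le _ _).trans (mul_le_mul ?_ ?_ (norm_nonneg _) (Real.exp_pos _).le)
    · rw [Complex.norm_exp]
      exact Real.exp_le_exp.2 (hre t ht x)
    · refine (norm_nilExp_le hsK).trans ?_
      gcongr
  calc (1 + ‖x‖) ^ 2 * ‖gaussExp (matrixPath S t) ((t : ℂ) • w) x‖
      ≤ (1 + ‖x‖) ^ 2 * (Real.exp (-b * ∑ i, x i ^ 2) *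
        (K * ‖(1 : Q)‖ * ((1 + M + M₁) * (1 + ‖x‖) ^ 2) ^ K)) := by gcongr
    _ = K * ‖(1 : Q)‖ * (1 + M + M₁) ^ K * Real.exp (-b * ∑ i, x i ^ 2) *
        (1 + ‖x‖) ^ (2 + 2 * K) := by
      rw [mul_pow, pow_add, pow_mul]
      ring
    _ ≤ K * ‖(1 : Q)‖ * (1 + M + M₁) ^ K * Real.exp (-b * ∑ i, x i ^ 2) *
        (C₂ * Real.exp (b / 2 * ∑ i, x i ^ 2)) :=
      mul_le_mul_of_nonneg_left (hpoly x) (by positivity)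
    _ = K * ‖(1 : Q)‖ * (1 + M + M₁) ^ K * C₂ * (Real.exp (-b * ∑ i, x i ^ 2) *
        Real.exp (b / 2 * ∑ i, x i ^ 2)) := by ring
    _ = _ := by
      rw [← Real.exp_add]
      congr 2
      ring

end Gaussian

end

end SuperPf

namespace SuperPf

noncomputable section

/-! ### Deformation to the standard Gaussian -/

section Gaussian

section Normed

variable {ι : Type*} [Fintype ι] {Q : Type*} [NormedCommRing Q] [NormedAlgebra ℂ Q]

theorem matrixPath_hasDerivAt {ι : Type*} [DecidableEq ι] (S : Matrix ι ι Q)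
    {τ : ℝ → ℝ} {τ' u : ℝ} (hτ : HasDerivAt τ τ' u)
    (i j : ι) : HasDerivAt (fun v => matrixPath S (τ v) i j) (((τ' : ℂ) • (S - 1)) i j) u := by
  have h1 := ((hτ.const_sub 1).ofReal_comp).smul_const ((1 : Matrix ι ι Q) i j)
  have h2 := (hτ.ofReal_comp).smul_const (S i j)
  refine (h1.add h2).congr_deriv ?_
  rw [Matrix.smul_apply, Matrix.sub_apply, Complex.ofReal_neg, neg_smul, smul_sub]
  abel

theorem shifted_path_hasDerivAt {ι : Type*} (w : ι → Q)
    {τ : ℝ → ℝ} {τ' u : ℝ} (hτ : HasDerivAt τ τ' u)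
    (x : ι → ℝ) (i : ι) :
    HasDerivAt (fun v => shifted ((τ v : ℂ) • w) x i) (-((τ' : ℂ) • w i)) u :=
  ((hτ.ofReal_comp).smul_const (w i)).const_sub _

theorem matrixPath_isSymm {ι : Type*} [DecidableEq ι] {S : Matrix ι ι Q}
    (hS : S.IsSymm) (t : ℝ) : (matrixPath S t).IsSymm := by
  unfold matrixPath
  exact (Matrix.isSymm_one.smul _).add (hS.smul _)

/-- The segment is run through with `t = sin² u`, which stays in `[0, 1]` for every real `u`:
derivatives exist on all of `ℝ` and no endpoint needs separate treatment. -/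
theorem sin_sq_mem_Icc (u : ℝ) : Real.sin u ^ 2 ∈ Set.Icc (0 : ℝ) 1 :=
  ⟨sq_nonneg _, Real.sin_sq_le_one u⟩

theorem sin_sq_hasDerivAt (u : ℝ) :
    HasDerivAt (fun v => Real.sin v ^ 2) (2 * Real.sin u * Real.cos u) u := by
  have h := (Real.hasDerivAt_sin u).fun_pow 2
  simpa using h

theorem abs_sin_sq_deriv_le (u : ℝ) : |2 * Real.sin u * Real.cos u| ≤ 1 := by
  rw [← Real.sin_two_mul]
  exact Real.abs_sin_le_one _

/-- The derivative of a shifted Gaussian `exp(-½ ∑ i j, P i j y i y j)` with respect to a parameter,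
when `P` and `y` have derivatives `P'` and `y'`. -/
def gaussDeriv (P : Matrix ι ι Q) (v : ι → Q) (P' : Matrix ι ι Q) (y' : ι → Q) (x : ι → ℝ) : Q :=
  ((-(1 / 2) : ℂ) • quad P' (shifted v x) - ∑ i, y' i * ∑ j, P i j * shifted v x j) *
    gaussExp P v x

theorem norm_gaussDeriv_le {P P' : Matrix ι ι Q} {v y' : ι → Q} {c c₁ d : ℝ}
    (hc : 0 ≤ c) (hc₁ : 0 ≤ c₁) (hd : 0 ≤ d) (hP : ∀ i j, ‖P i j‖ ≤ c)
    (hP' : ∀ i j, ‖P' i j‖ ≤ c₁) (hv : ∀ i, ‖v i‖ ≤ d) (hy' : ∀ i, ‖y' i‖ ≤ d) (x : ι → ℝ) :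
    ‖gaussDeriv P v P' y' x‖ ≤ ((Fintype.card ι) ^ 2 * (c₁ * (‖(1 : Q)‖ + d) ^ 2) +
      Fintype.card ι * (d * (Fintype.card ι * (c * (‖(1 : Q)‖ + d))))) *
      ((1 + ‖x‖) ^ 2 * ‖gaussExp P v x‖) := by
  have h1 := norm_gaussExponent_le hc₁ hd hP' hv x
  have h2 : ‖∑ i, y' i * ∑ j, P i j * shifted v x j‖ ≤
      ∑ _i : ι, d * ∑ _j : ι, c * ((‖(1 : Q)‖ + d) * (1 + ‖x‖)) :=
    norm_sum_le_of_le _ fun i _ => (norm_mul_le _ _).trans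
      (mul_le_mul (hy' i) (norm_sum_le_of_le _ fun j _ => (norm_mul_le _ _).trans
        (mul_le_mul (hP i j) (norm_shifted_le hv x j) (norm_nonneg _) hc)) (norm_nonneg _) hd)
  have hp : (1 + ‖x‖) ≤ (1 + ‖x‖) ^ 2 := by nlinarith [norm_nonneg x]
  have h3 : ∑ _i : ι, d * ∑ _j : ι, c * ((‖(1 : Q)‖ + d) * (1 + ‖x‖)) ≤
      Fintype.card ι * (d * (Fintype.card ι * (c * (‖(1 : Q)‖ + d)))) * (1 + ‖x‖) ^ 2 := by
    simp only [Finset.sum_const, Finset.card_univ, nsmul_eq_mul]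
    refine le_trans (le_of_eq ?_) (mul_le_mul_of_nonneg_left hp (by positivity))
    ring
  rw [← mul_assoc, add_mul]
  refine (norm_mul_le _ _).trans (mul_le_mul_of_nonneg_right ?_ (norm_nonneg _))
  exact (norm_sub_le _ _).trans (add_le_add h1 (h2.trans h3))

variable [FiniteDimensional ℂ Q]

theorem continuous_gaussDeriv (P : Matrix ι ι Q) (v : ι → Q) (P' : Matrix ι ι Q) (y' : ι → Q) :
    Continuous (gaussDeriv P v P' y') := by
  unfold gaussDeriv quad
  have h1 := continuous_shifted v
  have h2 := gaussExp_continuous (S := P) (w := v)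
  fun_prop

variable [DecidableEq ι]

/-- This is `J' = -½ tr(P⁻¹ P') J`, multiplied by `det P` so that no inverse is needed. -/
theorem det_mul_integral_gaussDeriv {P P' : Matrix ι ι Q} {v y' : ι → Q} {C a : ℝ}
    (ha : 0 < a) (hP : P.IsSymm)
    (hd : ∀ x, (1 + ‖x‖) ^ 2 * ‖gaussExp P v x‖ ≤ C * Real.exp (-a * ∑ i, x i ^ 2)) :
    P.det * ∫ x, gaussDeriv P v P' y' x =
      (-(1 / 2) : ℂ) • ((P.adjugate * P').trace * ∫ x, gaussExp P v x) := by
  have hi1 := integrable_shifted_mul_gaussExp ha hd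
  have hi2 := integrable_shifted_mul_shifted_mul_gaussExp ha hd
  have hexp : ∀ x, gaussDeriv P v P' y' x =
      (-(1 / 2) : ℂ) • (∑ i, ∑ j, P' i j * (shifted v x j * shifted v x i * gaussExp P v x)) -
      ∑ i, y' i * ∑ j, P i j * (shifted v x j * gaussExp P v x) := fun x => by
    unfold gaussDeriv
    simp only [quad, sub_mul, smul_mul_assoc, Finset.sum_mul, Finset.mul_sum]
    congr 1
    · congr 1
      exact Finset.sum_congr rfl fun i _ => Finset.sum_congr rfl fun j _ => by ring
    · exact Finset.sum_congr rfl fun i _ => Finset.sum_congr rfl fun j _ => by ring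
  have hint2 : ∀ i j, Integrable fun x => P' i j *
      (shifted v x j * shifted v x i * gaussExp P v x) := fun i j => (hi2 j i).const_mul _
  have hint1 : ∀ i j, Integrable fun x => P i j * (shifted v x j * gaussExp P v x) :=
    fun i j => (hi1 j).const_mul _
  have hs1 : ∀ i, Integrable fun x => ∑ j, P i j * (shifted v x j * gaussExp P v x) :=
    fun i => integrable_finsetSum _ fun j _ => hint1 i j
  have hs2 : ∀ i, Integrable fun x => ∑ j, P' i j *
      (shifted v x j * shifted v x i * gaussExp P v x) :=
    fun i => integrable_finsetSum _ fun j _ => hint2 i j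
  have ht1 : Integrable fun x => ∑ i, y' i * ∑ j, P i j * (shifted v x j * gaussExp P v x) :=
    integrable_finsetSum _ fun i _ => (hs1 i).const_mul _
  have ht2 : Integrable fun x => (-(1 / 2) : ℂ) • (∑ i, ∑ j, P' i j *
      (shifted v x j * shifted v x i * gaussExp P v x)) :=
    Integrable.smul (-(1 / 2) : ℂ) (integrable_finsetSum _ fun i _ => hs2 i)
  simp_rw [hexp]
  rw [integral_sub ht2 ht1, integral_smul, integral_finsetSum _ fun i _ => hs2 i,
    integral_finsetSum _ fun i _ => (hs1 i).const_mul _]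
  -- The first-moment identity removes the velocity of the shift; this is why the integral will not
  -- depend on the shift.
  have hz : ∀ i, ∫ x, y' i * ∑ j, P i j * (shifted v x j * gaussExp P v x) = 0 := fun i => by
    rw [integral_const_mul_of_integrable (hs1 i), integral_finsetSum _ fun j _ => hint1 i j]
    simp_rw [integral_const_mul_of_integrable (hi1 _)]
    rw [integral_shifted_mul_gaussExp ha hd hP i, mul_zero]
  simp_rw [hz]
  rw [Finset.sum_const_zero, sub_zero, mul_smul_comm]
  congr 1
  set J := ∫ x, gaussExp P v x with hJ
  set M : Matrix ι ι Q := Matrix.of fun j m => ∫ x, shifted v x j * shifted v x m * gaussExp P v x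
    with hMdef
  have hPM : P * M = J • (1 : Matrix ι ι Q) := by
    ext l m
    rw [Matrix.mul_apply, Matrix.smul_apply, smul_eq_mul, mul_comm]
    exact integral_shifted_mul_shifted_mul_gaussExp ha hd hP l m
  -- Multiplying `P * M = J • 1` by the adjugate replaces inversion of `P`.
  have hM : P.det • M = J • P.adjugate := by
    rw [← Matrix.one_mul M, ← Matrix.smul_mul, ← Matrix.adjugate_mul, Matrix.mul_assoc, hPM,
      Matrix.mul_smul, Matrix.mul_one]
  have hsum : ∀ i, ∫ x, ∑ j, P' i j *
      (shifted v x j * shifted v x i * gaussExp P v x) = ∑ j, P' i j * M j i :=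
    fun i => by
      rw [integral_finsetSum _ fun j _ => hint2 i j]
      exact Finset.sum_congr rfl fun j _ => integral_const_mul_of_integrable (hi2 j i)
  simp_rw [hsum]
  have htr : ∑ i, ∑ j, P' i j * M j i = (P' * M).trace := rfl
  rw [htr, ← smul_eq_mul, ← Matrix.trace_smul, ← Matrix.mul_smul, hM, Matrix.mul_smul,
    Matrix.trace_smul, smul_eq_mul, mul_comm, Matrix.trace_mul_comm]

/-- The integral of the Gaussian along the path from the standard Gaussian. -/
def gaussPathIntegral (S : Matrix ι ι Q) (w : ι → Q) (u : ℝ) : Q :=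
  ∫ x, gaussExp (matrixPath S (Real.sin u ^ 2)) (((Real.sin u ^ 2 : ℝ) : ℂ) • w) x

/-- Differentiation under the integral; the dominating function is the uniform bound times a
constant majorizing `P`, `P'`, the shift and its velocity for every `u`. -/
theorem gaussPathIntegral_hasDerivAt {S : Matrix ι ι Q} {w : ι → Q} {C a : ℝ}
    (ha : 0 < a) (hsymm : S.IsSymm)
    (hdom : ∀ t ∈ Set.Icc (0 : ℝ) 1, ∀ x : ι → ℝ,
      (1 + ‖x‖) ^ 2 * ‖gaussExp (matrixPath S t) ((t : ℂ) • w) x‖ ≤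
        C * Real.exp (-a * ∑ i, x i ^ 2)) (u : ℝ) :
    HasDerivAt (gaussPathIntegral S w) (∫ x, gaussDeriv (matrixPath S (Real.sin u ^ 2))
      (((Real.sin u ^ 2 : ℝ) : ℂ) • w) (((2 * Real.sin u * Real.cos u : ℝ) : ℂ) • (S - 1))
      (fun i => -(((2 * Real.sin u * Real.cos u : ℝ) : ℂ) • w i)) x) u := by
  have ht' : ∀ u : ℝ, ‖((2 * Real.sin u * Real.cos u : ℝ) : ℂ)‖ ≤ 1 := fun u => by
    rw [Complex.norm_real]
    exact abs_sin_sq_deriv_le u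
  have hbound := fun u x => norm_gaussDeriv_le (c := ‖(1 : Q)‖ + ∑ i, ∑ j, ‖S i j‖)
    (c₁ := ∑ i, ∑ j, ‖(S - 1) i j‖) (d := ∑ i, ‖w i‖) (by positivity) (by positivity)
    (by positivity) (norm_matrixPath_le (sin_sq_mem_Icc u))
    (P' := ((2 * Real.sin u * Real.cos u : ℝ) : ℂ) • (S - 1))
    (fun i j => (norm_smul_le _ _).trans ((mul_le_of_le_one_left (norm_nonneg _) (ht' u)).trans
      ((norm_le_sum_norm (fun j => (S - 1) i j) j).trans
        (Finset.single_le_sum (f := fun i => ∑ j, ‖(S - 1) i j‖)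
        (fun _ _ => Finset.sum_nonneg fun _ _ => norm_nonneg _) (Finset.mem_univ i)))))
    (norm_vectorPath_le (sin_sq_mem_Icc u))
    (y' := fun i => -(((2 * Real.sin u * Real.cos u : ℝ) : ℂ) • w i))
    (fun i => by
      rw [norm_neg]
      exact (norm_smul_le _ _).trans ((mul_le_of_le_one_left (norm_nonneg _) (ht' u)).trans
        (norm_le_sum_norm w i))) x
  set M := (Fintype.card ι : ℝ) ^ 2 * ((∑ i, ∑ j, ‖(S - 1) i j‖) * (‖(1 : Q)‖ + ∑ i, ‖w i‖) ^ 2) +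
      Fintype.card ι * ((∑ i, ‖w i‖) * (Fintype.card ι * ((‖(1 : Q)‖ + ∑ i, ∑ j, ‖S i j‖) *
        (‖(1 : Q)‖ + ∑ i, ‖w i‖)))) with hM
  have hM0 : 0 ≤ M := by positivity
  have key := hasDerivAt_integral_of_dominated_loc_of_deriv_le
    (μ := (volume : Measure (ι → ℝ))) (x₀ := u)
    (bound := fun x => M * (C * Real.exp (-a * ∑ i, x i ^ 2)))
    (F := fun u x => gaussExp (matrixPath S (Real.sin u ^ 2)) (((Real.sin u ^ 2 : ℝ) : ℂ) • w) x)
    (F' := fun u x => gaussDeriv (matrixPath S (Real.sin u ^ 2))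
      (((Real.sin u ^ 2 : ℝ) : ℂ) • w) (((2 * Real.sin u * Real.cos u : ℝ) : ℂ) • (S - 1))
      (fun i => -(((2 * Real.sin u * Real.cos u : ℝ) : ℂ) • w i)) x) (s := Set.univ)
    Filter.univ_mem (Filter.Eventually.of_forall fun v => gaussExp_continuous.aestronglyMeasurable)
    (integrable_gaussExp ha (hdom _ (sin_sq_mem_Icc u)))
    (continuous_gaussDeriv _ _ _ _).aestronglyMeasurable
    (Filter.Eventually.of_forall fun x v _ => (hbound v x).trans
      (mul_le_mul_of_nonneg_left (hdom _ (sin_sq_mem_Icc v) x) hM0))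
    (((integrable_exp_neg_mul_sum_sq ha).const_mul C).const_mul M)
    (Filter.Eventually.of_forall fun x v _ => gaussExp_hasDerivAt (matrixPath_isSymm hsymm _)
      (matrixPath_hasDerivAt S (sin_sq_hasDerivAt v))
      (shifted_path_hasDerivAt w (sin_sq_hasDerivAt v) x))
  exact key.2

theorem gaussPathIntegral_zero (S : Matrix ι ι Q) (w : ι → Q) :
    gaussPathIntegral S w 0 =
      algebraMap ℝ Q (∫ x : ι → ℝ, Real.exp (-(1 / 2) * ∑ i, x i ^ 2)) := by
  have : CompleteSpace Q := FiniteDimensional.complete ℂ Q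
  let : NormedAlgebra ℚ Q := NormedAlgebra.restrictScalars ℚ ℝ Q
  have h : ∀ x : ι → ℝ, gaussExp (matrixPath S (Real.sin 0 ^ 2))
      (((Real.sin 0 ^ 2 : ℝ) : ℂ) • w) x =
      Real.exp (-(1 / 2) * ∑ i, x i ^ 2) • (1 : Q) := fun x => by
    have hq : gaussExponent (matrixPath S (Real.sin 0 ^ 2)) (((Real.sin 0 ^ 2 : ℝ) : ℂ) • w) x =
        algebraMap ℝ Q (-(1 / 2) * ∑ i, x i ^ 2) := by
      rw [IsScalarTower.algebraMap_apply ℝ ℂ Q]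
      have h1 : matrixPath S (Real.sin 0 ^ 2) = 1 := by simp [matrixPath]
      rw [h1]
      simp [gaussExponent, quad, shifted, Matrix.one_apply, Algebra.smul_def, map_sum, pow_two]
    rw [gaussExp, hq, ← Algebra.algebraMap_eq_smul_one, Real.exp_eq_exp_ℝ]
    exact (NormedSpace.algebraMap_exp_comm (𝔸 := Q) _).symm
  unfold gaussPathIntegral
  simp_rw [h]
  rw [integral_smul_const, Algebra.algebraMap_eq_smul_one]

/-- Here `I` and `I'` are the derivatives of the two integrals `J` and `J'`, and `T` is that of the
determinant `D`. The logarithmic derivatives `-½`, `-½` and `1` add up to zero. -/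
theorem leibniz_eq_zero {Q : Type*} [CommRing Q] [Algebra ℂ Q] {D T I I' J J' : Q}
    (h : D * I = (-(1 / 2) : ℂ) • (T * J)) (h' : D * I' = (-(1 / 2) : ℂ) • (T * J')) :
    (I * J' + J * I') * D + J * J' * T = 0 := by
  have hc : algebraMap ℂ Q (-(1 / 2)) + algebraMap ℂ Q (-(1 / 2)) = -1 := by
    rw [← map_add, ← map_one (algebraMap ℂ Q), ← map_neg]
    norm_num
  rw [Algebra.smul_def] at h h'
  linear_combination J' * h + J * h' + T * J * J' * hc

theorem integral_gaussExp_mul_integral_gaussExp_mul_det {S₀ : Matrix ι ι ℂ} {S : Matrix ι ι Q}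
    {w w' : ι → Q} (hpos : ∀ x : ι → ℝ, x ≠ 0 → 0 < ∑ i, ∑ j, (S₀ i j).re * x i * x j)
    (hsymm : S.IsSymm) (hS : ∀ i j, IsNilpotent (S i j - algebraMap ℂ Q (S₀ i j)))
    (hw : ∀ i, IsNilpotent (w i)) (hw' : ∀ i, IsNilpotent (w' i)) :
    Integrable (gaussExp S w) ∧
      (∫ x, gaussExp S w x) * (∫ x, gaussExp S w' x) * S.det =
        algebraMap ℝ Q ((2 * Real.pi) ^ Fintype.card ι) := by
  obtain ⟨C, a, ha, hdom⟩ := exists_gaussian_bound hpos hS hw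
  obtain ⟨C', a', ha', hdom'⟩ := exists_gaussian_bound hpos hS hw'
  have hone : ∀ w : ι → Q, gaussExp (matrixPath S 1) (((1 : ℝ) : ℂ) • w) = gaussExp S w :=
    fun w => by simp [matrixPath]
  have hint : Integrable (gaussExp S w) := by
    rw [← hone]
    exact integrable_gaussExp ha (hdom 1 (by simp))
  refine ⟨hint, ?_⟩
  let D : ℝ → Q := fun u => (matrixPath S (Real.sin u ^ 2)).det
  have hD : ∀ u, HasDerivAt D _ u := fun u =>
    det_hasDerivAt (matrixPath_hasDerivAt S (sin_sq_hasDerivAt u))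
  have hder : ∀ u, HasDerivAt (fun u => gaussPathIntegral S w u * gaussPathIntegral S w' u * D u)
      0 u := fun u => by
    refine (((gaussPathIntegral_hasDerivAt ha hsymm hdom u).mul
      (gaussPathIntegral_hasDerivAt ha' hsymm hdom' u)).mul (hD u)).congr_deriv ?_
    have h1 := det_mul_integral_gaussDeriv (P' := ((2 * Real.sin u * Real.cos u : ℝ) : ℂ) • (S - 1))
      (y' := fun i => -(((2 * Real.sin u * Real.cos u : ℝ) : ℂ) • w i)) ha
      (matrixPath_isSymm hsymm _) (hdom _ (sin_sq_mem_Icc u))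
    have h2 := det_mul_integral_gaussDeriv (P' := ((2 * Real.sin u * Real.cos u : ℝ) : ℂ) • (S - 1))
      (y' := fun i => -(((2 * Real.sin u * Real.cos u : ℝ) : ℂ) • w' i)) ha'
      (matrixPath_isSymm hsymm _) (hdom' _ (sin_sq_mem_Icc u))
    change _ = (-(1 / 2) : ℂ) • (_ * gaussPathIntegral S w u) at h1
    change _ = (-(1 / 2) : ℂ) • (_ * gaussPathIntegral S w' u) at h2
    exact leibniz_eq_zero h1 h2
  -- At `u = 0` the path is at the identity matrix with zero shift, at `u = π / 2` it is at `S` with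
  -- the given shift.
  have hconst := is_const_of_deriv_eq_zero (fun u => (hder u).differentiableAt)
    (fun u => (hder u).deriv) (Real.pi / 2) 0
  have h0 : D 0 = 1 := by simp [D, matrixPath]
  have h1 : D (Real.pi / 2) = S.det := by simp [D, matrixPath]
  have h2 : ∀ w, gaussPathIntegral S w (Real.pi / 2) = ∫ x, gaussExp S w x := fun w => by
    rw [← hone w]
    simp [gaussPathIntegral]
  rw [h0, h1, h2, h2, gaussPathIntegral_zero, gaussPathIntegral_zero, mul_one, ← map_mul, ← pow_two,
    integral_exp_neg_half_sum_sq] at hconst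
  exact hconst

end Normed

end Gaussian

end

end SuperPf

namespace SuperPf

noncomputable section

/-! ### The Gaussian integral formula without a norm -/

section Gaussian

/-- The Gaussian integral over a finite dimensional commutative algebra `Q`: for a symmetric matrix
`S` whose body has positive definite real part, `∫ exp(-½ (x-w)ᵀ S (x-w)) dx` is an inverse square
root of `det S / (2π)^m`, which does not depend on the nilpotent vector `w`. -/
theorem gaussian_integral {ι : Type*} [Fintype ι] [DecidableEq ι] {Q : Type*} [hQ : CommRing Q]
    [hA : Algebra ℂ Q] [FiniteDimensional ℂ Q]
    {S₀ : Matrix ι ι ℂ} {S : Matrix ι ι Q} {w w' : ι → Q}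
    (hpos : ∀ x : ι → ℝ, x ≠ 0 → 0 < ∑ i, ∑ j, (S₀ i j).re * x i * x j)
    (hsymm : S.IsSymm) (hS : ∀ i j, IsNilpotent (S i j - algebraMap ℂ Q (S₀ i j)))
    (hw : ∀ i, IsNilpotent (w i)) (hw' : ∀ i, IsNilpotent (w' i)) :
    Converges (gaussFun S₀ S w) ∧
      vectorIntegral (gaussFun S₀ S w) * vectorIntegral (gaussFun S₀ S w') * S.det =
        algebraMap ℂ Q (((2 * Real.pi) ^ Fintype.card ι : ℝ) : ℂ) := by
  -- The statement involves no norm, so one may be chosen; the analytic exponential then agrees with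
  -- the algebraic one.
  obtain ⟨i, j, rfl, h⟩ := exists_normedCommRing Q
  obtain rfl := eq_of_heq h
  have h1 := integral_gaussExp_mul_integral_gaussExp_mul_det hpos hsymm hS hw hw'
  have h2 := integral_gaussExp_mul_integral_gaussExp_mul_det hpos hsymm hS hw' hw
  have e1 : gaussExp S w = gaussFun S₀ S w := funext (gaussExp_eq_gaussFun hS hw)
  have e2 : gaussExp S w' = gaussFun S₀ S w' := funext (gaussExp_eq_gaussFun hS hw')
  rw [e1, e2] at h1 h2
  refine ⟨converges_of_integrable h1.1, ?_⟩
  rw [vectorIntegral_eq_integral h1.1, vectorIntegral_eq_integral h2.1]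
  exact h1.2.trans (IsScalarTower.algebraMap_apply ℝ ℂ Q _)

end Gaussian

end

end SuperPf

namespace SuperPf

noncomputable section

/-! ### The Pfaffian -/

section SquareZero

variable {Q : Type*} [CommRing Q]

theorem add_pow_succ_of_sq_zero {g : Q} (hg : g ^ 2 = 0) (G : Q) (m : ℕ) :
    (g + G) ^ (m + 1) = G ^ (m + 1) + (m + 1) * g * G ^ m := by
  induction m with
  | zero => ring
  | succ m ih =>
    rw [pow_succ, ih]
    push_cast
    linear_combination (m + 1) * G ^ m * hg

/-- Only squarefree monomials survive in a power of the sum; at the exponent `s.card` there is one,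
counted once for each ordering of its factors. -/
theorem sum_pow_of_sq_zero {ι : Type*} (s : Finset ι) (g : ι → Q) (hg : ∀ i, g i ^ 2 = 0) :
    (∑ i ∈ s, g i) ^ (s.card + 1) = 0 ∧
      (∑ i ∈ s, g i) ^ s.card = s.card.factorial * ∏ i ∈ s, g i := by
  classical
  induction s using Finset.induction_on with
  | empty => simp
  | insert a s ha ih =>
    obtain ⟨h0, h1⟩ := ih
    rw [Finset.sum_insert ha, Finset.prod_insert ha, Finset.card_insert_of_notMem ha,
      add_pow_succ_of_sq_zero (hg a), add_pow_succ_of_sq_zero (hg a), h0, h1, pow_succ, h0,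
      Nat.factorial_succ]
    refine ⟨by ring, by push_cast; ring⟩

end SquareZero

/-- Each `y i` has to pass every `x j` with `j > i`, which makes `n (n - 1) / 2` sign changes. -/
theorem prod_ofFn_mul {T : Type*} [Ring T] {n : ℕ} (x y : Fin n → T)
    (h : ∀ i j, y i * x j = -(x j * y i)) :
    (List.ofFn fun i => x i * y i).prod =
      (-1) ^ (n * (n - 1) / 2) * ((List.ofFn x).prod * (List.ofFn y).prod) := by
  have hcomm : ∀ {m : ℕ} (v : Fin m → T) (u : T), (∀ i, u * v i = -(v i * u)) →
      u * (List.ofFn v).prod = (-1) ^ m * ((List.ofFn v).prod * u) := by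
    intro m
    induction m with
    | zero => intro v u _; simp
    | succ m ih =>
      intro v u hu
      rw [List.ofFn_succ, List.prod_cons, ← mul_assoc, hu, neg_mul, mul_assoc,
        ih _ _ fun i => hu i.succ, pow_succ]
      simp only [mul_neg, mul_one, neg_mul, mul_assoc]
      rw [← mul_assoc, ← mul_assoc ((-1) ^ m : T), ((Commute.neg_one_left (v 0)).pow_left m).eq]
  induction n with
  | zero => simp
  | succ n ih =>
    rw [List.ofFn_succ, List.ofFn_succ, List.ofFn_succ, List.prod_cons, List.prod_cons,
      List.prod_cons, ih _ _ fun i j => h i.succ j.succ]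
    have h2 := hcomm (fun i => x i.succ) (y 0) fun i => h 0 i.succ
    have he : (n + 1) * (n + 1 - 1) / 2 = n * (n - 1) / 2 + n := by
      rw [← Finset.sum_range_id_mul_two, ← Finset.sum_range_id_mul_two,
        Nat.mul_div_cancel _ two_pos, Nat.mul_div_cancel _ two_pos, Finset.sum_range_succ]
    have hc : ∀ (k : ℕ) (t : T), t * (-1) ^ k = (-1) ^ k * t := fun k t =>
      ((Commute.neg_one_left t).pow_left k).eq.symm
    rw [he, pow_add]
    calc x 0 * y 0 * ((-1) ^ (n * (n - 1) / 2) * ((List.ofFn fun i => x i.succ).prod *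
          (List.ofFn fun i => y i.succ).prod))
        = x 0 * (y 0 * (-1) ^ (n * (n - 1) / 2)) * ((List.ofFn fun i => x i.succ).prod *
          (List.ofFn fun i => y i.succ).prod) := by simp only [mul_assoc]
      _ = (x 0 * (-1) ^ (n * (n - 1) / 2)) * (y 0 * (List.ofFn fun i => x i.succ).prod) *
          (List.ofFn fun i => y i.succ).prod := by rw [hc _ (y 0)]; simp only [mul_assoc]
      _ = _ := by
        rw [h2, hc _ (x 0), ← mul_assoc _ ((-1) ^ n), mul_assoc _ (x 0), hc n (x 0)]
        simp only [mul_assoc]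

section Pfaffian

open ExteriorAlgebra

variable {A : Type*} [CommRing A] {n : ℕ}

theorem ιMulti_eq_det_smul (v : Fin n → Fin n → A) :
    ιMulti A n v = (Pi.basisFun A (Fin n)).det v • ιMulti A n (Pi.basisFun A (Fin n)) := by
  have : ιMulti A n = (LinearMap.toSpanSingleton A _
      (ιMulti A n (Pi.basisFun A (Fin n)))).compAlternatingMap (Pi.basisFun A (Fin n)).det := by
    refine Module.Basis.ext_alternating (Pi.basisFun A (Fin n)) fun f hf => ?_
    let σ : Equiv.Perm (Fin n) := Equiv.ofBijective f (Finite.injective_iff_bijective.1 hf)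
    have h1 : (fun i => Pi.basisFun A (Fin n) (f i)) = (Pi.basisFun A (Fin n)) ∘ σ := rfl
    rw [h1, AlternatingMap.map_perm, AlternatingMap.map_perm,
      LinearMap.compAlternatingMap_apply, Module.Basis.det_self, LinearMap.toSpanSingleton_apply,
      one_smul]
  exact DFunLike.congr_fun this v

theorem ιMulti_eq_zero_of_lt {k : ℕ} (hk : n < k) :
    (ιMulti A k : (Fin n → A) [⋀^Fin k]→ₗ[A] _) = 0 :=
  Module.Basis.ext_alternating (Pi.basisFun A (Fin n)) fun f hf => by
    have := Fintype.card_le_of_injective f hf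
    simp at this
    omega

theorem exteriorPower_top_eq {y : ExteriorAlgebra A (Fin n → A)} (hy : y ∈ ⋀[A]^n (Fin n → A)) :
    ∃ c : A, y = c • ιMulti A n (Pi.basisFun A (Fin n)) := by
  rw [← ιMulti_span_fixedDegree] at hy
  have h : Submodule.span A (Set.range (ιMulti A n (M := Fin n → A))) ≤
      Submodule.span A {ιMulti A n (Pi.basisFun A (Fin n))} := by
    rw [Submodule.span_le]
    rintro _ ⟨v, rfl⟩
    rw [ιMulti_eq_det_smul v]
    exact Submodule.mem_span_singleton.2 ⟨_, rfl⟩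
  obtain ⟨c, hc⟩ := Submodule.mem_span_singleton.1 (h hy)
  exact ⟨c, hc.symm⟩

theorem exteriorPower_eq_zero_of_lt {k : ℕ} (hk : n < k) {y : ExteriorAlgebra A (Fin n → A)}
    (hy : y ∈ ⋀[A]^k (Fin n → A)) : y = 0 := by
  rw [← ιMulti_span_fixedDegree, ιMulti_eq_zero_of_lt hk] at hy
  have : Set.range (0 : (Fin n → A) [⋀^Fin k]→ₗ[A] ExteriorAlgebra A (Fin n → A)) ⊆ {0} := by
    rintro _ ⟨v, rfl⟩
    rfl
  simpa using Submodule.span_mono this hy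

/-- The quadratic element `∑ N i j x i x j` of an exterior algebra, for vectors `x`. -/
def quadElt {M : Type*} [AddCommGroup M] [Module A M] (N : Matrix (Fin n) (Fin n) A)
    (x : Fin n → M) : ExteriorAlgebra A M :=
  ∑ i, ∑ j, N i j • (ι A (x i) * ι A (x j))

theorem quadElt_pow_mem (N : Matrix (Fin n) (Fin n) A) {M : Type*} [AddCommGroup M] [Module A M]
    (x : Fin n → M) (j : ℕ) : quadElt N x ^ j ∈ ⋀[A]^(2 * j) M := by
  rw [mul_comm]
  refine SetLike.pow_mem_graded (A := fun k : ℕ => ⋀[A]^k M) j (i := 2) (r := quadElt N x) ?_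
  refine Submodule.sum_mem _ fun i _ => Submodule.sum_mem _ fun j _ => Submodule.smul_mem _ _ ?_
  change _ ∈ LinearMap.range (ι A (M := M)) ^ 2
  rw [pow_two]
  exact Submodule.mul_mem_mul ⟨_, rfl⟩ ⟨_, rfl⟩

theorem ι_mul_ι_mem_center {M : Type*} [AddCommGroup M] [Module A M] (u v : M) :
    ι A u * ι A v ∈ Subalgebra.center A (ExteriorAlgebra A M) := by
  rw [Subalgebra.mem_center_iff]
  intro y
  induction y using ExteriorAlgebra.induction with
  | algebraMap r => exact Algebra.commutes _ _
  | ι w =>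
    have h1 := ι_add_mul_swap (R := A) w u
    have h2 := ι_add_mul_swap (R := A) w v
    rw [← mul_assoc, eq_neg_of_add_eq_zero_left h1, neg_mul, mul_assoc,
      eq_neg_of_add_eq_zero_left h2, mul_neg, neg_neg, mul_assoc]
  | mul a b ha hb => rw [mul_assoc, hb, ← mul_assoc, ha, mul_assoc]
  | add a b ha hb => rw [add_mul, mul_add, ha, hb]

theorem map_quadElt {M M' : Type*} [AddCommGroup M] [Module A M] [AddCommGroup M'] [Module A M']
    (f : M →ₗ[A] M') (N : Matrix (Fin n) (Fin n) A) (x : Fin n → M) :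
    ExteriorAlgebra.map f (quadElt N x) = quadElt N (f ∘ x) := by
  simp [quadElt, map_sum]

theorem quadElt_mem_center {M : Type*} [AddCommGroup M] [Module A M] (N : Matrix (Fin n) (Fin n) A)
    (x : Fin n → M) : quadElt N x ∈ Subalgebra.center A (ExteriorAlgebra A M) :=
  Subalgebra.sum_mem _ fun _ _ => Subalgebra.sum_mem _ fun _ _ =>
    Subalgebra.smul_mem _ (ι_mul_ι_mem_center _ _) _

/-- By functoriality of the exterior algebra, the coefficient found on the standard basis is valid
for any vectors in any module. It is used for two families in a space of twice the rank. -/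
theorem quadElt_pow_eq {N : Matrix (Fin n) (Fin n) A} {m : ℕ} {c : A}
    (hc : quadElt N (Pi.basisFun A (Fin n)) ^ m = c • ιMulti A n (Pi.basisFun A (Fin n)))
    {M : Type*} [AddCommGroup M] [Module A M] (x : Fin n → M) :
    quadElt N x ^ m = c • ιMulti A n x := by
  have h := congrArg (ExteriorAlgebra.map ((Pi.basisFun A (Fin n)).constr A x)) hc
  have hx : (Pi.basisFun A (Fin n)).constr A x ∘ Pi.basisFun A (Fin n) = x :=
    funext fun i => Module.Basis.constr_basis _ _ _ _
  rw [map_pow, map_quadElt, map_smul, map_apply_ιMulti, hx] at h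
  exact h

theorem quadElt_pow_eq_zero (N : Matrix (Fin n) (Fin n) A) {j : ℕ} (hj : n < 2 * j)
    {M : Type*} [AddCommGroup M] [Module A M] (x : Fin n → M) : quadElt N x ^ j = 0 := by
  have h := congrArg (ExteriorAlgebra.map ((Pi.basisFun A (Fin n)).constr A x))
    (exteriorPower_eq_zero_of_lt hj (quadElt_pow_mem N (Pi.basisFun A (Fin n)) j))
  have hx : (Pi.basisFun A (Fin n)).constr A x ∘ Pi.basisFun A (Fin n) = x :=
    funext fun i => Module.Basis.constr_basis _ _ _ _
  rw [map_pow, map_quadElt, map_zero, hx] at h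
  exact h

theorem ιMulti_linear_combination {M : Type*} [AddCommGroup M] [Module A M]
    (N : Matrix (Fin n) (Fin n) A) (b : Fin n → M) :
    ιMulti A n (fun i => ∑ j, N i j • b j) = N.det • ιMulti A n b := by
  have h := congrArg (ExteriorAlgebra.map ((Pi.basisFun A (Fin n)).constr A b))
    (ιMulti_eq_det_smul fun i => N i)
  rw [map_smul, map_apply_ιMulti, map_apply_ιMulti, Pi.basisFun_det_apply] at h
  convert! h using 2
  · funext i
    simp [Module.Basis.constr_apply_fintype]
  · congr 1
    exact (funext fun i => Module.Basis.constr_basis _ _ _ _).symm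

/-- Polarization: since `I ^ 2 = -1`, the terms in `a a` and `b b` cancel, and antisymmetry of `N`
identifies the two kinds of mixed terms. -/
theorem quadElt_add_quadElt {M : Type*} [AddCommGroup M] [Module A M]
    {N : Matrix (Fin n) (Fin n) A} (hN : N.transpose = -N) {I : A} (hI : I * I = -1)
    (a b : Fin n → M) :
    quadElt N (a + b) + quadElt N (I • (a - b)) =
      ∑ i, (4 : A) • (ι A (a i) * ι A (∑ j, N i j • b j)) := by
  have h1 : ∀ i j, ι A ((a + b) i) * ι A ((a + b) j) +
      ι A ((I • (a - b)) i) * ι A ((I • (a - b)) j) =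
      (2 : A) • (ι A (a i) * ι A (b j)) + (2 : A) • (ι A (b i) * ι A (a j)) := fun i j => by
    simp only [Pi.add_apply, Pi.smul_apply, Pi.sub_apply, map_add, map_smul, map_sub,
      smul_mul_smul_comm, hI, two_smul, neg_smul, one_smul]
    noncomm_ring
  have h2 : ∑ i, ∑ j, N i j • (ι A (b i) * ι A (a j)) =
      ∑ i, ∑ j, N i j • (ι A (a i) * ι A (b j)) := by
    rw [Finset.sum_comm]
    refine Finset.sum_congr rfl fun i _ => Finset.sum_congr rfl fun j _ => ?_
    have hij : N j i = -N i j := congrFun (congrFun hN i) j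
    rw [hij, eq_neg_of_add_eq_zero_left (ι_add_mul_swap (R := A) (b j) (a i)), neg_smul, smul_neg,
      neg_neg]
  have h3 : quadElt N (a + b) + quadElt N (I • (a - b)) =
      (2 : A) • (∑ i, ∑ j, N i j • (ι A (a i) * ι A (b j))) +
        (2 : A) • ∑ i, ∑ j, N i j • (ι A (b i) * ι A (a j)) := by
    simp only [quadElt, Finset.smul_sum, ← Finset.sum_add_distrib, ← smul_add, h1]
    refine Finset.sum_congr rfl fun i _ => Finset.sum_congr rfl fun j _ => ?_
    simp only [smul_add]
    rw [smul_comm (N i j) (2 : A), smul_comm (N i j) (2 : A)]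
  rw [h3, h2, ← add_smul, Finset.smul_sum]
  refine Finset.sum_congr rfl fun i _ => ?_
  rw [map_sum, Finset.mul_sum]
  norm_num

/-- The polarization identity is raised to the power `n` in the center. On the left only the middle
binomial term survives for degree reasons; on the right each summand has square zero. -/
theorem quadElt_pow_mul_quadElt_pow {M : Type*} [AddCommGroup M] [Module A M]
    {N : Matrix (Fin n) (Fin n) A} (hN : N.transpose = -N) {I : A} (hI : I * I = -1)
    (a b : Fin n → M) {m : ℕ} (hm : n = 2 * m) :
    (n.choose m : A) • (quadElt N (a + b) ^ m * quadElt N (I • (a - b)) ^ m) =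
      (n.factorial * 4 ^ n : A) •
        (List.ofFn fun i => ι A (a i) * ι A (∑ j, N i j • b j)).prod := by
  let Z := Subalgebra.center A (ExteriorAlgebra A M)
  let E₁ : Z := ⟨quadElt N (a + b), quadElt_mem_center N _⟩
  let E₂ : Z := ⟨quadElt N (I • (a - b)), quadElt_mem_center N _⟩
  let g : Fin n → Z := fun i => ⟨ι A (a i) * ι A (∑ j, N i j • b j), ι_mul_ι_mem_center _ _⟩
  have hsum : E₁ + E₂ = ∑ i, (4 : A) • g i := by
    refine Subtype.ext ?_
    simpa [E₁, E₂, g] using quadElt_add_quadElt hN hI a b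
  have hg : ∀ i, ((4 : A) • g i) ^ 2 = 0 := fun i => by
    rw [smul_pow]
    have : g i ^ 2 = 0 := by
      refine Subtype.ext ?_
      have hc := Subalgebra.mem_center_iff.1 (ι_mul_ι_mem_center (A := A) (a i)
        (∑ j, N i j • b j)) (ι A (a i))
      change (ι A (a i) * ι A (∑ j, N i j • b j)) ^ 2 = 0
      rw [pow_two, ← mul_assoc, ← hc, ← mul_assoc, ι_sq_zero, zero_mul, zero_mul]
    rw [this, smul_zero]
  have h1 := (sum_pow_of_sq_zero Finset.univ _ hg).2
  rw [← hsum, Finset.card_univ, Fintype.card_fin, add_pow,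
    Finset.sum_eq_single m (fun j hj hjm => ?_) (fun h => absurd (Finset.mem_range.2 (by omega)) h)]
    at h1
  · have h2 := congrArg (Subalgebra.val Z) h1
    have hp : (Subalgebra.val Z) (∏ i, (4 : A) • g i) = (4 ^ n : A) •
        (List.ofFn fun i => ι A (a i) * ι A (∑ j, N i j • b j)).prod := by
      rw [Finset.prod_smul, map_smul, Finset.prod_const, Finset.card_univ, Fintype.card_fin,
        ← List.prod_ofFn, map_list_prod, List.map_ofFn]
      rfl
    have hnm : n - m = m := by omega
    rw [map_mul, map_mul, map_mul, hp, hnm, map_pow, map_pow, map_natCast, map_natCast] at h2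
    rw [mul_smul, Nat.cast_smul_eq_nsmul, Nat.cast_smul_eq_nsmul, nsmul_eq_mul, nsmul_eq_mul, ← h2]
    exact (Nat.cast_commute _ _).eq
  · rcases lt_or_gt_of_ne hjm with h | h
    · have : E₂ ^ (n - j) = 0 := Subtype.ext (quadElt_pow_eq_zero N (by omega) _)
      rw [this]
      ring
    · have : E₁ ^ j = 0 := Subtype.ext (quadElt_pow_eq_zero N (by omega) _)
      rw [this]
      ring

/-- Factor by factor, `(a + b) ∧ I (a - b) = -2 I (a ∧ b)`, and `(-2 I) ^ 2 = -4`. -/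
theorem ιMulti_mul_ιMulti_eq {M : Type*} [AddCommGroup M] [Module A M] {I : A} (hI : I * I = -1)
    (a b : Fin n → M) {m : ℕ} (hm : n = 2 * m) :
    ιMulti A n (a + b) * ιMulti A n (I • (a - b)) =
      ((-4) ^ m * (-1) ^ (n * (n - 1) / 2) : A) •
        (List.ofFn fun i => ι A (a i) * ι A (b i)).prod := by
  have hs := prod_ofFn_mul (fun i => ι A ((a + b) i)) (fun i => ι A ((I • (a - b)) i)) fun i j =>
    eq_neg_of_add_eq_zero_left (ι_add_mul_swap _ _)
  have hpt : ∀ i, ι A ((a + b) i) * ι A ((I • (a - b)) i) =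
      (-2 * I) • (ι A (a i) * ι A (b i)) := fun i => by
    have h := eq_neg_of_add_eq_zero_left (ι_add_mul_swap (R := A) (b i) (a i))
    simp only [Pi.add_apply, Pi.smul_apply, Pi.sub_apply, map_add, map_smul, map_sub,
      mul_smul_comm, mul_sub, add_mul, ι_sq_zero, h]
    module
  have hsm : ∀ (l : ℕ) (c : A) (v : Fin l → ExteriorAlgebra A M),
      (List.ofFn fun i => c • v i).prod = c ^ l • (List.ofFn v).prod := by
    intro l c
    induction l with
    | zero => simp
    | succ l ih =>
      intro v
      rw [List.ofFn_succ, List.ofFn_succ, List.prod_cons, List.prod_cons, ih, smul_mul_smul_comm,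
        pow_succ']
  have hpow : (-2 * I) ^ n = (-4) ^ m := by
    rw [hm, pow_mul]
    congr 1
    linear_combination 4 * hI
  simp only [hpt, hsm, hpow] at hs
  have hsq : ((-1) ^ (n * (n - 1) / 2) : A) * (-1) ^ (n * (n - 1) / 2) = 1 := by
    rw [← mul_pow]
    simp
  have hcast : ((-1) ^ (n * (n - 1) / 2) : ExteriorAlgebra A M) =
      algebraMap A _ ((-1) ^ (n * (n - 1) / 2)) := by simp
  rw [hcast, ← Algebra.smul_def] at hs
  rw [mul_comm ((-4) ^ m : A), mul_smul, hs, smul_smul, hsq, one_smul, ιMulti_apply, ιMulti_apply]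

/-- The Pfaffian of an antisymmetric matrix `N` of even size `2 m`: the coefficient `c` of the
top degree element in `(∑ N i j x i x j) ^ m` satisfies `c ^ 2 = (2 ^ m m!) ^ 2 det N`. -/
theorem exists_quadElt_pow_eq [Algebra ℂ A] {N : Matrix (Fin n) (Fin n) A}
    (hN : N.transpose = -N) {m : ℕ} (hm : n = 2 * m) :
    ∃ c : A, quadElt N (Pi.basisFun A (Fin n)) ^ m = c • ιMulti A n (Pi.basisFun A (Fin n)) ∧
      c ^ 2 = (2 ^ m * m.factorial) ^ 2 * N.det := by
  have hmem := quadElt_pow_mem N (Pi.basisFun A (Fin n)) m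
  rw [← hm] at hmem
  obtain ⟨c, hc⟩ := exteriorPower_top_eq hmem
  refine ⟨c, hc, ?_⟩
  set I : A := algebraMap ℂ A Complex.I with hIdef
  have hI : I * I = -1 := by rw [hIdef, ← map_mul, Complex.I_mul_I, map_neg, map_one]
  -- In the doubled space the left side of the power identity is `c ^ 2` and the right side `det N`,
  -- up to constants, times the same top element `a ∧ b`.
  let e := Pi.basisFun A (Fin (n + n))
  let a : Fin n → Fin (n + n) → A := fun i => e (Fin.castAdd n i)
  let b : Fin n → Fin (n + n) → A := fun i => e (Fin.natAdd n i)
  have h1 := quadElt_pow_mul_quadElt_pow hN hI a b hm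
  rw [quadElt_pow_eq hc, quadElt_pow_eq hc, smul_mul_smul_comm, ιMulti_mul_ιMulti_eq hI a b hm,
    prod_ofFn_mul _ _ fun i j => eq_neg_of_add_eq_zero_left (ι_add_mul_swap _ _),
    prod_ofFn_mul _ _ fun i j => eq_neg_of_add_eq_zero_left (ι_add_mul_swap _ _),
    ← ιMulti_apply, ← ιMulti_apply, ← ιMulti_apply, ιMulti_linear_combination] at h1
  have hcast : ((-1) ^ (n * (n - 1) / 2) : ExteriorAlgebra A (Fin (n + n) → A)) =
      algebraMap A _ ((-1) ^ (n * (n - 1) / 2)) := by simp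
  -- With `n = 2 m` the exponent is `m (n - 1)`, and `n - 1` is odd when `m > 0`.
  have hsign : ((-1) ^ (n * (n - 1) / 2) : A) = (-1) ^ m := by
    have : n * (n - 1) / 2 = m * (n - 1) := by
      rw [hm, mul_assoc, Nat.mul_div_cancel_left _ two_pos]
    rcases Nat.eq_zero_or_pos m with rfl | hpos
    · simp [this]
    · rw [this, mul_comm, pow_mul, Odd.neg_one_pow (n := n - 1) ⟨m - 1, by omega⟩]
  have hab : ιMulti A n a * ιMulti A n b = ιMulti A (n + n) e := by
    rw [ιMulti_mul_ιMulti]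
    congr 1
    exact Fin.append_castAdd_natAdd (f := e)
  rw [hcast, ← Algebra.smul_def, ← Algebra.smul_def, mul_smul_comm, hab, hsign] at h1
  -- This functional reads off the coefficient of the top element.
  have h2 := congrArg (liftAlternating (R := A) (Pi.single (n + n) e.det)) h1
  simp only [map_smul, liftAlternating_apply_ιMulti, Pi.single_eq_same, Module.Basis.det_self,
    smul_eq_mul, mul_one] at h2
  have hsq : ((-1) ^ m : A) * (-1) ^ m = 1 := by rw [← mul_pow]; simp
  have h4 : ((-4) ^ m : A) = (-1) ^ m * 4 ^ m := by rw [← mul_pow]; simp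
  have h16 : (4 ^ n : A) = 4 ^ m * 4 ^ m := by rw [hm, two_mul, pow_add]
  have h44 : (4 ^ m : A) = 2 ^ m * 2 ^ m := by rw [← mul_pow]; norm_num
  have hch : (n.factorial : A) = n.choose m * (m.factorial * m.factorial) := by
    have := Nat.choose_mul_factorial_mul_factorial (n := n) (k := m) (by omega)
    rw [← this, show n - m = m by omega]
    push_cast
    ring
  rw [h16, h4, hch] at h2
  have hu : ∀ k : ℕ, k ≠ 0 → IsUnit (k : A) := fun k hk => by
    rw [← map_natCast (algebraMap ℂ A)]
    exact (IsUnit.mk0 (k : ℂ) (Nat.cast_ne_zero.2 hk)).map _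
  have hu' : IsUnit ((n.choose m : A) * 4 ^ m) := by
    refine (hu _ (Nat.choose_pos (by omega)).ne').mul (IsUnit.pow _ ?_)
    exact_mod_cast hu 4 (by norm_num)
  have hsu : IsUnit ((-1) ^ m : A) := (isUnit_one.neg).pow _
  refine hu'.mul_left_cancel (hsu.mul_left_cancel ?_)
  linear_combination h2 - (n.choose m * c ^ 2 * 4 ^ m * (-1) ^ m : A) * hsq +
    (n.choose m * m.factorial ^ 2 * N.det * (-1) ^ m * 4 ^ m : A) * h44

end Pfaffian

end

end SuperPf

namespace SuperPf

noncomputable section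

/-! ### The algebra `Λ(V₁*) ⊗ R` -/

section OddFun

variable {R : Type*} [Ring R] [Algebra ℂ R] {ℛ : ZMod 2 → Submodule ℂ R} [GradedAlgebra ℛ] {n : ℕ}

variable (ℛ) in
/-- The functions of the odd coordinates with constant coefficients. -/
def oddIncl (n : ℕ) : ExteriorAlgebra ℂ (Fin n → ℂ) →ₐ[ℂ] OddFun ℛ n :=
  GradedTensorProduct.includeLeft (extGrading (Fin n → ℂ)) ℛ

theorem oddCoord_eq (i : Fin n) :
    oddCoord ℛ i = oddIncl ℛ n (ExteriorAlgebra.ι ℂ (Pi.single i 1)) := rfl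

theorem oddIncl_mul_const (y : ExteriorAlgebra ℂ (Fin n → ℂ)) (r : R) :
    oddIncl ℛ n y * const ℛ n r =
      GradedTensorProduct.tmul ℂ (𝒜 := extGrading (Fin n → ℂ)) (ℬ := ℛ) y r :=
  GradedTensorProduct.tmul_one_mul_one_tmul _ _ y r

theorem oddFun_induction {p : OddFun ℛ n → Prop} (h : ∀ y r, p (oddIncl ℛ n y * const ℛ n r))
    (hadd : ∀ s t, p s → p t → p (s + t)) (t : OddFun ℛ n) : p t := by
  have key : ∀ u : ExteriorAlgebra ℂ (Fin n → ℂ) ⊗[ℂ] R,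
      p (GradedTensorProduct.of ℂ (extGrading (Fin n → ℂ)) ℛ u) := fun u => by
    induction u using TensorProduct.induction_on with
    | zero =>
      have := h 0 0
      rwa [map_zero, zero_mul] at this
    | tmul y r =>
      have := h y r
      rwa [oddIncl_mul_const] at this
    | add x y hx hy =>
      rw [map_add]
      exact hadd _ _ hx hy
  exact key ((GradedTensorProduct.of ℂ (extGrading (Fin n → ℂ)) ℛ).symm t)

theorem berezinR_oddIncl_mul_const (y : ExteriorAlgebra ℂ (Fin n → ℂ)) (r : R) :
    berezinR ℛ n (oddIncl ℛ n y * const ℛ n r) = berezin n y • r := by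
  rw [oddIncl_mul_const]
  rfl

theorem oddBody_oddIncl_mul_const (b : R →ₐ[ℂ] ℂ) (y : ExteriorAlgebra ℂ (Fin n → ℂ)) (r : R) :
    oddBody ℛ b n (oddIncl ℛ n y * const ℛ n r) = ExteriorAlgebra.algebraMapInv y * b r := by
  rw [oddIncl_mul_const]
  rfl

theorem const_mul_oddIncl_ι (j : ZMod 2) {r : R} (hr : r ∈ ℛ j) (v : Fin n → ℂ) :
    const ℛ n r * oddIncl ℛ n (ExteriorAlgebra.ι ℂ v) =
      (-1 : ℤˣ) ^ j • (oddIncl ℛ n (ExteriorAlgebra.ι ℂ v) * const ℛ n r) := by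
  rw [oddIncl_mul_const]
  have := GradedTensorProduct.tmul_coe_mul_coe_tmul (R := ℂ) (extGrading (Fin n → ℂ)) ℛ 1 ⟨r, hr⟩
    (⟨ExteriorAlgebra.ι ℂ v, CliffordAlgebra.ι_mem_evenOdd_one _ _⟩ :
      extGrading (Fin n → ℂ) 1) 1
  rw [mul_one, one_mul, mul_one] at this
  exact this

theorem const_mul_oddIncl_ι_of_even {r : R} (hr : r ∈ ℛ 0) (v : Fin n → ℂ) :
    const ℛ n r * oddIncl ℛ n (ExteriorAlgebra.ι ℂ v) =
      oddIncl ℛ n (ExteriorAlgebra.ι ℂ v) * const ℛ n r := by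
  rw [const_mul_oddIncl_ι 0 hr, uzpow_zero, one_smul]

theorem const_mul_oddIncl_ι_of_odd {r : R} (hr : r ∈ ℛ 1) (v : Fin n → ℂ) :
    const ℛ n r * oddIncl ℛ n (ExteriorAlgebra.ι ℂ v) =
      -(oddIncl ℛ n (ExteriorAlgebra.ι ℂ v) * const ℛ n r) := by
  rw [const_mul_oddIncl_ι 1 hr, uzpow_one, Units.neg_smul, one_smul]

/-- The vectors of the exterior algebra and the homogeneous constants generate the algebra, so
commuting with them suffices. -/
theorem mem_center_oddFun {t : OddFun ℛ n}
    (h : ∀ v, oddIncl ℛ n (ExteriorAlgebra.ι ℂ v) * t = t * oddIncl ℛ n (ExteriorAlgebra.ι ℂ v))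
    (h0 : ∀ r ∈ ℛ 0, const ℛ n r * t = t * const ℛ n r)
    (h1 : ∀ r ∈ ℛ 1, const ℛ n r * t = t * const ℛ n r) :
    t ∈ Subalgebra.center ℂ (OddFun ℛ n) := by
  have hy : ∀ y, Commute (oddIncl ℛ n y) t := fun y => by
    induction y using ExteriorAlgebra.induction with
    | algebraMap r =>
      rw [AlgHom.commutes]
      exact Algebra.commutes _ _
    | ι w => exact h w
    | mul a b ha hb =>
      rw [map_mul]
      exact ha.mul_left hb
    | add a b ha hb =>
      rw [map_add]
      exact ha.add_left hb
  have hr : ∀ r, Commute (const ℛ n r) t := fun r => by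
    have hhom : ∀ (i : ZMod 2) (r : R), r ∈ ℛ i → Commute (const ℛ n r) t := fun i => by
      fin_cases i
      · exact h0
      · exact h1
    refine DirectSum.Decomposition.inductionOn ℛ ?_ ?_ ?_ r
    · rw [map_zero]
      exact Commute.zero_left _
    · exact fun m => hhom _ m.1 m.2
    · intro m m' h h'
      rw [map_add]
      exact h.add_left h'
  rw [Subalgebra.mem_center_iff]
  intro s
  induction s using oddFun_induction with
  | h y r => exact ((hy y).mul_left (hr r)).eq
  | hadd s s' hs hs' => rw [add_mul, mul_add, hs, hs']

theorem oddIncl_ι_mul_swap (u v : Fin n → ℂ) :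
    oddIncl ℛ n (ExteriorAlgebra.ι ℂ u) * oddIncl ℛ n (ExteriorAlgebra.ι ℂ v) =
      -(oddIncl ℛ n (ExteriorAlgebra.ι ℂ v) * oddIncl ℛ n (ExteriorAlgebra.ι ℂ u)) := by
  rw [← map_mul (oddIncl ℛ n), ← map_mul (oddIncl ℛ n),
    eq_neg_of_add_eq_zero_left (ExteriorAlgebra.ι_add_mul_swap u v), map_neg]

variable [IsSupercommutative ℛ]

theorem const_mem_center {r : R} (hr : r ∈ ℛ 0) :
    const ℛ n r ∈ Subalgebra.center ℂ (OddFun ℛ n) :=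
  mem_center_oddFun (fun v => (const_mul_oddIncl_ι_of_even hr v).symm)
    (fun s _ => by rw [← map_mul, ← map_mul, IsSupercommutative.even_comm (ℛ := ℛ) r hr s])
    (fun s _ => by rw [← map_mul, ← map_mul, IsSupercommutative.even_comm (ℛ := ℛ) r hr s])

/-- A product of two odd elements is even. This places the linear coefficients of the moment in a
commutative ring, where the Gaussian integral formula applies. -/
theorem const_mul_oddIncl_ι_mem_center {r : R} (hr : r ∈ ℛ 1) (v : Fin n → ℂ) :
    const ℛ n r * oddIncl ℛ n (ExteriorAlgebra.ι ℂ v) ∈ Subalgebra.center ℂ (OddFun ℛ n) := by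
  refine mem_center_oddFun (fun w => ?_) (fun s hs => ?_) (fun s hs => ?_)
  · rw [mul_assoc, oddIncl_ι_mul_swap v w, mul_neg, ← mul_assoc, ← mul_assoc,
      const_mul_oddIncl_ι_of_odd hr w, neg_mul, neg_neg]
  · rw [← mul_assoc, ← map_mul, IsSupercommutative.even_comm (ℛ := ℛ) s hs r, map_mul, mul_assoc,
      const_mul_oddIncl_ι_of_even hs, mul_assoc]
  · rw [← mul_assoc, ← map_mul, IsSupercommutative.odd_anticomm (ℛ := ℛ) s hs r hr, map_neg,
      map_mul, neg_mul, mul_assoc, const_mul_oddIncl_ι_of_odd hs, mul_neg, neg_neg, mul_assoc]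

/-- Linearity over `R₀` takes the value of the even Gaussian integral out of the Berezin integral.
-/
theorem berezinR_const_mul {a : R} (ha : a ∈ ℛ 0) (t : OddFun ℛ n) :
    berezinR ℛ n (const ℛ n a * t) = a * berezinR ℛ n t := by
  induction t using oddFun_induction with
  | h y r =>
    have hc := Subalgebra.mem_center_iff.1 (const_mem_center (n := n) ha) (oddIncl ℛ n y)
    rw [← mul_assoc, ← hc, mul_assoc, ← map_mul, berezinR_oddIncl_mul_const,
      berezinR_oddIncl_mul_const, mul_smul_comm]
  | hadd s s' hs hs' => rw [mul_add, map_add, map_add, hs, hs', mul_add]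

theorem finiteDimensional_exteriorAlgebra (M : Type*) [AddCommGroup M] [Module ℂ M]
    [FiniteDimensional ℂ M] : FiniteDimensional ℂ (ExteriorAlgebra ℂ M) :=
  Module.Finite.of_basis (Module.finBasis ℂ M).ExteriorAlgebra

theorem finiteDimensional_oddFun {R : Type*} [Ring R] [Algebra ℂ R] (ℛ : ZMod 2 → Submodule ℂ R)
    [GradedAlgebra ℛ] [FiniteDimensional ℂ R] (n : ℕ) : FiniteDimensional ℂ (OddFun ℛ n) := by
  have := finiteDimensional_exteriorAlgebra (Fin n → ℂ)
  exact Module.Finite.equiv (GradedTensorProduct.of ℂ (extGrading (Fin n → ℂ)) ℛ)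

theorem berezin_eq_zero {l : ℕ} (hl : l ≠ n) {y : ExteriorAlgebra ℂ (Fin n → ℂ)}
    (hy : y ∈ ⋀[ℂ]^l (Fin n → ℂ)) : berezin n y = 0 := by
  rw [← ExteriorAlgebra.ιMulti_span_fixedDegree] at hy
  induction hy using Submodule.span_induction with
  | mem x hx =>
    obtain ⟨v, rfl⟩ := hx
    rw [berezin, ExteriorAlgebra.liftAlternating_apply_ιMulti, Pi.single_eq_of_ne hl]
    rfl
  | zero => rw [map_zero]
  | add x y _ _ hx hy => rw [map_add, hx, hy, add_zero]
  | smul c x _ hx => rw [map_smul, hx, smul_zero]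

theorem berezin_top :
    berezin n (ExteriorAlgebra.ιMulti ℂ n fun i => Pi.single i 1) =
      (-1 : ℂ) ^ (n * (n - 1) / 2) := by
  have h : (fun i : Fin n => (Pi.single i 1 : Fin n → ℂ)) = Pi.basisFun ℂ (Fin n) := by
    funext i
    rw [Pi.basisFun_apply]
  rw [berezin, ExteriorAlgebra.liftAlternating_apply_ιMulti, Pi.single_eq_same,
    AlternatingMap.smul_apply, h, Module.Basis.det_self, smul_eq_mul, mul_one]

variable (ℛ n) in
/-- The even constants, as elements of the center. -/
def constCenter : evenPart ℛ →ₐ[ℂ] Subalgebra.center ℂ (OddFun ℛ n) :=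
  ((const ℛ n).comp (evenPart ℛ).val).codRestrict _ fun a => const_mem_center a.2

theorem coe_constCenter (a : evenPart ℛ) : (constCenter ℛ n a : OddFun ℛ n) = const ℛ n a := rfl

variable (ℛ) in
/-- The quadratic function `∑ N i j ξⁱ ξʲ`. -/
def quadOdd (N : Matrix (Fin n) (Fin n) (evenPart ℛ)) : OddFun ℛ n :=
  ∑ i, ∑ j, const ℛ n (N i j) * (oddCoord ℛ i * oddCoord ℛ j)

end OddFun

end

end SuperPf

namespace SuperPf

noncomputable section

/-! ### The matrix of the bilinear form `B(v, X w)` -/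

section Contract

variable {W S : Type*} [AddCommGroup W] [Module ℝ W] [AddCommGroup S] [Module ℝ S]

theorem contract_tmul (φ : W →ₗ[ℝ] ℝ) (w : W) (s : S) : contract φ (w ⊗ₜ[ℝ] s) = φ w • s := by
  simp [contract]

/-- Contraction is linear in the linear form. -/
theorem contract_sum_smul {ι : Type*} (s : Finset ι) (c : ι → ℝ) (φ : ι → W →ₗ[ℝ] ℝ)
    {ψ : W →ₗ[ℝ] ℝ} (h : ∀ w, ψ w = ∑ i ∈ s, c i * φ i w) (t : W ⊗[ℝ] S) :
    contract ψ t = ∑ i ∈ s, c i • contract (φ i) t := by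
  induction t using TensorProduct.induction_on with
  | zero => simp
  | tmul w a =>
    simp_rw [contract_tmul, h, Finset.sum_smul, smul_smul]
  | add x y hx hy => simp_rw [map_add, hx, hy, smul_add, Finset.sum_add_distrib]

theorem contract_eq_neg {φ ψ : W →ₗ[ℝ] ℝ} (h : ∀ w, ψ w = -φ w) (t : W ⊗[ℝ] S) :
    contract ψ t = -contract φ t := by
  have := contract_sum_smul (S := S) {()} (fun _ => -1) (fun _ => φ) (ψ := ψ)
    (fun w => by simp [h]) t
  simpa using this

theorem contract_lTensor {S' : Type*} [AddCommGroup S'] [Module ℝ S'] (f : S →ₗ[ℝ] S')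
    (φ : W →ₗ[ℝ] ℝ) (t : W ⊗[ℝ] S) :
    contract φ (LinearMap.lTensor W f t) = f (contract φ t) := by
  induction t using TensorProduct.induction_on with
  | zero => simp
  | tmul w a => simp [contract_tmul]
  | add x y hx hy => simp_rw [map_add, hx, hy]

theorem apply_realPart (φ : W →ₗ[ℝ] ℝ) (t : W ⊗[ℝ] ℂ) : φ (realPart t) = (contract φ t).re := by
  induction t using TensorProduct.induction_on with
  | zero => simp
  | tmul w a => simp [contract_tmul, realPart, mul_comm]
  | add x y hx hy => simp_rw [map_add, hx, hy, Complex.add_re]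

end Contract

section Forms

variable {V₀ V₁ : Type*} [AddCommGroup V₀] [Module ℝ V₀] [AddCommGroup V₁] [Module ℝ V₁]
  {B : SymplecticForm V₀ V₁} {k n : ℕ} (β : SymplecticBasis B k n)

namespace SymplecticBasis

/-- The matrix of the symplectic form on `V₀`. -/
def gramEven : Matrix (Fin k × Fin 2) (Fin k × Fin 2) ℝ := fun i j => B.even (β.e i) (β.e j)

/-- The matrix of the symmetric form on `V₁`. -/
def gramOdd : Matrix (Fin n) (Fin n) ℝ := fun i j => B.odd (β.g i) (β.g j)

theorem det_gramEven : β.gramEven.det = 1 := by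
  have h : β.gramEven = Matrix.kroneckerMap (· * ·) (1 : Matrix (Fin k) (Fin k) ℝ) J₂ := by
    ext ⟨i, a⟩ ⟨j, b⟩
    rw [gramEven, β.even_eq, Matrix.kroneckerMap_apply, Matrix.one_apply, ite_mul, one_mul,
      zero_mul]
  rw [h, Matrix.det_kronecker]
  simp [J₂, Matrix.det_fin_two]

theorem prod_phase_sq_mul_det_gramOdd :
    (∏ i, β.phase i) ^ 2 * (β.gramOdd.det : ℂ) = 1 := by
  have h : Matrix.diagonal β.phase * β.gramOdd.map ((↑) : ℝ → ℂ) * Matrix.diagonal β.phase = 1 := by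
    ext i j
    rw [Matrix.mul_diagonal, Matrix.diagonal_mul, Matrix.map_apply, Matrix.one_apply, gramOdd,
      ← β.odd_eq i j]
    ring
  have h' := congrArg Matrix.det h
  have hm : (β.gramOdd.map ((↑) : ℝ → ℂ)).det = (β.gramOdd.det : ℂ) :=
    (Complex.ofRealHom.map_det β.gramOdd).symm
  rw [Matrix.det_mul, Matrix.det_mul, Matrix.det_diagonal, Matrix.det_one, hm] at h'
  rw [← h']
  ring

end SymplecticBasis

variable {R : Type*} [Ring R] [Algebra ℂ R] {ℛ : ZMod 2 → Submodule ℂ R} [GradedAlgebra ℛ]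

namespace SpoPoint

variable (X : SpoPoint B ℛ)

/-- The matrix of `B(v, X w)` for `v` and `w` in `V₀`. -/
def formEven : Matrix (Fin k × Fin 2) (Fin k × Fin 2) (evenPart ℛ) :=
  fun i j => contract (B.even (β.e i) ∘ₗ LinearMap.applyₗ (β.e j) ∘ₗ
      LinearMap.fst ℝ _ _ ∘ₗ (spoEven B).subtype) X.even

/-- The matrix of `B(v, X w)` for `v` and `w` in `V₁`. -/
def formOdd : Matrix (Fin n) (Fin n) (evenPart ℛ) :=
  fun i j => contract (B.odd (β.g i) ∘ₗ LinearMap.applyₗ (β.g j) ∘ₗ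
      LinearMap.snd ℝ _ _ ∘ₗ (spoEven B).subtype) X.even

/-- The matrix of `B(v, X w)` for `v` in `V₀` and `w` in `V₁`. -/
def formMixed : Matrix (Fin k × Fin 2) (Fin n) (ℛ 1) :=
  fun i j => contract (B.even (β.e i) ∘ₗ LinearMap.applyₗ (β.g j) ∘ₗ
      LinearMap.fst ℝ _ _ ∘ₗ (spoOdd B).subtype) X.odd

/-- Moving `X` to the other side of the form costs one sign and skew symmetry of the form on `V₀`
another. -/
theorem formEven_isSymm : (X.formEven β).IsSymm := by
  ext1 i j
  refine congrArg (fun φ => contract φ X.even) (LinearMap.ext fun G => ?_)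
  have h := G.2.1 (β.e i) (β.e j)
  have h' := LinearMap.BilinForm.IsAlt.neg_eq B.even_alt (G.1.1 (β.e i)) (β.e j)
  change B.even (β.e j) (G.1.1 (β.e i)) = B.even (β.e i) (G.1.1 (β.e j))
  linarith

theorem formOdd_transpose : (X.formOdd β).transpose = -X.formOdd β := by
  ext1 i j
  refine contract_eq_neg (fun G => ?_) _
  have h := G.2.2 (β.g i) (β.g j)
  have h' : B.odd (G.1.2 (β.g i)) (β.g j) = _ := B.odd_symm.eq (G.1.2 (β.g i)) (β.g j)
  change B.odd (β.g j) (G.1.2 (β.g i)) = -B.odd (β.g i) (G.1.2 (β.g j))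
  linarith

theorem formEven_apply (i j) :
    X.formEven β i j = ∑ l, β.gramEven i l • X.blockA β l j := by
  refine contract_sum_smul _ _ _ (fun G => ?_) _
  change B.even (β.e i) (G.1.1 (β.e j)) = _
  conv_lhs => rw [← β.e.sum_repr (G.1.1 (β.e j)), map_sum]
  refine Finset.sum_congr rfl fun l _ => ?_
  rw [map_smul, smul_eq_mul, mul_comm]
  rfl

theorem formOdd_apply (i j) :
    X.formOdd β i j = ∑ l, β.gramOdd i l • X.blockD β l j := by
  refine contract_sum_smul _ _ _ (fun G => ?_) _
  change B.odd (β.g i) (G.1.2 (β.g j)) = _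
  conv_lhs => rw [← β.g.sum_repr (G.1.2 (β.g j)), map_sum]
  refine Finset.sum_congr rfl fun l _ => ?_
  rw [map_smul, smul_eq_mul, mul_comm]
  rfl

theorem formMixed_apply (i j) :
    X.formMixed β i j = -∑ l, β.gramEven i l • X.blockB β l j := by
  have : X.formMixed β i j = ∑ l, β.gramEven i l • -X.blockB β l j := by
    simp_rw [blockB, neg_neg]
    refine contract_sum_smul _ _ _ (fun G => ?_) _
    change B.even (β.e i) (G.1.1 (β.g j)) = _
    conv_lhs => rw [← β.e.sum_repr (G.1.1 (β.g j)), map_sum]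
    refine Finset.sum_congr rfl fun l _ => ?_
    rw [map_smul, smul_eq_mul, mul_comm]
    rfl
  rw [this, ← Finset.sum_neg_distrib]
  exact Finset.sum_congr rfl fun l _ => Subtype.ext (smul_neg (β.gramEven i l) (X.blockB β l j : R))

theorem pairing_inr_inl (i j) :
    X.pairing β (.inr j) (.inl i) = -(X.formMixed β i j : R) := by
  rw [← Submodule.coe_neg]
  refine congrArg Subtype.val (contract_eq_neg (fun G => ?_) _)
  have h := G.2.2 (β.g j) (β.e i)
  have h' := LinearMap.BilinForm.IsAlt.neg_eq B.even_alt (G.1.1 (β.g j)) (β.e i)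
  change B.odd (β.g j) (G.1.2 (β.e i)) = -B.even (β.e i) (G.1.1 (β.g j))
  linarith

theorem sum_gramOdd_smul_blockC (i j) :
    ∑ l, β.gramOdd j l • X.blockC β l i = -X.formMixed β i j := by
  have h := X.pairing_inr_inl β i j
  rw [← Submodule.coe_neg] at h
  rw [← Subtype.ext h]
  refine (contract_sum_smul _ _ _ (fun G => ?_) _).symm
  change B.odd (β.g j) (G.1.2 (β.e i)) = _
  conv_lhs => rw [← β.g.sum_repr (G.1.2 (β.e i)), map_sum]
  refine Finset.sum_congr rfl fun l _ => ?_
  rw [map_smul, smul_eq_mul, mul_comm]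
  rfl

/-- The form `x ↦ Re (b (B(x, X x)))` is positive definite if the body of `X` lies in the tube. -/
theorem formEven_body_pos {b : R →ₐ[ℂ] ℂ} (hX : X.body b ∈ tube B) (x : Fin k × Fin 2 → ℝ)
    (hx : x ≠ 0) : 0 < ∑ i, ∑ j, (b (X.formEven β i j : R)).re * x i * x j := by
  set G := realPart (X.body b) with hG
  have hre (i j) : (b (X.formEven β i j : R)).re = B.even (β.e i) (G.1.1 (β.e j)) := by
    have := apply_realPart (B.even (β.e i) ∘ₗ LinearMap.applyₗ (β.e j) ∘ₗ
      LinearMap.fst ℝ _ _ ∘ₗ (spoEven B).subtype) (X.body b)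
    rw [SpoPoint.body, contract_lTensor] at this
    exact this.symm
  have hv : ∑ i, x i • β.e i ≠ 0 := fun h => hx <| funext fun i =>
    Fintype.linearIndependent_iff.1 β.e.linearIndependent x h i
  have hpos : 0 < B.even (∑ i, x i • β.e i) (G.1.1 (∑ i, x i • β.e i)) := hX _ hv
  convert hpos using 1
  simp_rw [map_sum, LinearMap.sum_apply, map_smul, LinearMap.smul_apply, hre, smul_eq_mul]
  rw [Finset.sum_comm]
  refine Finset.sum_congr rfl fun i _ => Finset.sum_congr rfl fun j _ => by ring

end SpoPoint

end Forms

end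

end SuperPf

namespace SuperPf

noncomputable section

/-! ### Completing the square in the odd variables -/

section Reduced

variable {V₀ V₁ : Type*} [AddCommGroup V₀] [Module ℝ V₀] [AddCommGroup V₁] [Module ℝ V₁]
  {B : SymplecticForm V₀ V₁} {k n : ℕ} (β : SymplecticBasis B k n)
  {R : Type*} [Ring R] [Algebra ℂ R] {ℛ : ZMod 2 → Submodule ℂ R} [GradedAlgebra ℛ]

namespace SpoPoint

variable (X : SpoPoint B ℛ)

theorem formEven_eq_mul :
    X.formEven β = β.gramEven.map (algebraMap ℝ (evenPart ℛ)) * X.blockA β := by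
  ext1 i j
  rw [formEven_apply, Matrix.mul_apply]
  exact Finset.sum_congr rfl fun l _ => by rw [Matrix.map_apply, Algebra.smul_def]

variable [IsSupercommutative ℛ]

theorem det_map_gramEven : (β.gramEven.map (algebraMap ℝ (evenPart ℛ))).det = 1 := by
  have := (algebraMap ℝ (evenPart ℛ)).map_det β.gramEven
  rw [β.det_gramEven, map_one] at this
  exact this.symm

theorem det_formEven : (X.formEven β).det = (X.blockA β).det := by
  rw [formEven_eq_mul, Matrix.det_mul, det_map_gramEven, one_mul]

theorem formEven_inv_mul :
    (X.formEven β)⁻¹ * β.gramEven.map (algebraMap ℝ (evenPart ℛ)) = (X.blockA β)⁻¹ := by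
  rw [formEven_eq_mul, Matrix.mul_inv_rev, Matrix.mul_assoc, Matrix.nonsing_inv_mul, Matrix.mul_one]
  rw [det_map_gramEven]
  exact isUnit_one

theorem formEven_inv_isSymm : ((X.formEven β)⁻¹).IsSymm := by
  rw [Matrix.IsSymm, Matrix.transpose_nonsing_inv, X.formEven_isSymm β]

/-- The Gram matrix cancels between `formEven⁻¹` and `formMixed`; the sign is the one in the
definition of `blockB`. -/
theorem sum_formEven_inv_mul_formMixed (p j) :
    ∑ q, ((X.formEven β)⁻¹ p q : R) * (X.formMixed β q j : R) =
      -∑ q, ((X.blockA β)⁻¹ p q : R) * (X.blockB β q j : R) := by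
  have h (q) : ((X.blockA β)⁻¹ p q : R) =
      ∑ l, β.gramEven l q • ((X.formEven β)⁻¹ p l : R) := by
    rw [← formEven_inv_mul, Matrix.mul_apply, AddSubmonoidClass.coe_finsetSum]
    refine Finset.sum_congr rfl fun l _ => ?_
    rw [Matrix.map_apply, mul_comm, ← Algebra.smul_def]
    rfl
  have h' (q) : (X.formMixed β q j : R) = -∑ l, β.gramEven q l • (X.blockB β l j : R) := by
    rw [formMixed_apply, Submodule.coe_neg, AddSubmonoidClass.coe_finsetSum]
    rfl
  simp_rw [h, h', mul_neg, Finset.sum_neg_distrib, Finset.mul_sum, Finset.sum_mul]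
  rw [Finset.sum_comm]
  simp_rw [mul_smul_comm, smul_mul_assoc]

/-- The matrix of the form on the odd variables which is left when the square in the even
variables is completed. -/
def formReduced : Matrix (Fin n) (Fin n) (evenPart ℛ) :=
  fun i j => X.formOdd β i j - ∑ l, ∑ l', oddEvenOdd (X.formMixed β l i)
    ((X.formEven β)⁻¹ l l') (X.formMixed β l' j)

/-- In the correction term the inverse matrix is symmetric and its entries are central, while
exchanging the two odd entries changes the sign. -/
theorem formReduced_transpose : (X.formReduced β).transpose = -X.formReduced β := by
  ext1 i j
  have h : X.formOdd β j i = -X.formOdd β i j := congrFun₂ (X.formOdd_transpose β) i j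
  rw [Matrix.transpose_apply, Matrix.neg_apply, formReduced, formReduced, h, neg_sub,
    sub_eq_add_neg, sub_eq_add_neg, add_comm, Finset.sum_comm, ← Finset.sum_neg_distrib]
  congr 1
  refine Finset.sum_congr rfl fun l _ => ?_
  rw [← Finset.sum_neg_distrib]
  refine Finset.sum_congr rfl fun l' _ => Subtype.ext ?_
  have hs : (X.formEven β)⁻¹ l' l = (X.formEven β)⁻¹ l l' := (X.formEven_inv_isSymm β).apply _ _
  change -((X.formMixed β l' j : R) * ((X.formEven β)⁻¹ l' l : R) * (X.formMixed β l i : R)) =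
    (X.formMixed β l i : R) * ((X.formEven β)⁻¹ l l' : R) * (X.formMixed β l' j : R)
  have hc := IsSupercommutative.even_comm (ℛ := ℛ) _ ((X.formEven β)⁻¹ l l').2
  rw [hs, ← hc, mul_assoc, IsSupercommutative.odd_anticomm (ℛ := ℛ) _ (X.formMixed β l' j).2 _
    (X.formMixed β l i).2, mul_neg, neg_neg, ← mul_assoc, hc]

/-- This connects the completed square to the Berezinian: the reduced form is the bilinear form on
`V₁` applied to the Schur complement. -/
theorem formReduced_apply (i j) :
    X.formReduced β i j = ∑ l, β.gramOdd i l • X.schur β l j := by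
  have hC (p) : -(X.formMixed β p i : R) = ∑ l, β.gramOdd i l • (X.blockC β l p : R) := by
    rw [← Submodule.coe_neg, ← sum_gramOdd_smul_blockC, AddSubmonoidClass.coe_finsetSum]
    rfl
  rw [formReduced, formOdd_apply]
  simp_rw [schur, smul_sub, Finset.sum_sub_distrib]
  congr 1
  refine Subtype.ext ?_
  simp_rw [Finset.smul_sum]
  push_cast
  change ∑ l, ∑ l', (X.formMixed β l i : R) * ((X.formEven β)⁻¹ l l' : R) *
      (X.formMixed β l' j : R) = ∑ m, ∑ l, ∑ l', β.gramOdd i m • ((X.blockC β m l : R) *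
        ((X.blockA β)⁻¹ l l' : R) * (X.blockB β l' j : R))
  conv_rhs => rw [Finset.sum_comm]
  refine Finset.sum_congr rfl fun l _ => ?_
  simp_rw [mul_assoc, ← Finset.mul_sum, ← Finset.smul_sum, ← Finset.mul_sum]
  rw [sum_formEven_inv_mul_formMixed, mul_neg, ← neg_mul, hC, Finset.sum_mul]
  exact Finset.sum_congr rfl fun m _ => smul_mul_assoc _ _ _

theorem det_formReduced :
    (X.formReduced β).det = algebraMap ℝ (evenPart ℛ) β.gramOdd.det * (X.schur β).det := by
  have h : X.formReduced β = β.gramOdd.map (algebraMap ℝ (evenPart ℛ)) * X.schur β := by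
    ext1 i j
    rw [formReduced_apply, Matrix.mul_apply]
    exact Finset.sum_congr rfl fun l _ => by rw [Matrix.map_apply, Algebra.smul_def]
  rw [h, Matrix.det_mul]
  congr 1
  exact ((algebraMap ℝ (evenPart ℛ)).map_det β.gramOdd).symm

/-- The matrix `formReduced` in the coordinates `ξ`. -/
def pfaffMatrix : Matrix (Fin n) (Fin n) (evenPart ℛ) :=
  fun i j => (β.phase i * β.phase j) • X.formReduced β i j

theorem pfaffMatrix_transpose : (X.pfaffMatrix β).transpose = -X.pfaffMatrix β := by
  ext1 i j
  have h : X.formReduced β j i = -X.formReduced β i j := congrFun₂ (X.formReduced_transpose β) i j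
  rw [Matrix.transpose_apply, Matrix.neg_apply, pfaffMatrix, h, smul_neg, mul_comm]
  rfl

/-- The phases turn `g` into an orthonormal basis, so their squared product cancels the determinant
of the Gram matrix. -/
theorem det_pfaffMatrix : (X.pfaffMatrix β).det = (X.schur β).det := by
  set φ := fun i => algebraMap ℂ (evenPart ℛ) (β.phase i)
  have h : X.pfaffMatrix β = Matrix.diagonal φ * X.formReduced β * Matrix.diagonal φ := by
    ext1 i j
    rw [Matrix.mul_diagonal, Matrix.diagonal_mul, pfaffMatrix, Algebra.smul_def, map_mul]
    ring
  have h1 := congrArg (algebraMap ℂ (evenPart ℛ)) β.prod_phase_sq_mul_det_gramOdd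
  rw [map_mul, map_pow, map_prod, map_one] at h1
  rw [h, Matrix.det_mul, Matrix.det_mul, Matrix.det_diagonal, det_formReduced,
    IsScalarTower.algebraMap_apply ℝ ℂ (evenPart ℛ)]
  linear_combination (X.schur β).det * h1

end SpoPoint

end Reduced

end

end SuperPf

namespace SuperPf

noncomputable section

/-! ### The moment map as a Gaussian exponent -/

section CompleteSquare

theorem sum_comm_four {ι κ M : Type*} [Fintype ι] [Fintype κ] [AddCommMonoid M]
    (f : ι → ι → κ → κ → M) :
    ∑ l, ∑ l', ∑ i, ∑ j, f l l' i j = ∑ i, ∑ j, ∑ l, ∑ l', f l l' i j := by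
  have h1 : ∀ l, ∑ l', ∑ i, ∑ j, f l l' i j = ∑ i, ∑ j, ∑ l', f l l' i j := fun l => by
    rw [Finset.sum_comm]
    exact Finset.sum_congr rfl fun i _ => Finset.sum_comm
  simp_rw [h1]
  rw [Finset.sum_comm]
  exact Finset.sum_congr rfl fun i _ => Finset.sum_comm

variable {ι Q : Type*} [Fintype ι] [CommRing Q]

theorem quad_eq_dotProduct (S : Matrix ι ι Q) (y : ι → Q) :
    quad S y = dotProduct y (S.mulVec y) := by
  simp_rw [quad, dotProduct, Matrix.mulVec, dotProduct, Finset.mul_sum]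
  exact Finset.sum_congr rfl fun i _ => Finset.sum_congr rfl fun j _ => by ring

theorem quad_sub_inv_mulVec [DecidableEq ι] {S : Matrix ι ι Q} (hS : S.IsSymm) (hdet : IsUnit S.det)
    (y u : ι → Q) :
    quad S (y - S⁻¹.mulVec u) = quad S y - 2 * dotProduct y u + quad S⁻¹ u := by
  have h : S.mulVec (S⁻¹.mulVec u) = u := by
    rw [Matrix.mulVec_mulVec, Matrix.mul_nonsing_inv _ hdet, Matrix.one_mulVec]
  have h' : dotProduct (S⁻¹.mulVec u) (S.mulVec y) = dotProduct y u := by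
    rw [Matrix.dotProduct_mulVec, ← Matrix.mulVec_transpose, hS, h, dotProduct_comm]
  simp_rw [quad_eq_dotProduct, Matrix.mulVec_sub, dotProduct_sub, sub_dotProduct, h, h']
  rw [dotProduct_comm u]
  ring

end CompleteSquare

section Moment

variable {V₀ V₁ : Type*} [AddCommGroup V₀] [Module ℝ V₀] [AddCommGroup V₁] [Module ℝ V₁]
  {B : SymplecticForm V₀ V₁} {k n : ℕ} (β : SymplecticBasis B k n)
  {R : Type*} [Ring R] [Algebra ℂ R] {ℛ : ZMod 2 → Submodule ℂ R} [GradedAlgebra ℛ]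

/-- The coordinate dual to `g j` is `ξ` of the following vector. -/
def phaseVec (j : Fin n) : Fin n → ℂ := β.phase j • Pi.single j 1

theorem coordFun_inr (x : Fin k × Fin 2 → ℝ) (j : Fin n) :
    coordFun β ℛ x (.inr j) = oddIncl ℛ n (ExteriorAlgebra.ι ℂ (phaseVec β j)) := by
  rw [coordFun, oddCoord_eq, phaseVec, map_smul, map_smul]

theorem oddIncl_phaseVec (j : Fin n) :
    oddIncl ℛ n (ExteriorAlgebra.ι ℂ (phaseVec β j)) = β.phase j • oddCoord ℛ j := by
  rw [oddCoord_eq, phaseVec, map_smul, map_smul]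

namespace SpoPoint

variable (X : SpoPoint B ℛ)

/-- Both kinds of mixed terms give the same contribution `-x b ξ`, which doubles and cancels the
`-½`. In the odd block, reordering the two `ξ` turns `-½` into `½`. -/
theorem moment_eq (x : Fin k × Fin 2 → ℝ) :
    X.moment β x =
      (-(1 / 2) : ℂ) • ∑ i, ∑ j, (x i * x j : ℂ) • const ℛ n (X.formEven β i j) +
      ∑ i, (x i : ℂ) • ∑ j, const ℛ n (X.formMixed β i j) *
        oddIncl ℛ n (ExteriorAlgebra.ι ℂ (phaseVec β j)) +
      (1 / 2 : ℂ) • ∑ i, ∑ j, const ℛ n (X.formOdd β i j) *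
        (oddIncl ℛ n (ExteriorAlgebra.ι ℂ (phaseVec β i)) *
          oddIncl ℛ n (ExteriorAlgebra.ι ℂ (phaseVec β j))) := by
  have hee (i j) : coordFun β ℛ x (.inl j) * const ℛ n (X.pairing β (.inl i) (.inl j)) *
      coordFun β ℛ x (.inl i) = (x i * x j : ℂ) • const ℛ n (X.formEven β i j) := by
    rw [coordFun, coordFun, ← Algebra.commutes, ← Algebra.smul_def, ← Algebra.smul_def, smul_smul]
    rfl
  have heo (i j) : coordFun β ℛ x (.inr j) * const ℛ n (X.pairing β (.inl i) (.inr j)) *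
      coordFun β ℛ x (.inl i) = -((x i : ℂ) • (const ℛ n (X.formMixed β i j) *
        oddIncl ℛ n (ExteriorAlgebra.ι ℂ (phaseVec β j)))) := by
    rw [coordFun_inr, coordFun, ← Algebra.commutes, ← Algebra.smul_def,
      const_mul_oddIncl_ι_of_odd (X.formMixed β i j).2, smul_neg, neg_neg]
    rfl
  have hoe (i j) : coordFun β ℛ x (.inl j) * const ℛ n (X.pairing β (.inr i) (.inl j)) *
      coordFun β ℛ x (.inr i) = -((x j : ℂ) • (const ℛ n (X.formMixed β j i) *
        oddIncl ℛ n (ExteriorAlgebra.ι ℂ (phaseVec β i)))) := by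
    rw [coordFun_inr, coordFun, pairing_inr_inl, mul_assoc, ← Algebra.smul_def, map_neg, neg_mul,
      smul_neg]
  have hoo (i j) : coordFun β ℛ x (.inr j) * const ℛ n (X.pairing β (.inr i) (.inr j)) *
      coordFun β ℛ x (.inr i) = -(const ℛ n (X.formOdd β i j) *
        (oddIncl ℛ n (ExteriorAlgebra.ι ℂ (phaseVec β i)) *
          oddIncl ℛ n (ExteriorAlgebra.ι ℂ (phaseVec β j)))) := by
    rw [coordFun_inr, coordFun_inr, oddIncl_ι_mul_swap, mul_neg, neg_neg, ← mul_assoc,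
      const_mul_oddIncl_ι_of_even (X.formOdd β i j).2]
    rfl
  rw [moment]
  simp_rw [Fintype.sum_sum_type, hee, heo, hoe, hoo, Finset.sum_add_distrib,
    Finset.sum_neg_distrib]
  rw [Finset.sum_comm (f := fun (i : Fin n) (j : Fin k × Fin 2) =>
    (x j : ℂ) • (const ℛ n (X.formMixed β j i : R) *
        oddIncl ℛ n (ExteriorAlgebra.ι ℂ (phaseVec β i))))]
  simp_rw [Finset.smul_sum]
  simp_rw [← Finset.smul_sum]
  module

theorem oddBody_moment (b : R →ₐ[ℂ] ℂ) (x : Fin k × Fin 2 → ℝ) :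
    oddBody ℛ b n (X.moment β x) =
      gaussExponent (Matrix.of fun i j => b (X.formEven β i j)) 0 x := by
  have h1 (r : R) : oddBody ℛ b n (const ℛ n r) = b r := by
    have := oddBody_oddIncl_mul_const (ℛ := ℛ) (n := n) b 1 r
    rwa [map_one, one_mul, map_one, one_mul] at this
  have h2 (i j) : oddBody ℛ b n (const ℛ n (X.formMixed β i j) *
      oddIncl ℛ n (ExteriorAlgebra.ι ℂ (phaseVec β j))) = 0 := by
    rw [const_mul_oddIncl_ι_of_odd (X.formMixed β i j).2, map_neg, oddBody_oddIncl_mul_const]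
    simp [ExteriorAlgebra.algebraMapInv]
  have h3 (i j) : oddBody ℛ b n (const ℛ n (X.formOdd β i j) *
      (oddIncl ℛ n (ExteriorAlgebra.ι ℂ (phaseVec β i)) *
          oddIncl ℛ n (ExteriorAlgebra.ι ℂ (phaseVec β j)))) = 0 := by
    rw [← mul_assoc, const_mul_oddIncl_ι_of_even (X.formOdd β i j).2, mul_assoc,
      const_mul_oddIncl_ι_of_even (X.formOdd β i j).2, ← mul_assoc, ← map_mul,
      oddBody_oddIncl_mul_const]
    simp [ExteriorAlgebra.algebraMapInv]
  rw [moment_eq]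
  simp only [map_add, map_smul, map_sum, h1, h2, h3, Finset.sum_const_zero, mul_zero, add_zero,
    smul_eq_mul, gaussExponent, quad, shifted, Pi.zero_apply, sub_zero,
    Algebra.algebraMap_self, RingHom.id_apply, Matrix.of_apply]
  congr 1
  exact Finset.sum_congr rfl fun i _ => Finset.sum_congr rfl fun j _ => by ring

variable [IsSupercommutative ℛ]

/-- The coefficient of `xⁱ` in the moment map. -/
def momentLinear (i : Fin k × Fin 2) : Subalgebra.center ℂ (OddFun ℛ n) :=
  ∑ j, ⟨const ℛ n (X.formMixed β i j) * oddIncl ℛ n (ExteriorAlgebra.ι ℂ (phaseVec β j)),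
    const_mul_oddIncl_ι_mem_center (X.formMixed β i j).2 _⟩

theorem coe_momentLinear (i : Fin k × Fin 2) : (X.momentLinear β i : OddFun ℛ n) =
    ∑ j, const ℛ n (X.formMixed β i j) * oddIncl ℛ n (ExteriorAlgebra.ι ℂ (phaseVec β j)) := by
  rw [momentLinear, AddSubmonoidClass.coe_finsetSum]

/-- Each summand has square zero because it contains a vector of the exterior algebra, and the
summands commute. -/
theorem isNilpotent_momentLinear (i : Fin k × Fin 2) : IsNilpotent (X.momentLinear β i) := by
  refine Commute.isNilpotent_sum (fun j _ => ⟨2, Subtype.ext ?_⟩) fun _ _ _ _ => Commute.all _ _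
  change (_ * _) ^ 2 = (0 : OddFun ℛ n)
  rw [pow_two, mul_assoc, ← mul_assoc (oddIncl ℛ n _),
    ← neg_eq_iff_eq_neg.2 (const_mul_oddIncl_ι_of_odd (X.formMixed β i j).2 _), neg_mul, mul_assoc,
    ← map_mul (oddIncl ℛ n), ExteriorAlgebra.ι_sq_zero, map_zero, mul_zero, neg_zero, mul_zero]

/-- The nilpotent shift which completes the square in the moment map. -/
def momentShift : Fin k × Fin 2 → Subalgebra.center ℂ (OddFun ℛ n) :=
  (((X.formEven β).map (constCenter ℛ n))⁻¹).mulVec (X.momentLinear β)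

theorem isNilpotent_momentShift (i : Fin k × Fin 2) : IsNilpotent (X.momentShift β i) :=
  mem_nilradical.1 <| Ideal.sum_mem _ fun j _ =>
    Ideal.mul_mem_left _ _ (mem_nilradical.2 (X.isNilpotent_momentLinear β j))

theorem quadOdd_pfaffMatrix : quadOdd ℛ (X.pfaffMatrix β) =
    ∑ i, ∑ j, const ℛ n (X.formReduced β i j) *
        (oddIncl ℛ n (ExteriorAlgebra.ι ℂ (phaseVec β i)) *
          oddIncl ℛ n (ExteriorAlgebra.ι ℂ (phaseVec β j))) := by
  refine Finset.sum_congr rfl fun i _ => Finset.sum_congr rfl fun j _ => ?_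
  rw [oddIncl_phaseVec, oddIncl_phaseVec, smul_mul_smul_comm, mul_smul_comm, ← smul_mul_assoc,
    ← map_smul]
  rfl

/-- The sign arises when the first `ξ` passes the second odd coefficient. It makes the constant left
by the completed square the correction term of `formReduced`. -/
theorem coe_quad_momentLinear (P : Matrix (Fin k × Fin 2) (Fin k × Fin 2) (evenPart ℛ)) :
    ((quad (P.map (constCenter ℛ n)) (X.momentLinear β) : Subalgebra.center ℂ (OddFun ℛ n)) :
      OddFun ℛ n) =
      -∑ i, ∑ j, const ℛ n (∑ l, ∑ l', oddEvenOdd (X.formMixed β l i) (P l l')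
          (X.formMixed β l' j) : evenPart ℛ) *
        (oddIncl ℛ n (ExteriorAlgebra.ι ℂ (phaseVec β i)) *
          oddIncl ℛ n (ExteriorAlgebra.ι ℂ (phaseVec β j))) := by
  have h (l l' i j) : const ℛ n (P l l') * (const ℛ n (X.formMixed β l i) *
        oddIncl ℛ n (ExteriorAlgebra.ι ℂ (phaseVec β i))) *
      (const ℛ n (X.formMixed β l' j) * oddIncl ℛ n (ExteriorAlgebra.ι ℂ (phaseVec β j))) =
      -(const ℛ n (oddEvenOdd (X.formMixed β l i) (P l l') (X.formMixed β l' j) : evenPart ℛ) *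
        (oddIncl ℛ n (ExteriorAlgebra.ι ℂ (phaseVec β i)) *
          oddIncl ℛ n (ExteriorAlgebra.ι ℂ (phaseVec β j)))) := by
    change _ = -(const ℛ n ((X.formMixed β l i : R) * (P l l' : R) * (X.formMixed β l' j : R)) * _)
    rw [← IsSupercommutative.even_comm (ℛ := ℛ) _ (P l l').2, map_mul, map_mul]
    simp only [mul_assoc]
    rw [← mul_assoc (oddIncl ℛ n _) (const ℛ n _),
      ← neg_eq_iff_eq_neg.2 (const_mul_oddIncl_ι_of_odd (X.formMixed β l' j).2 _), neg_mul,
      mul_neg, mul_neg, mul_assoc]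
  have h' (l l') : const ℛ n (P l l') *
        (∑ i, const ℛ n (X.formMixed β l i) *
          oddIncl ℛ n (ExteriorAlgebra.ι ℂ (phaseVec β i))) *
        (∑ j, const ℛ n (X.formMixed β l' j) *
          oddIncl ℛ n (ExteriorAlgebra.ι ℂ (phaseVec β j))) =
      -∑ i, ∑ j, (const ℛ n (oddEvenOdd (X.formMixed β l i) (P l l') (X.formMixed β l' j)
          : evenPart ℛ) *
        (oddIncl ℛ n (ExteriorAlgebra.ι ℂ (phaseVec β i)) *
          oddIncl ℛ n (ExteriorAlgebra.ι ℂ (phaseVec β j)))) := by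
    rw [Finset.mul_sum (Finset.univ) (fun i => const ℛ n (X.formMixed β l i) * _),
      Finset.sum_mul_sum, ← Finset.sum_neg_distrib]
    refine Finset.sum_congr rfl fun i _ => ?_
    rw [← Finset.sum_neg_distrib]
    exact Finset.sum_congr rfl fun j _ => h l l' i j
  unfold quad
  push_cast
  simp_rw [Matrix.map_apply, coe_constCenter, coe_momentLinear, h', Finset.sum_neg_distrib,
    map_sum, Finset.sum_mul]
  rw [sum_comm_four]

theorem moment_eq_gaussExponent (hdet : IsUnit (X.formEven β).det) (x : Fin k × Fin 2 → ℝ) :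
    X.moment β x =
      ((gaussExponent ((X.formEven β).map (constCenter ℛ n)) (X.momentShift β) x :
        Subalgebra.center ℂ (OddFun ℛ n)) : OddFun ℛ n) +
      (1 / 2 : ℂ) • quadOdd ℛ (X.pfaffMatrix β) := by
  set S := X.formEven β with hS
  have hinv : (S.map (constCenter ℛ n))⁻¹ = S⁻¹.map (constCenter ℛ n) := by
    refine Matrix.inv_eq_right_inv ?_
    rw [← Matrix.map_mul, Matrix.mul_nonsing_inv _ hdet]
    exact Matrix.map_one _ (map_zero _) (map_one _)
  have hsymm : (S.map (constCenter ℛ n)).IsSymm := (X.formEven_isSymm β).map _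
  have hdet' : IsUnit (S.map (constCenter ℛ n)).det := by
    have := hdet.map (constCenter ℛ n)
    rwa [AlgHom.map_det] at this
  have key : gaussExponent (S.map (constCenter ℛ n)) (X.momentShift β) x = (-(1 / 2) : ℂ) •
      (quad (S.map (constCenter ℛ n)) (fun i => algebraMap ℂ _ (x i)) -
        2 * dotProduct (fun i => algebraMap ℂ _ (x i)) (X.momentLinear β) +
        quad (S⁻¹.map (constCenter ℛ n)) (X.momentLinear β)) := by
    have h := quad_sub_inv_mulVec hsymm hdet' (fun i => algebraMap ℂ _ (x i : ℂ))
      (X.momentLinear β)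
    rw [← hinv]
    exact congrArg (fun t => (-(1 / 2) : ℂ) • t) h
  have hq : ((quad (S.map (constCenter ℛ n)) (fun i => algebraMap ℂ _ (x i)) :
      Subalgebra.center ℂ (OddFun ℛ n)) : OddFun ℛ n) =
      ∑ i, ∑ j, (x i * x j : ℂ) • const ℛ n (S i j) := by
    unfold quad
    push_cast
    refine Finset.sum_congr rfl fun i _ => Finset.sum_congr rfl fun j _ => ?_
    rw [Matrix.map_apply, coe_constCenter, mul_assoc]
    change _ * (algebraMap ℂ _ (x i : ℂ) * algebraMap ℂ _ (x j : ℂ)) = _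
    rw [← map_mul, ← Algebra.commutes, ← Algebra.smul_def]
  have hl : ((dotProduct (fun i => algebraMap ℂ _ (x i)) (X.momentLinear β) :
      Subalgebra.center ℂ (OddFun ℛ n)) : OddFun ℛ n) =
      ∑ i, (x i : ℂ) • ∑ j, const ℛ n (X.formMixed β i j) *
        oddIncl ℛ n (ExteriorAlgebra.ι ℂ (phaseVec β j)) := by
    unfold dotProduct
    push_cast
    refine Finset.sum_congr rfl fun i _ => ?_
    rw [coe_momentLinear, Algebra.smul_def]
  rw [key, two_mul, moment_eq, quadOdd_pfaffMatrix]
  push_cast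
  rw [hq, hl, coe_quad_momentLinear]
  have hr (i j) : const ℛ n (X.formReduced β i j) = const ℛ n (X.formOdd β i j) -
      const ℛ n (∑ l, ∑ l', oddEvenOdd (X.formMixed β l i) (S⁻¹ l l')
        (X.formMixed β l' j) : evenPart ℛ) :=
    map_sub (const ℛ n) (X.formOdd β i j : R) _
  simp_rw [hr, sub_mul, Finset.sum_sub_distrib]
  module

end SpoPoint

end Moment

end

end SuperPf

namespace SuperPf

noncomputable section

/-! ### The Berezin integral of an odd Gaussian -/

section BerezinGaussian

variable {R : Type*} [Ring R] [Algebra ℂ R] {ℛ : ZMod 2 → Submodule ℂ R} [GradedAlgebra ℛ] {n : ℕ}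
  [IsSupercommutative ℛ]

variable (ℛ n) in
-- The Pfaffian identity lives in an exterior algebra over a commutative ring. Taking `R₀` as that
-- ring and mapping generators to the `ξⁱ` transports it to `OddFun`.
theorem exists_exteriorAlgebra_hom :
    ∃ f : ExteriorAlgebra (evenPart ℛ) (Fin n → evenPart ℛ) →+* OddFun ℛ n,
      (∀ a : evenPart ℛ, f (algebraMap (evenPart ℛ) _ a) = const ℛ n (a : R)) ∧
        ∀ i, f (ExteriorAlgebra.ι (evenPart ℛ) (Pi.basisFun (evenPart ℛ) (Fin n) i)) =
          oddCoord ℛ i := by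
  let : Algebra (evenPart ℛ) (OddFun ℛ n) :=
    RingHom.toAlgebra' ((const ℛ n).comp (evenPart ℛ).val : evenPart ℛ →+* OddFun ℛ n)
      fun a t => (Subalgebra.mem_center_iff.1 (const_mem_center (n := n) a.2) t).symm
  have hsmul (a : evenPart ℛ) (t : OddFun ℛ n) : a • t = const ℛ n (a : R) * t := rfl
  let l : (Fin n → evenPart ℛ) →ₗ[evenPart ℛ] OddFun ℛ n :=
    (Pi.basisFun (evenPart ℛ) (Fin n)).constr (evenPart ℛ) (oddCoord ℛ)
  have hl (v) : l v * l v = 0 := by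
    have h : l v * l v = -(l v * l v) := by
      conv_rhs => rw [Module.Basis.constr_apply_fintype, Finset.sum_mul_sum, Finset.sum_comm]
      conv_lhs => rw [Module.Basis.constr_apply_fintype, Finset.sum_mul_sum]
      rw [← Finset.sum_neg_distrib]
      refine Finset.sum_congr rfl fun i _ => ?_
      rw [← Finset.sum_neg_distrib]
      refine Finset.sum_congr rfl fun j _ => ?_
      rw [smul_mul_smul_comm, smul_mul_smul_comm, mul_comm, oddCoord_eq, oddCoord_eq,
        oddIncl_ι_mul_swap, smul_neg]
    -- Anticommutation gives only `t = -t`; dividing by `2` yields `t = 0`.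
    have h2 : (2 : ℂ) • (l v * l v) = 0 := by
      rw [two_smul]
      exact eq_neg_iff_add_eq_zero.1 h
    simpa using h2
  refine ⟨(ExteriorAlgebra.lift (evenPart ℛ) ⟨l, hl⟩ :
    ExteriorAlgebra (evenPart ℛ) (Fin n → evenPart ℛ) →+* OddFun ℛ n), fun a => ?_, fun i => ?_⟩
  · exact AlgHom.commutes _ a
  · exact (ExteriorAlgebra.lift_ι_apply _ _ _ _).trans (Module.Basis.constr_basis _ _ _ _)

theorem oddCoord_mul_oddCoord_mul_mem_span {l : ℕ} {t : OddFun ℛ n}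
    (ht : t ∈ Submodule.span ℂ
      {t | ∃ y ∈ ⋀[ℂ]^l (Fin n → ℂ), ∃ r, t = oddIncl ℛ n y * const ℛ n r})
    (a : evenPart ℛ) (i j : Fin n) :
    const ℛ n a * (oddCoord ℛ i * oddCoord ℛ j) * t ∈ Submodule.span ℂ
      {t | ∃ y ∈ ⋀[ℂ]^(l + 2) (Fin n → ℂ), ∃ r, t = oddIncl ℛ n y * const ℛ n r} := by
  induction ht using Submodule.span_induction with
  | mem t ht =>
    obtain ⟨y, hy, r, rfl⟩ := ht
    refine Submodule.subset_span ⟨ExteriorAlgebra.ι ℂ (Pi.single i 1) *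
      ExteriorAlgebra.ι ℂ (Pi.single j 1) * y, ?_, a * r, ?_⟩
    · rw [add_comm]
      refine SetLike.mul_mem_graded (A := fun k : ℕ => ⋀[ℂ]^k (Fin n → ℂ)) (i := 2) ?_ hy
      change _ ∈ LinearMap.range (ExteriorAlgebra.ι ℂ (M := Fin n → ℂ)) ^ 2
      rw [pow_two]
      exact Submodule.mul_mem_mul (LinearMap.mem_range_self _ _) (LinearMap.mem_range_self _ _)
    · have hc := Subalgebra.mem_center_iff.1 (const_mem_center (n := n) a.2)
      rw [oddCoord_eq, oddCoord_eq, ← map_mul (oddIncl ℛ n), mul_assoc, ← mul_assoc (oddIncl ℛ n _),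
        ← map_mul (oddIncl ℛ n), ← mul_assoc, ← hc, mul_assoc, ← map_mul (const ℛ n)]
  | zero =>
    rw [mul_zero]
    exact Submodule.zero_mem _
  | add x y _ _ hx hy =>
    rw [mul_add]
    exact Submodule.add_mem _ hx hy
  | smul c x _ hx =>
    rw [mul_smul_comm]
    exact Submodule.smul_mem _ _ hx

/-- Tracks the degree in `ξ`: the Berezin integral kills every power whose degree is not `n`. -/
theorem quadOdd_pow_mem_span (N : Matrix (Fin n) (Fin n) (evenPart ℛ)) (m : ℕ) :
    quadOdd ℛ N ^ m ∈ Submodule.span ℂ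
      {t | ∃ y ∈ ⋀[ℂ]^(2 * m) (Fin n → ℂ), ∃ r, t = oddIncl ℛ n y * const ℛ n r} := by
  induction m with
  | zero =>
    refine Submodule.subset_span ⟨1, ?_, 1, ?_⟩
    · exact SetLike.one_mem_graded fun k : ℕ => ⋀[ℂ]^k (Fin n → ℂ)
    · simp
  | succ m ih =>
    rw [pow_succ', quadOdd, Finset.sum_mul]
    refine Submodule.sum_mem _ fun i _ => ?_
    rw [Finset.sum_mul]
    exact Submodule.sum_mem _ fun j _ => oddCoord_mul_oddCoord_mul_mem_span ih _ _ _

theorem berezinR_quadOdd_pow_eq_zero (N : Matrix (Fin n) (Fin n) (evenPart ℛ)) {m : ℕ}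
    (hm : 2 * m ≠ n) : berezinR ℛ n (quadOdd ℛ N ^ m) = 0 := by
  have h := quadOdd_pow_mem_span N m
  generalize quadOdd ℛ N ^ m = t at h ⊢
  induction h using Submodule.span_induction with
  | mem t ht =>
    obtain ⟨y, hy, r, rfl⟩ := ht
    rw [berezinR_oddIncl_mul_const, berezin_eq_zero hm hy, zero_smul]
  | zero => rw [map_zero]
  | add x y _ _ hx hy => rw [map_add, hx, hy, add_zero]
  | smul c x _ hx => rw [map_smul, hx, smul_zero]

theorem exists_map_quadElt (N : Matrix (Fin n) (Fin n) (evenPart ℛ)) :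
    ∃ f : ExteriorAlgebra (evenPart ℛ) (Fin n → evenPart ℛ) →+* OddFun ℛ n,
      (∀ (a : evenPart ℛ) (t), f (a • t) = const ℛ n (a : R) * f t) ∧
        f (quadElt N (Pi.basisFun (evenPart ℛ) (Fin n))) = quadOdd ℛ N ∧
        f (ExteriorAlgebra.ιMulti _ n (Pi.basisFun (evenPart ℛ) (Fin n))) =
          oddIncl ℛ n (ExteriorAlgebra.ιMulti ℂ n fun i => Pi.single i 1) := by
  obtain ⟨f, hf, hf'⟩ := exists_exteriorAlgebra_hom ℛ n
  have hs (a : evenPart ℛ) (t) : f (a • t) = const ℛ n (a : R) * f t := by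
    rw [Algebra.smul_def, map_mul, hf]
  refine ⟨f, hs, ?_, ?_⟩
  · simp_rw [quadElt, map_sum, hs, map_mul, hf']
    rfl
  · rw [ExteriorAlgebra.ιMulti_apply, ExteriorAlgebra.ιMulti_apply, map_list_prod, map_list_prod,
      List.map_ofFn, List.map_ofFn]
    congr 2
    funext i
    exact hf' i

theorem quadOdd_pow_eq_zero (N : Matrix (Fin n) (Fin n) (evenPart ℛ)) {j : ℕ} (hj : n < 2 * j) :
    quadOdd ℛ N ^ j = 0 := by
  obtain ⟨f, -, hf, -⟩ := exists_map_quadElt N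
  rw [← hf, ← map_pow, quadElt_pow_eq_zero N hj, map_zero]

theorem isNilpotent_quadOdd (N : Matrix (Fin n) (Fin n) (evenPart ℛ)) :
    IsNilpotent (quadOdd ℛ N) :=
  ⟨n + 1, quadOdd_pow_eq_zero N (by omega)⟩

theorem det_eq_zero_of_transpose_eq_neg {A : Type*} [CommRing A] [Algebra ℂ A]
    {N : Matrix (Fin n) (Fin n) A} (hN : N.transpose = -N) (hn : Odd n) : N.det = 0 := by
  have h : N.det = -N.det := by
    conv_lhs => rw [← Matrix.det_transpose, hN, Matrix.det_neg, Fintype.card_fin, hn.neg_one_pow,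
      neg_one_mul]
  have h2 : (2 : ℂ) • N.det = 0 := by
    rw [two_smul]
    exact eq_neg_iff_add_eq_zero.1 h
  simpa using h2

theorem berezinR_nilExp_quadOdd (N : Matrix (Fin n) (Fin n) (evenPart ℛ)) :
    berezinR ℛ n (nilExp ((1 / 2 : ℂ) • quadOdd ℛ N)) = ∑ j ∈ Finset.range (n + 1),
      ((j.factorial : ℂ)⁻¹ * (1 / 2) ^ j) • berezinR ℛ n (quadOdd ℛ N ^ j) := by
  rw [nilExp_eq_sum (K := n + 1)
    (by rw [smul_pow, quadOdd_pow_eq_zero N (by omega), smul_zero]), map_sum]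
  refine Finset.sum_congr rfl fun j _ => ?_
  rw [smul_pow, smul_smul, map_smul]

/-- The Berezin integral of `exp(½ ∑ N i j ξⁱ ξʲ)` is a Pfaffian of `N`, up to sign: it is an even
square root of `det N`. -/
theorem exists_berezinR_nilExp_eq {N : Matrix (Fin n) (Fin n) (evenPart ℛ)}
    (hN : N.transpose = -N) :
    ∃ F : evenPart ℛ, F ^ 2 = N.det ∧
      berezinR ℛ n (nilExp ((1 / 2 : ℂ) • quadOdd ℛ N)) = F := by
  rw [berezinR_nilExp_quadOdd]
  rcases Nat.even_or_odd' n with ⟨m, hm | hm⟩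
  · obtain ⟨c, hc, hc2⟩ := exists_quadElt_pow_eq hN hm
    obtain ⟨f, hs, hf, htop⟩ := exists_map_quadElt N
    have hpow : quadOdd ℛ N ^ m =
        const ℛ n c * oddIncl ℛ n (ExteriorAlgebra.ιMulti ℂ n fun i => Pi.single i 1) := by
      rw [← hf, ← map_pow, hc, hs, htop]
    have hb : berezinR ℛ n (quadOdd ℛ N ^ m) = (-1 : ℂ) ^ (n * (n - 1) / 2) • (c : R) := by
      rw [hpow, ← Subalgebra.mem_center_iff.1 (const_mem_center (n := n) c.2),
        berezinR_oddIncl_mul_const, berezin_top]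
    -- Only the `m`-th term of the exponential has degree `n`. Its coefficient `1 / (2 ^ m m!)`
    -- normalizes `c` to a square root of the determinant; the sign is that of the Berezin integral.
    refine ⟨((m.factorial : ℂ)⁻¹ * (1 / 2) ^ m * (-1) ^ (n * (n - 1) / 2)) • c, ?_, ?_⟩
    · have h1 : ((-1 : ℂ) ^ (n * (n - 1) / 2)) ^ 2 = 1 := by
        rw [← pow_mul, mul_comm, pow_mul, neg_one_sq, one_pow]
      have hm0 : (m.factorial : ℂ) ≠ 0 := Nat.cast_ne_zero.2 m.factorial_ne_zero
      have h3 : (2 ^ m * m.factorial : evenPart ℛ) ^ 2 * N.det =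
          ((2 : ℂ) ^ m * m.factorial) ^ 2 • N.det := by
        rw [Algebra.smul_def, map_pow, map_mul, map_pow, map_ofNat, map_natCast]
      rw [smul_pow, hc2, h3, smul_smul, ← mul_pow]
      have h4 : (m.factorial : ℂ)⁻¹ * (1 / 2) ^ m * (-1) ^ (n * (n - 1) / 2) *
          (2 ^ m * m.factorial) = (-1) ^ (n * (n - 1) / 2) := by
        field_simp
        rw [← mul_pow]
        norm_num
      rw [h4, h1, one_smul]
    · rw [Finset.sum_eq_single m, hb, smul_smul]
      · rfl
      · intro j _ hj
        rw [berezinR_quadOdd_pow_eq_zero N (by omega), smul_zero]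
      · intro h
        exact absurd (Finset.mem_range.2 (by omega)) h
  -- For odd `n` both sides vanish: no even power has degree `n`, and an antisymmetric matrix of odd
  -- size has determinant zero.
  · refine ⟨0, ?_, ?_⟩
    · rw [det_eq_zero_of_transpose_eq_neg hN ⟨m, hm⟩, zero_pow two_ne_zero]
    · rw [ZeroMemClass.coe_zero]
      refine Finset.sum_eq_zero fun j _ => ?_
      rw [berezinR_quadOdd_pow_eq_zero N (by omega), smul_zero]

end BerezinGaussian

end

end SuperPf

namespace SuperPf

noncomputable section

/-! ### The square of the superPfaffian -/

theorem map_gaussFun {ι Q Q' : Type*} [Fintype ι] [CommRing Q] [Algebra ℂ Q] [CommRing Q']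
    [Algebra ℂ Q'] (f : Q →ₐ[ℂ] Q') {S₀ : Matrix ι ι ℂ} {S : Matrix ι ι Q} {w : ι → Q}
    (hS : ∀ i j, IsNilpotent (S i j - algebraMap ℂ Q (S₀ i j))) (hw : ∀ i, IsNilpotent (w i))
    (x : ι → ℝ) : f (gaussFun S₀ S w x) = gaussFun S₀ (S.map f) (f ∘ w) x := by
  rw [gaussFun, map_smul,
    map_nilExp f (mem_nilradical.1 (gaussExponent_sub_mem_nilradical hS hw x)),
    map_sub, map_gaussExponent, AlgHom.commutes]
  rfl

theorem eq_of_mul_mul_eq {Q : Type*} [CommRing Q] {x y d u : Q} (hu : IsUnit u)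
    (hx : x * y * d = u) (hy : y * y * d = u) : x = y := by
  have h : IsUnit (y * d) := isUnit_of_mul_isUnit_right (by rwa [← hy, mul_assoc] at hu)
  exact h.mul_right_cancel (by rw [← mul_assoc, ← mul_assoc, hx, hy])

section Main

variable {V₀ V₁ : Type*} [AddCommGroup V₀] [Module ℝ V₀] [AddCommGroup V₁] [Module ℝ V₁]
  {B : SymplecticForm V₀ V₁} {k n : ℕ} (β : SymplecticBasis B k n)
  {R : Type*} [Ring R] [Algebra ℂ R] {ℛ : ZMod 2 → Submodule ℂ R} [GradedAlgebra ℛ]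

/-- The shift may involve elements of `Q'` outside the image of `Q`, but it does not affect the
value, which is therefore the image of the unshifted integral computed in `Q`. It is applied with `Q
= R₀` and `Q'` the center of `OddFun`. -/
theorem converges_and_vectorIntegral_gaussFun_map {ι Q Q' : Type*} [Fintype ι] [DecidableEq ι]
    [CommRing Q] [Algebra ℂ Q] [FiniteDimensional ℂ Q] [CommRing Q'] [Algebra ℂ Q']
    [FiniteDimensional ℂ Q'] (f : Q →ₐ[ℂ] Q') {S₀ : Matrix ι ι ℂ} {S : Matrix ι ι Q} {w : ι → Q'}
    (hpos : ∀ x : ι → ℝ, x ≠ 0 → 0 < ∑ i, ∑ j, (S₀ i j).re * x i * x j) (hsymm : S.IsSymm)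
    (hS : ∀ i j, IsNilpotent (S i j - algebraMap ℂ Q (S₀ i j))) (hw : ∀ i, IsNilpotent (w i)) :
    Converges (gaussFun S₀ (S.map f) w) ∧
      vectorIntegral (gaussFun S₀ (S.map f) w) = f (vectorIntegral (gaussFun S₀ S 0)) := by
  have hS' (i j) : IsNilpotent (S.map f i j - algebraMap ℂ Q' (S₀ i j)) := by
    have := (hS i j).map f
    rwa [map_sub, AlgHom.commutes] at this
  have h0 (i : ι) : IsNilpotent ((0 : ι → Q) i) := IsNilpotent.zero
  have h0' (i : ι) : IsNilpotent ((0 : ι → Q') i) := IsNilpotent.zero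
  obtain ⟨hconv, hw⟩ := gaussian_integral hpos (hsymm.map f) hS' hw h0'
  obtain ⟨-, hz⟩ := gaussian_integral hpos (hsymm.map f) hS' h0' h0'
  have hu : IsUnit (algebraMap ℂ Q' (((2 * Real.pi) ^ Fintype.card ι : ℝ) : ℂ)) :=
    (isUnit_iff_ne_zero.2 (Complex.ofReal_ne_zero.2 (by positivity))).map _
  refine ⟨hconv, (eq_of_mul_mul_eq hu hw hz).trans ?_⟩
  refine Eq.trans ?_
    (map_vectorIntegral (gaussian_integral hpos hsymm hS h0 h0).1 f.toLinearMap).symm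
  congr 1
  funext x
  have h : f ∘ (0 : ι → Q) = 0 := funext fun _ => map_zero f
  rw [← h]
  exact (map_gaussFun f hS h0 x).symm

theorem superExp_eq (b : R →ₐ[ℂ] ℂ) (α : OddFun ℛ n) :
    superExp ℛ b α = Complex.exp (oddBody ℛ b n α) •
      nilExp (α - algebraMap ℂ _ (oddBody ℛ b n α)) := rfl

variable [IsSupercommutative ℛ]

namespace SpoPoint

variable (X : SpoPoint B ℛ)

/-- The even exponent is central, so the exponential of the sum factors into an even Gaussian and an
odd one that does not depend on `x`. -/
theorem integrand_eq {b : R →ₐ[ℂ] ℂ} (hdet : IsUnit (X.formEven β).det)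
    (hS : ∀ i j, IsNilpotent (X.formEven β i j - algebraMap ℂ _ (b (X.formEven β i j))))
    (x : Fin k × Fin 2 → ℝ) :
    X.integrand β b x = berezinR ℛ n
      (((gaussFun (Matrix.of fun i j => b (X.formEven β i j))
        ((X.formEven β).map (constCenter ℛ n)) (X.momentShift β) x :
          Subalgebra.center ℂ (OddFun ℛ n)) : OddFun ℛ n) *
        nilExp ((1 / 2 : ℂ) • quadOdd ℛ (X.pfaffMatrix β))) := by
  have hS' (i j) : IsNilpotent ((X.formEven β).map (constCenter ℛ n) i j -
      algebraMap ℂ _ (Matrix.of (fun i j => b (X.formEven β i j)) i j)) := by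
    have := (hS i j).map (constCenter ℛ n)
    rwa [map_sub, AlgHom.commutes] at this
  have hnil := mem_nilradical.1
    (gaussExponent_sub_mem_nilradical hS' (X.isNilpotent_momentShift β) x)
  rw [integrand, superExp_eq, oddBody_moment, moment_eq_gaussExponent β X hdet, add_sub_right_comm]
  rw [gaussFun]
  set s := gaussExponent ((X.formEven β).map (constCenter ℛ n)) (X.momentShift β) x with hs
  set z := gaussExponent (Matrix.of fun i j => b (X.formEven β i j)) 0 x with hz
  have h1 : (s : OddFun ℛ n) - algebraMap ℂ _ z =
      (Subalgebra.center ℂ (OddFun ℛ n)).val (s - algebraMap ℂ _ z) := rfl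
  have h2 : Commute ((Subalgebra.center ℂ (OddFun ℛ n)).val (s - algebraMap ℂ _ z))
      ((1 / 2 : ℂ) • quadOdd ℛ (X.pfaffMatrix β)) :=
    (Subalgebra.mem_center_iff.1 (s - algebraMap ℂ _ z).2 _).symm
  have h3 := map_nilExp (Subalgebra.center ℂ (OddFun ℛ n)).val hnil
  rw [h1, nilExp_add h2 (hnil.map (Subalgebra.center ℂ (OddFun ℛ n)).val)
    ((isNilpotent_quadOdd _).smul _), ← smul_mul_assoc]
  exact congrArg (fun t => berezinR ℛ n (Complex.exp z • t * nilExp _)) h3.symm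

theorem converges_and_superPf_sq [FiniteDimensional ℂ R] {b : R →ₐ[ℂ] ℂ} (hX : X.body b ∈ tube B)
    (hS : ∀ i j, IsNilpotent (X.formEven β i j - algebraMap ℂ _ (b (X.formEven β i j)))) :
    Converges (X.integrand β b) ∧ IsUnit (X.blockA β).det ∧ X.superPf β b ^ 2 = X.invBer β := by
  have := finiteDimensional_oddFun ℛ n
  set S₀ : Matrix (Fin k × Fin 2) (Fin k × Fin 2) ℂ := Matrix.of fun i j => b (X.formEven β i j)
  have hpos (x : Fin k × Fin 2 → ℝ) (hx : x ≠ 0) : 0 < ∑ i, ∑ j, (S₀ i j).re * x i * x j :=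
    X.formEven_body_pos β hX x hx
  set c : ℂ := (((2 * Real.pi) ^ k : ℝ) : ℂ) with hcdef
  have hc0 : c ≠ 0 := Complex.ofReal_ne_zero.2 (by positivity)
  have hc2 : (((2 * Real.pi) ^ Fintype.card (Fin k × Fin 2) : ℝ) : ℂ) = c ^ 2 := by
    rw [hcdef, Fintype.card_prod, Fintype.card_fin, Fintype.card_fin, pow_mul, Complex.ofReal_pow]
  have hcu {Q : Type _} [CommRing Q] [Algebra ℂ Q] : IsUnit (algebraMap ℂ Q (c ^ 2)) :=
    (isUnit_iff_ne_zero.2 (pow_ne_zero 2 hc0)).map _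
  have h0 (i : Fin k × Fin 2) : IsNilpotent ((0 : Fin k × Fin 2 → evenPart ℛ) i) :=
    IsNilpotent.zero
  obtain ⟨-, hδ⟩ := gaussian_integral hpos (X.formEven_isSymm β) hS h0 h0
  set δ := vectorIntegral (gaussFun S₀ (X.formEven β) 0)
  rw [hc2] at hδ
  -- Invertibility is read off from the Gaussian formula, which makes the determinant a factor of a
  -- nonzero power of `2π`.
  have hdet : IsUnit (X.formEven β).det := isUnit_of_mul_isUnit_right (hδ ▸ hcu)
  have hJ := converges_and_vectorIntegral_gaussFun_map (constCenter ℛ n) hpos (X.formEven_isSymm β)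
    hS (X.isNilpotent_momentShift β)
  obtain ⟨F, hF, hFb⟩ := exists_berezinR_nilExp_eq (X.pfaffMatrix_transpose β)
  set E := nilExp ((1 / 2 : ℂ) • quadOdd ℛ (X.pfaffMatrix β))
  let L : Subalgebra.center ℂ (OddFun ℛ n) →ₗ[ℂ] R :=
    berezinR ℛ n ∘ₗ LinearMap.mulRight ℂ E ∘ₗ (Subalgebra.center ℂ (OddFun ℛ n)).val.toLinearMap
  have hint : X.integrand β b = fun x =>
      L (gaussFun S₀ ((X.formEven β).map (constCenter ℛ n)) (X.momentShift β) x) :=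
    funext fun x => X.integrand_eq β hdet hS x
  have hval : vectorIntegral (X.integrand β b) = (δ * F : evenPart ℛ) := by
    rw [hint, ← map_vectorIntegral hJ.1, hJ.2]
    -- The value `δ` of the even integral is an element of `R₀`, so it leaves the Berezin integral
    -- as a factor.
    exact (berezinR_const_mul δ.2 E).trans (by rw [hFb]; rfl)
  have hdetA := X.det_formEven β
  refine ⟨hint ▸ hJ.1.map L, hdetA ▸ hdet, ?_⟩
  rw [superPf, hval, invBer, ← X.det_pfaffMatrix β, ← hF, ← hdetA]
  have key : (c⁻¹ • (δ * F)) ^ 2 = Ring.inverse (X.formEven β).det * F ^ 2 := by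
    have h2 : (c⁻¹ • δ) ^ 2 * (X.formEven β).det = 1 := by
      rw [smul_pow, smul_mul_assoc, pow_two δ, hδ, Algebra.smul_def, ← map_mul, inv_pow,
        inv_mul_cancel₀ (pow_ne_zero 2 hc0), map_one]
    have h3 : Ring.inverse (X.formEven β).det = (c⁻¹ • δ) ^ 2 := by
      rw [← mul_one (Ring.inverse _), ← h2, mul_comm ((c⁻¹ • δ) ^ 2),
        Ring.inverse_mul_cancel_left _ _ hdet]
    rw [h3, ← mul_pow, smul_mul_assoc]
  rw [← key]
  rfl

end SpoPoint

end Main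

end

end SuperPf

namespace SuperPf

noncomputable section

/-! ### Body and soul at the generic point -/

section Generic

variable {V₀ V₁ : Type*} [AddCommGroup V₀] [Module ℝ V₀] [AddCommGroup V₁] [Module ℝ V₁]
  {B : SymplecticForm V₀ V₁} [FiniteDimensional ℝ V₀] [FiniteDimensional ℝ V₁]

theorem finiteDimensional_lambdaSpo : FiniteDimensional ℂ (LambdaSpo B) := by
  have : FiniteDimensional ℂ (spoOdd B →ₗ[ℝ] ℂ) := Module.Finite.of_restrictScalars_finite ℝ ℂ _
  exact finiteDimensional_exteriorAlgebra _

theorem genericPoint_body (Y : spoEven B ⊗[ℝ] ℂ) :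
    (genericPoint B Y).body ExteriorAlgebra.algebraMapInv = Y := by
  rw [SpoPoint.body, genericPoint, ← LinearMap.lTensor_comp_apply]
  convert LinearMap.id_apply (R := ℝ) Y
  rw [← LinearMap.lTensor_id]
  congr 1
  exact LinearMap.ext fun z => ExteriorAlgebra.algebraMap_leftInverse (R := ℂ) _ z

/-- The odd generators enter only the odd blocks, so the even form equals its body and the
nilpotency condition is trivial. -/
theorem genericPoint_formEven {k n : ℕ} (β : SymplecticBasis B k n) (Y : spoEven B ⊗[ℝ] ℂ) (i j) :
    ∃ z : ℂ, (genericPoint B Y).formEven β i j = algebraMap ℂ _ z :=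
  ⟨_, contract_lTensor _ _ _⟩

end Generic

/-! ### Nilpotency of the soul over a near superalgebra -/

section Near

variable {P : Type*} [Ring P] [Algebra ℝ P] (𝒢 : ZMod 2 → Submodule ℝ P) [GradedAlgebra 𝒢]
  [IsNear 𝒢]

/-- The descending chain of right ideals `p ^ m P` stabilizes, so `p ^ m (1 - p q) = 0` for some
`q`. As `p q` has body zero it is not a unit, so by locality `1 - p q` is one. -/
theorem isNilpotent_of_body_eq_zero {p : P} (hp : body 𝒢 p = 0) : IsNilpotent p := by
  have : FiniteDimensional ℝ P := IsNear.finiteDimensional (𝒢 := 𝒢)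
  have : IsLocalRing P := IsNear.isLocalRing (𝒢 := 𝒢)
  let f : ℕ →o (Submodule ℝ P)ᵒᵈ :=
    ⟨fun m => OrderDual.toDual (LinearMap.range (LinearMap.mulLeft ℝ (p ^ m))),
      monotone_nat_of_le_succ fun m => by
        rintro _ ⟨q, rfl⟩
        exact ⟨p * q, by simp [pow_succ]⟩⟩
  obtain ⟨m, hm⟩ := IsArtinian.monotone_stabilizes f
  have h1 : LinearMap.range (LinearMap.mulLeft ℝ (p ^ m)) =
      LinearMap.range (LinearMap.mulLeft ℝ (p ^ (m + 1))) := hm (m + 1) m.le_succ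
  obtain ⟨q, hq⟩ : p ^ m ∈ LinearMap.range (LinearMap.mulLeft ℝ (p ^ (m + 1))) :=
    h1 ▸ ⟨1, by simp⟩
  refine ⟨m, ?_⟩
  have h2 : p ^ m * (1 - p * q) = 0 := by
    rw [mul_sub, mul_one, ← mul_assoc, ← pow_succ]
    exact sub_eq_zero.2 hq.symm
  rcases IsLocalRing.isUnit_or_isUnit_of_add_one (add_sub_cancel (p * q) 1) with h | h
  · have := h.map (body 𝒢)
    rw [map_mul, hp, zero_mul] at this
    exact absurd this not_isUnit_zero
  · exact h.mul_left_eq_zero.1 h2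

/-- The complexified even part is spanned by the `1 ⊗ p` with `p` even, where the real case applies.
Even elements are central, so sums of the nilpotents obtained remain nilpotent. -/
theorem isNilpotent_sub_bodyC {t : ℂ ⊗[ℝ] P} (ht : t ∈ complexify 𝒢 0) :
    IsNilpotent (t - algebraMap ℂ _ (bodyC 𝒢 t)) := by
  have ht' : t ∈ (𝒢 0).baseChange ℂ := ht
  rw [Submodule.baseChange_eq_span] at ht'
  clear ht
  induction ht' using Submodule.span_induction with
  | mem x hx =>
    obtain ⟨p, hp, rfl⟩ := hx
    obtain ⟨m, hm⟩ := isNilpotent_of_body_eq_zero 𝒢 (p := p - algebraMap ℝ P (body 𝒢 p))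
      (by rw [map_sub, AlgHom.commutes]; exact sub_self _)
    refine ⟨m, ?_⟩
    have h : TensorProduct.mk ℝ ℂ P 1 p - algebraMap ℂ _ (bodyC 𝒢 (TensorProduct.mk ℝ ℂ P 1 p)) =
        (1 : ℂ) ⊗ₜ[ℝ] (p - algebraMap ℝ P (body 𝒢 p)) := by
      rw [TensorProduct.tmul_sub]
      congr 1
      rw [Algebra.algebraMap_eq_smul_one (body 𝒢 p), TensorProduct.tmul_smul,
        TensorProduct.smul_tmul']
      simp [bodyC, Algebra.TensorProduct.algebraMap_apply, Algebra.ofId_apply]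
    rw [h, Algebra.TensorProduct.tmul_pow, hm, TensorProduct.tmul_zero]
  | zero => simp
  | add x y hx hy ihx ihy =>
    rw [← Submodule.baseChange_eq_span] at hx hy
    rw [map_add, map_add, add_sub_add_comm]
    refine Commute.isNilpotent_add ?_ ihx ihy
    have hc : Commute x (y - algebraMap ℂ _ (bodyC 𝒢 y)) :=
      IsSupercommutative.even_comm (ℛ := complexify 𝒢) x hx _
    exact hc.sub_left (Algebra.commutes _ _)
  | smul c x hx ih =>
    rw [map_smul, smul_eq_mul, map_mul, ← Algebra.smul_def, ← smul_sub]
    exact ih.smul c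

end Near

theorem isNilpotent_evenPart_iff {R : Type*} [Ring R] [Algebra ℂ R] {ℛ : ZMod 2 → Submodule ℂ R}
    [GradedAlgebra ℛ] {a : evenPart ℛ} : IsNilpotent a ↔ IsNilpotent (a : R) :=
  (IsNilpotent.map_iff (f := (evenPart ℛ).val) Subtype.val_injective).symm

end

end SuperPf

theorem mainTheorem4 {V₀ V₁ : Type*} [AddCommGroup V₀] [Module ℝ V₀] [FiniteDimensional ℝ V₀]
    [AddCommGroup V₁] [Module ℝ V₁] [FiniteDimensional ℝ V₁]
    (B : SuperPf.SymplecticForm V₀ V₁) {k n : ℕ} (β : SuperPf.SymplecticBasis B k n) :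
    ((∀ Y : SuperPf.tube B,
        SuperPf.Converges
          ((SuperPf.genericPoint B Y).integrand β ExteriorAlgebra.algebraMapInv) ∧
        IsUnit ((SuperPf.genericPoint B Y).blockA β).det) ∧
      SuperPf.superPfFun β ^ 2 = SuperPf.invBerFun β) ∧
    ∀ {P : Type*} [Ring P] [Algebra ℝ P] (𝒢 : ZMod 2 → Submodule ℝ P) [GradedAlgebra 𝒢]
      [SuperPf.IsNear 𝒢] (X : SuperPf.SpoPoint B (SuperPf.complexify 𝒢)),
      X.body (SuperPf.bodyC 𝒢) ∈ SuperPf.tube B →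
        SuperPf.Converges (X.integrand β (SuperPf.bodyC 𝒢)) ∧
        IsUnit (X.blockA β).det ∧
        X.superPf β (SuperPf.bodyC 𝒢) ^ 2 = X.invBer β := by
  refine ⟨?_, fun {P} _ _ 𝒢 _ _ X hX => ?_⟩
  · have := SuperPf.finiteDimensional_lambdaSpo (B := B)
    have key (Y : SuperPf.tube B) := (SuperPf.genericPoint B Y).converges_and_superPf_sq β
      (b := ExteriorAlgebra.algebraMapInv) (by rw [SuperPf.genericPoint_body]; exact Y.2)
      fun i j => by
        obtain ⟨z, hz⟩ := SuperPf.genericPoint_formEven β Y.1 i j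
        have h : ExteriorAlgebra.algebraMapInv
            ((algebraMap ℂ (SuperPf.evenPart (SuperPf.extGrading (SuperPf.spoOdd B →ₗ[ℝ] ℂ))) z :
              SuperPf.LambdaSpo B)) = z := ExteriorAlgebra.algebraMap_leftInverse _ z
        rw [hz, h, sub_self]
        exact IsNilpotent.zero
    exact ⟨fun Y => ⟨(key Y).1, (key Y).2.1⟩, funext fun Y => (key Y).2.2⟩
  · have : FiniteDimensional ℝ P := SuperPf.IsNear.finiteDimensional (𝒢 := 𝒢)
    exact X.converges_and_superPf_sq β hX fun i j =>
      SuperPf.isNilpotent_evenPart_iff.2 (SuperPf.isNilpotent_sub_bodyC 𝒢 (X.formEven β i j).2)
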